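/- Let $X$ be a complete, connected $C^\infty$ Riemannian manifold with volume measure $dx$ (also written $\operatorname{vol}$), $\operatorname{vol}(X)=\infty$. Fix $x_0\in X$, let $B(x,r)$ denote the closed ball of radius $r$ centered at $x$, and put $B(r):=B(x_0,r)$. Assume that there are $m\in\mathbb N=\{1,2,\dots\}$ and $C>0$ with $$\operatorname{vol}(B(\beta r))\le C\beta^m\operatorname{vol}(B(r)),\qquad r>0,\ \beta\ge1 .$$ Let $\Gamma$ be the set of all infinite, locally finite subsets of $X$, with the vague topology (the coarsest topology for which all maps $\gamma\mapsto\sum_{x\in\gamma}\varphi(x)$, $\varphi$ continuous with compact support, are continuous) and its Borel $\sigma$-algebra. Let $\alpha\ge1$ and let $$\Theta_\alpha:=\{\gamma\in\Gamma:\ \exists K\in\mathbb N\ \forall r\in\mathbb N:\ |\gamma\cap B(r)|\le K\operatorname{vol}(B(r))^\alpha\},$$ with the trace $\sigma$-algebra. Let $(p_t)_{t\ge0}$ be a Markov semigroup of kernels on $X$ (that is, the $p_t$ are Markov kernels, $p_0(x,\cdot)=\varepsilon_x$, and $p_{s+t}=p_sp_t$) such that $$p_t(x,\cdot)\otimes p_t(y,\cdot)\big(\{(u,v):u=v\}\big)=0,\qquad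 x\ne y,\ t>0,$$ and $$\exists\,\epsilon>0\ \ \forall t\in(0,\epsilon)\ \ \forall\delta>0:\quad \sum_{n=1}^\infty\ \sup_{x\in X}p_t\big(x,B(x,\delta n^{1/(\alpha m)})^c\big)<\infty .$$ Then every $\gamma\in\Theta_\alpha$ satisfies $$\sum_{x\in\gamma}p_t(x,B(r))<\infty,\qquad t>0,\ r\in\mathbb N.$$ Moreover, for $\gamma\in\Theta_\alpha$, $t\ge0$ and a numeration $\gamma=\{x_n\}_{n=1}^\infty$, the product measure $\bigotimes_{n}p_t(x_n,\cdot)$ is concentrated on the set of sequences $(y_n)$ of pairwise distinct points without accumulation points in $X$; its image ${\bf P}_t(\gamma,\cdot)$ under $(y_n)\mapsto\{y_n:n\in\mathbb N\}$ is a probability measure on $\Gamma$ which does not depend on the numeration; and ${\bf P}_t(\gamma,\Theta_\alpha)=1$ and $({\bf P}_t)_{t\ge0}$ is a Markov semigroup of kernels on $\Theta_\alpha$. Additionally, let $z>0$, let $\pi_z$ be the Poisson measure on $\Gamma$ with intensity measure $z\,dx$, and let $(T_t)_{t\ge0}$ be a semigroup of self-adjoint contractions in $L^2(X,z\,dx)$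 with $T_0=1$ that are Markov operators, and to which $(p_t)$ corresponds: $x\mapsto\int f(y)\,p_t(x,dy)$ is a version of $T_tf$ for all $f\in L^2(X,z\,dx)$, $t\ge 0$. (An operator $A$ is Markov if $0\le f\le1$ a.e. implies $0\le Af\le1$ a.e., and $Af_n\nearrow1$ a.e. for some sequence $f_n\nearrow1$ in $L^2$.) Let $\operatorname{Exp}(T_t)$ be the second quantization of $T_t$, realized in $L^2(\Gamma,\pi_z)$: the bounded linear operator with $$\operatorname{Exp}(T_t)\,I_n(f^{\otimes n})=I_n\big((T_tf)^{\otimes n}\big),\qquad f\in L^2(X,z\,dx),\ n\ge0,$$ where $I_n:L^2(X^n,(z\,dx)^{\otimes n})\to L^2(\Gamma,\pi_z)$ is the $n$-fold multiple stochastic integral with respect to the compensated Poisson random measure. Then for all $t>0$ and $F\in L^2(\Gamma,\pi_z)$: for $\pi_z$-almost every $\gamma\in\Gamma$ one has $\gamma\in\Theta_\alpha$, $F$ is integrable with respect to ${\bf P}_t(\gamma,\cdot)$, and $$\int_{\Theta_\alpha}F(\xi)\,{\bf P}_t(\gamma,d\xi)=\big(\operatorname{Exp}(T_t)F\big)(\gamma),$$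 i.e. the left-hand side is a $\pi_z$-version of $\operatorname{Exp}(T_t)F$. -/

import Mathlib

open MeasureTheory ProbabilityTheory Set Filter Topology
open scoped NNReal ENNReal ContDiff Manifold Bundle

namespace InfiniteParticles

noncomputable section

section Volume

theorem euclidean_sum_single {d : ℕ} (v : EuclideanSpace ℝ (Fin d)) :
    v = ∑ k, v k • EuclideanSpace.single k (1 : ℝ) := by
  ext i
  simp [Finset.sum_apply, Pi.single_apply]

variable {d : ℕ} {X : Type*} [TopologicalSpace X] [ChartedSpace (EuclideanSpace ℝ (Fin d)) X]

/-- The inverse of the preferred chart at `c`, as a map from `ℝ^d` to the manifold. -/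
def chartInv (d : ℕ) {X : Type*} [TopologicalSpace X] [ChartedSpace (EuclideanSpace ℝ (Fin d)) X]
    (c : X) : EuclideanSpace ℝ (Fin d) → X :=
  (chartAt (EuclideanSpace ℝ (Fin d)) c).symm

theorem chart_image_eq (c : X) {A : Set X}
    (hs : A ⊆ (chartAt (EuclideanSpace ℝ (Fin d)) c).source) :
    chartAt (EuclideanSpace ℝ (Fin d)) c '' A
      = (chartAt (EuclideanSpace ℝ (Fin d)) c).target ∩ chartInv d c ⁻¹' A := by
  have h := (chartAt (EuclideanSpace ℝ (Fin d)) c).image_source_inter_eq' A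
  rwa [inter_eq_self_of_subset_right hs] at h

theorem measurableSet_chart_image [MeasurableSpace X] [BorelSpace X] (c : X) {A : Set X}
    (hA : MeasurableSet A) (hs : A ⊆ (chartAt (EuclideanSpace ℝ (Fin d)) c).source) :
    MeasurableSet (chartAt (EuclideanSpace ℝ (Fin d)) c '' A) := by
  rw [chart_image_eq c hs]
  set e := chartAt (EuclideanSpace ℝ (Fin d)) c
  have h := e.continuousOn_symm.domRestrict.measurable hA
  have h2 := (MeasurableEmbedding.subtype_coe e.open_target.measurableSet).measurableSet_image.2 h
  convert h2 using 1
  ext u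
  constructor
  · rintro ⟨h1, h3⟩
    exact ⟨⟨u, h1⟩, h3, rfl⟩
  · rintro ⟨⟨u, h1⟩, h3, rfl⟩
    exact ⟨h1, h3⟩

variable [Bundle.RiemannianBundle (fun x : X => TangentSpace (𝓡 d) x)]

/-- The Riemannian metric `g_x(v, w)`. -/
def metricForm (x : X) (v w : TangentSpace (𝓡 d) x) : ℝ := inner ℝ v w

/-- The `i`-th coordinate vector field of the chart at `c`, at the point with coordinates `u`. -/
def coordVector (c : X) (u : EuclideanSpace ℝ (Fin d)) (i : Fin d) :
    TangentSpace (𝓡 d) (chartInv d c u) :=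
  mfderiv (𝓡 d) (𝓡 d) (chartInv d c) u (EuclideanSpace.single i (1 : ℝ))

/-- The matrix `(g_{ij}(u))` of the Riemannian metric in the chart at `c`. -/
def metricMatrix (c : X) (u : EuclideanSpace ℝ (Fin d)) : Matrix (Fin d) (Fin d) ℝ :=
  Matrix.of fun i j => metricForm (chartInv d c u) (coordVector c u i) (coordVector c u j)

/-- The density `√(det g_{ij}(u))`. -/
def volumeDensity (c : X) (u : EuclideanSpace ℝ (Fin d)) : ℝ :=
  Real.sqrt (metricMatrix c u).det

/-- `v` is the Riemannian volume measure: in every chart, it is `√(det g_{ij}) du`. -/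
def IsRiemannianVolume [MeasurableSpace X] (d : ℕ) [ChartedSpace (EuclideanSpace ℝ (Fin d)) X]
    [Bundle.RiemannianBundle (fun x : X => TangentSpace (𝓡 d) x)] (v : Measure X) : Prop :=
  ∀ (c : X) (A : Set X), MeasurableSet A → A ⊆ (chartAt (EuclideanSpace ℝ (Fin d)) c).source →
    v A = ∫⁻ u in chartAt (EuclideanSpace ℝ (Fin d)) c '' A, ENNReal.ofReal (volumeDensity c u)

theorem metricForm_congr {x y : X} (h : x = y) (v w : EuclideanSpace ℝ (Fin d)) :
    metricForm x v w = metricForm y v w := by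
  subst h; rfl

theorem metricForm_sum (x : X) (a b : Fin d → ℝ) (v : Fin d → TangentSpace (𝓡 d) x) :
    metricForm x (∑ k, a k • v k) (∑ l, b l • v l)
      = ∑ k, ∑ l, a k * b l * metricForm x (v k) (v l) := by
  unfold metricForm
  rw [sum_inner]
  refine Finset.sum_congr rfl fun k _ => ?_
  rw [inner_sum]
  refine Finset.sum_congr rfl fun l _ => ?_
  rw [real_inner_smul_left, real_inner_smul_right]; ring

/-- The measure `√(det g_{ij}) du` of the chart at `c`, transported to the manifold. -/
def chartVolume [MeasurableSpace X] (c : X) : Measure X :=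
  ((volume.restrict (chartAt (EuclideanSpace ℝ (Fin d)) c).target).withDensity
    fun u => ENNReal.ofReal (volumeDensity c u)).map (chartInv d c)

theorem chartVolume_apply [MeasurableSpace X] [BorelSpace X] (c : X) {A : Set X}
    (hA : MeasurableSet A) (hs : A ⊆ (chartAt (EuclideanSpace ℝ (Fin d)) c).source) :
    chartVolume (d := d) c A
      = ∫⁻ u in chartAt (EuclideanSpace ℝ (Fin d)) c '' A,
          ENNReal.ofReal (volumeDensity c u) := by
  set e := chartAt (EuclideanSpace ℝ (Fin d)) c with he
  have hm : AEMeasurable (chartInv d c) (volume.restrict e.target) :=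
    ContinuousOn.aemeasurable e.continuousOn_symm e.open_target.measurableSet
  have hm' := hm.mono_ac (withDensity_absolutelyContinuous (volume.restrict e.target)
    fun u => ENNReal.ofReal (volumeDensity c u))
  have hi := measurableSet_chart_image c hA hs
  unfold chartVolume
  rw [Measure.map_apply_of_aemeasurable hm' hA, withDensity_apply',
    Measure.restrict_restrict' e.open_target.measurableSet, inter_comm, chart_image_eq c hs]

variable [IsManifold (𝓡 d) ∞ X]

theorem volumeDensity_change (c c' : X) (u : EuclideanSpace ℝ (Fin d))
    (hu : u ∈ (chartAt (EuclideanSpace ℝ (Fin d)) c).target)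
    (hu' : chartInv d c u ∈ (chartAt (EuclideanSpace ℝ (Fin d)) c').source) :
    ∃ J : EuclideanSpace ℝ (Fin d) →L[ℝ] EuclideanSpace ℝ (Fin d),
      HasFDerivAt (fun w => chartAt (EuclideanSpace ℝ (Fin d)) c' (chartInv d c w)) J u ∧
      volumeDensity c u = |J.det| *
        volumeDensity c' (chartAt (EuclideanSpace ℝ (Fin d)) c' (chartInv d c u)) := by
  set e := chartAt (EuclideanSpace ℝ (Fin d)) c with he
  set e' := chartAt (EuclideanSpace ℝ (Fin d)) c' with he'
  have hx : chartInv d c u ∈ e.source := e.map_target hu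
  have h1 : MDifferentiableAt (𝓡 d) (𝓡 d) (chartInv d c) u :=
    ((contMDiffOn_chart_symm (I := 𝓡 d) (n := ∞) (x := c)).contMDiffAt
      (e.open_target.mem_nhds hu)).mdifferentiableAt (by simp)
  have h2 : MDifferentiableAt (𝓡 d) (𝓡 d) e' (chartInv d c u) :=
    ((contMDiffOn_chart (I := 𝓡 d) (n := ∞) (x := c')).contMDiffAt
      (e'.open_source.mem_nhds hu')).mdifferentiableAt (by simp)
  have h3 : MDifferentiableAt (𝓡 d) (𝓡 d) (chartInv d c') (e' (chartInv d c u)) :=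
    ((contMDiffOn_chart_symm (I := 𝓡 d) (n := ∞) (x := c')).contMDiffAt
      (e'.open_target.mem_nhds (e'.map_source hu'))).mdifferentiableAt (by simp)
  have h4 : MDifferentiableAt (𝓡 d) (𝓡 d) (fun w => e' (chartInv d c w)) u :=
    MDifferentiableAt.comp u h2 h1
  have h5 : DifferentiableAt ℝ (fun w => e' (chartInv d c w)) u :=
    mdifferentiableAt_iff_differentiableAt.1 h4
  refine ⟨fderiv ℝ (fun w => e' (chartInv d c w)) u, h5.hasFDerivAt, ?_⟩
  set J := fderiv ℝ (fun w => e' (chartInv d c w)) u with hJ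
  have hback : chartInv d c' (e' (chartInv d c u)) = chartInv d c u := e'.left_inv hu'
  -- the chain rule
  have hchain : ∀ v : EuclideanSpace ℝ (Fin d),
      (mfderiv (𝓡 d) (𝓡 d) (chartInv d c) u v : EuclideanSpace ℝ (Fin d))
        = mfderiv (𝓡 d) (𝓡 d) (chartInv d c') (e' (chartInv d c u)) (J v) := by
    intro v
    have hev : chartInv d c =ᶠ[𝓝 u] chartInv d c' ∘ (fun w => e' (chartInv d c w)) := by
      have hc : ContinuousAt (chartInv d c) u := h1.continuousAt
      filter_upwards [hc.preimage_mem_nhds (e'.open_source.mem_nhds hu')] with w hw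
      exact (e'.left_inv hw).symm
    have h6 := hev.mfderiv_eq (I := 𝓡 d) (I' := 𝓡 d)
    have h7 : mfderiv (𝓡 d) (𝓡 d) (chartInv d c' ∘ (fun w => e' (chartInv d c w))) u
        = (mfderiv (𝓡 d) (𝓡 d) (chartInv d c') (e' (chartInv d c u))).comp
          (mfderiv (𝓡 d) (𝓡 d) (fun w => e' (chartInv d c w)) u) :=
      mfderiv_comp u h3 h4
    have h8 : mfderiv (𝓡 d) (𝓡 d) (fun w => e' (chartInv d c w)) u = J := mfderiv_eq_fderiv
    have h9 := congrArg (fun L : EuclideanSpace ℝ (Fin d) →L[ℝ] EuclideanSpace ℝ (Fin d) => L v)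
      (h6.trans (h7.trans (by rw [h8])))
    exact h9
  set M : Matrix (Fin d) (Fin d) ℝ := Matrix.of fun k i =>
    (J (EuclideanSpace.single i (1 : ℝ))) k with hM
  have hvec : ∀ i, (coordVector c u i : EuclideanSpace ℝ (Fin d))
      = ∑ k, M k i • (coordVector c' (e' (chartInv d c u)) k : EuclideanSpace ℝ (Fin d)) := by
    intro i
    refine (hchain _).trans ?_
    conv_lhs => rw [euclidean_sum_single (J (EuclideanSpace.single i (1 : ℝ)))]
    exact (map_sum (mfderiv (𝓡 d) (𝓡 d) (chartInv d c') (e' (chartInv d c u))) _ _).trans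
      (Finset.sum_congr rfl fun k _ => map_smul _ _ _)
  have hG : metricMatrix c u
      = M.transpose * metricMatrix c' (e' (chartInv d c u)) * M := by
    ext i j
    have e1 : metricMatrix c u i j = metricForm (chartInv d c' (e' (chartInv d c u)))
        (∑ k, M k i • coordVector c' (e' (chartInv d c u)) k)
        (∑ k, M k j • coordVector c' (e' (chartInv d c u)) k) := by
      refine (metricForm_congr hback.symm _ _).trans ?_
      exact congrArg₂ (fun a b : EuclideanSpace ℝ (Fin d) =>
        metricForm (chartInv d c' (e' (chartInv d c u))) a b) (hvec i) (hvec j)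
    rw [e1, metricForm_sum]
    simp only [Matrix.mul_apply, Matrix.transpose_apply, Finset.sum_mul]
    rw [Finset.sum_comm]
    refine Finset.sum_congr rfl fun l _ => Finset.sum_congr rfl fun k _ => ?_
    exact mul_right_comm _ _ _
  have hdet : J.det = M.det := by
    have : M = LinearMap.toMatrix (EuclideanSpace.basisFun (Fin d) ℝ).toBasis
        (EuclideanSpace.basisFun (Fin d) ℝ).toBasis (J : _ →ₗ[ℝ] _) := by
      ext k i
      simp [LinearMap.toMatrix_apply, hM]
    rw [this, LinearMap.det_toMatrix]
  unfold volumeDensity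
  rw [hG, Matrix.det_mul, Matrix.det_mul, Matrix.det_transpose, hdet,
    show M.det * (metricMatrix c' (e' (chartInv d c u))).det * M.det
      = M.det ^ 2 * (metricMatrix c' (e' (chartInv d c u))).det by ring,
    Real.sqrt_mul (sq_nonneg _), Real.sqrt_sq_eq_abs]

theorem lintegral_volumeDensity_change [MeasurableSpace X] [BorelSpace X] (c c' : X) {A : Set X}
    (hA : MeasurableSet A) (hs : A ⊆ (chartAt (EuclideanSpace ℝ (Fin d)) c).source)
    (hs' : A ⊆ (chartAt (EuclideanSpace ℝ (Fin d)) c').source) :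
    ∫⁻ u in chartAt (EuclideanSpace ℝ (Fin d)) c' '' A, ENNReal.ofReal (volumeDensity c' u)
      = ∫⁻ u in chartAt (EuclideanSpace ℝ (Fin d)) c '' A, ENNReal.ofReal (volumeDensity c u) := by
  set e := chartAt (EuclideanSpace ℝ (Fin d)) c with he
  set e' := chartAt (EuclideanSpace ℝ (Fin d)) c' with he'
  set S := e '' A with hS
  have hSt : ∀ u ∈ S, u ∈ e.target ∧ chartInv d c u ∈ A := by
    rintro _ ⟨x, hx, rfl⟩
    refine ⟨e.map_source (hs hx), ?_⟩
    have : chartInv d c (e x) = x := e.left_inv (hs hx)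
    rwa [this]
  have himg : e' '' A = (fun w => e' (chartInv d c w)) '' S := by
    rw [hS, image_image]
    refine image_congr fun x hx => ?_
    have : chartInv d c (e x) = x := e.left_inv (hs hx)
    rw [this]
  have hch : ∀ u ∈ S, ∃ J : EuclideanSpace ℝ (Fin d) →L[ℝ] EuclideanSpace ℝ (Fin d),
      HasFDerivAt (fun w => e' (chartInv d c w)) J u ∧
      volumeDensity c u = |J.det| * volumeDensity c' (e' (chartInv d c u)) := fun u hu =>
    volumeDensity_change c c' u (hSt u hu).1 (hs' (hSt u hu).2)
  choose! J hJ1 hJ2 using hch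
  have hinj : InjOn (fun w => e' (chartInv d c w)) S := by
    intro u hu w hw h
    have h1 : chartInv d c u = chartInv d c w :=
      e'.injOn (hs' (hSt u hu).2) (hs' (hSt w hw).2) h
    exact e.symm.injOn (hSt u hu).1 (hSt w hw).1 h1
  have hSm : MeasurableSet S := measurableSet_chart_image c hA hs
  rw [himg, lintegral_image_eq_lintegral_abs_det_fderiv_mul volume hSm
    (fun u hu => (hJ1 u hu).hasFDerivWithinAt) hinj]
  refine setLIntegral_congr_fun hSm fun u hu => ?_
  rw [hJ2 u hu, ENNReal.ofReal_mul (abs_nonneg _)]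

theorem exists_riemannianVolume [MeasurableSpace X] [BorelSpace X] [SecondCountableTopology X] :
    ∃ v : Measure X, IsRiemannianVolume d v := by
  obtain ⟨s, hsc, hs⟩ := TopologicalSpace.countable_cover_nhds
    (fun x : X => chart_source_mem_nhds (EuclideanSpace ℝ (Fin d)) x)
  rcases s.eq_empty_or_nonempty with rfl | hne
  · refine ⟨0, fun c => ?_⟩
    have : c ∈ (∅ : Set X) := by
      have := mem_univ c
      rw [← hs] at this
      simp at this
    exact this.elim
  obtain ⟨f, rfl⟩ := hsc.exists_eq_range hne
  set V : ℕ → Set X := fun n => (chartAt (EuclideanSpace ℝ (Fin d)) (f n)).source with hV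
  have hVm : ∀ n, MeasurableSet (V n) := fun n =>
    (chartAt (EuclideanSpace ℝ (Fin d)) (f n)).open_source.measurableSet
  have hUm : ∀ n, MeasurableSet (disjointed V n) := fun n => MeasurableSet.disjointed hVm n
  have hUV : ⋃ n, disjointed V n = univ := by
    rw [iUnion_disjointed, ← hs]
    simp [hV]
  refine ⟨Measure.sum fun n => (chartVolume (d := d) (f n)).restrict (disjointed V n),
    fun c A hA hAc => ?_⟩
  rw [Measure.sum_apply _ hA, ← chartVolume_apply c hA hAc]
  have h1 : ∀ n, (chartVolume (d := d) (f n)).restrict (disjointed V n) A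
      = chartVolume (d := d) c (A ∩ disjointed V n) := by
    intro n
    have hm := hA.inter (hUm n)
    have hc : A ∩ disjointed V n ⊆ (chartAt (EuclideanSpace ℝ (Fin d)) c).source :=
      inter_subset_left.trans hAc
    have hc' : A ∩ disjointed V n ⊆ (chartAt (EuclideanSpace ℝ (Fin d)) (f n)).source :=
      inter_subset_right.trans (disjointed_subset V n)
    rw [Measure.restrict_apply hA, chartVolume_apply _ hm hc', chartVolume_apply _ hm hc,
      lintegral_volumeDensity_change c (f n) hm hc hc']
  simp_rw [h1]
  rw [← measure_iUnion (fun i j hij => (disjoint_disjointed V hij).mono inter_subset_right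
    inter_subset_right) (fun n => hA.inter (hUm n)), ← inter_iUnion, hUV, inter_univ]

theorem IsRiemannianVolume.unique [MeasurableSpace X] [BorelSpace X] [SecondCountableTopology X]
    {v w : Measure X} (hv : IsRiemannianVolume d v) (hw : IsRiemannianVolume d w) : v = w := by
  obtain ⟨s, hsc, hs⟩ := TopologicalSpace.countable_cover_nhds
    (fun x : X => chart_source_mem_nhds (EuclideanSpace ℝ (Fin d)) x)
  refine (Measure.ext_iff_of_biUnion_eq_univ hsc hs).2 fun c _ => ?_
  ext A hA
  have hm := hA.inter (chartAt (EuclideanSpace ℝ (Fin d)) c).open_source.measurableSet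
  rw [Measure.restrict_apply hA, Measure.restrict_apply hA, hv c _ hm inter_subset_right,
    hw c _ hm inter_subset_right]

/-- The Riemannian volume measure: the unique measure given by `√(det g_{ij}) du` in every
chart. -/
def riemannianVolume (d : ℕ) (X : Type*) [TopologicalSpace X]
    [ChartedSpace (EuclideanSpace ℝ (Fin d)) X]
    [Bundle.RiemannianBundle (fun x : X => TangentSpace (𝓡 d) x)] [IsManifold (𝓡 d) ∞ X]
    [MeasurableSpace X] [BorelSpace X] [SecondCountableTopology X] : Measure X :=
  (exists_riemannianVolume (d := d) (X := X)).choose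

theorem isRiemannianVolume_riemannianVolume [MeasurableSpace X] [BorelSpace X]
    [SecondCountableTopology X] : IsRiemannianVolume d (riemannianVolume d X) :=
  (exists_riemannianVolume (d := d) (X := X)).choose_spec

end Volume

section Kernels

variable {E : Type*} [MeasurableSpace E]

/-- A Markov semigroup of kernels `(p_t)_{t ≥ 0}` on `E`. -/
structure IsMarkovSemigroup (p : ℝ≥0 → Kernel E E) : Prop where
  markov : ∀ t, IsMarkovKernel (p t)
  zero : p 0 = Kernel.id
  add : ∀ s t, p (s + t) = p t ∘ₖ p s

/-- A sub-Markov operator `A` in `L²(μ)` which is moreover Markov. -/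
structure IsMarkovOperator {μ : Measure E} (A : Lp ℝ 2 μ →L[ℝ] Lp ℝ 2 μ) : Prop where
  subMarkov : ∀ f : Lp ℝ 2 μ, (∀ᵐ x ∂μ, 0 ≤ f x ∧ f x ≤ 1) → ∀ᵐ x ∂μ, 0 ≤ A f x ∧ A f x ≤ 1
  markov : ∃ f : ℕ → Lp ℝ 2 μ,
    (∀ᵐ x ∂μ, Monotone (fun n => f n x) ∧ Tendsto (fun n => f n x) atTop (𝓝 1)) ∧
    (∀ᵐ x ∂μ, Monotone (fun n => A (f n) x) ∧ Tendsto (fun n => A (f n) x) atTop (𝓝 1))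

/-- A semigroup of self-adjoint contractions in `L²(μ)` consisting of Markov operators. -/
structure IsMarkovL2Semigroup {μ : Measure E} (T : ℝ≥0 → Lp ℝ 2 μ →L[ℝ] Lp ℝ 2 μ) : Prop where
  zero : T 0 = ContinuousLinearMap.id ℝ (Lp ℝ 2 μ)
  add : ∀ s t, T (s + t) = (T s).comp (T t)
  selfAdjoint : ∀ t, IsSelfAdjoint (T t)
  contraction : ∀ t, ‖T t‖ ≤ 1
  markov : ∀ t, IsMarkovOperator (T t)

/-- The kernels `p_t` correspond to the operators `T_t`: for `f ∈ L²(μ)`, the function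
`x ↦ ∫ f(y) p_t(x, dy)` is a version of `T_t f`. -/
def Corresponds {μ : Measure E} (T : ℝ≥0 → Lp ℝ 2 μ →L[ℝ] Lp ℝ 2 μ) (p : ℝ≥0 → Kernel E E) :
    Prop :=
  ∀ (t : ℝ≥0) (f : E → ℝ), Measurable f → ∀ hf : MemLp f 2 μ,
    T t (hf.toLp f) =ᵐ[μ] fun x => ∫ y, f y ∂(p t x)

end Kernels

section Configurations

/-- The configuration space: the infinite, locally finite subsets of `X`. -/
def Config (X : Type*) [TopologicalSpace X] : Type _ :=
  {γ : Set X // γ.Infinite ∧ ∀ K, IsCompact K → (γ ∩ K).Finite}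

variable {X : Type*} [TopologicalSpace X]

/-- The vague topology: the coarsest one for which all `γ ↦ ∑_{x ∈ γ} φ(x)`, with `φ` continuous
and compactly supported, are continuous. -/
instance : TopologicalSpace (Config X) :=
  ⨅ φ : CompactlySupportedContinuousMap X ℝ,
    TopologicalSpace.induced (fun γ : Config X => ∑' x : γ.1, φ x.1) inferInstance

instance : MeasurableSpace (Config X) := borel (Config X)

/-- The sequences of pairwise distinct points without accumulation points in `X`. -/
def goodSeq (X : Type*) [TopologicalSpace X] : Set (ℕ → X) :=
  {x | Function.Injective x ∧ ∀ y, ¬ MapClusterPt y atTop x}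

/-- The map `(x_n) ↦ {x_n : n}` (as a measure, `∑ ε_{x_n}`). -/
def seqToConfig (x : goodSeq X) : Config X :=
  ⟨range x.1, infinite_range_of_injective x.2.1, fun K hK => by
    by_contra h
    have h1 : (x.1 ⁻¹' K).Infinite := by
      intro h2
      refine h ((h2.image x.1).subset ?_)
      rintro _ ⟨⟨n, rfl⟩, hn⟩
      exact ⟨n, hn, rfl⟩
    obtain ⟨a, -, ha⟩ := hK.exists_mapClusterPt_of_frequently
      (Nat.frequently_atTop_iff_infinite.2 h1)
    exact x.2.2 a ha⟩

/-- The law on the configuration space of the set `{y_n : n}` of independent random points `y_n`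
with laws `ν_n`: the image under `seqToConfig` of the restriction to `goodSeq X` of the product
measure. -/
def configLaw [MeasurableSpace X] (ν : ℕ → Measure X) : Measure (Config X) :=
  ((Measure.infinitePi ν).comap (Subtype.val : goodSeq X → ℕ → X)).map seqToConfig

/-- `x` is a numeration of the points of `γ`. -/
def IsNumeration (x : ℕ → X) (γ : Config X) : Prop :=
  Function.Injective x ∧ range x = γ.1

/-- The configurations whose number of points in each ball `B(x₀, r)`, `r = 1, 2, …`, is at most
a constant times `vol(B(x₀, r)) ^ α`. -/
def Theta {X : Type*} [PseudoMetricSpace X] [MeasurableSpace X] (vol : Measure X) (x₀ : X) (α : ℝ) :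
    Set (Config X) :=
  {γ | ∃ K : ℕ, ∀ r : ℕ, 1 ≤ r →
    ((γ.1 ∩ Metric.closedBall x₀ r).encard : ℝ≥0∞) ≤ K * vol (Metric.closedBall x₀ r) ^ α}

/-- `Q` is the Poisson measure with intensity measure `μ`: the numbers of points in disjoint Borel
sets of finite intensity are independent, with Poisson laws. -/
structure IsPoissonMeasure [MeasurableSpace X] (μ : Measure X) (Q : Measure (Config X)) : Prop where
  count_law : ∀ A : Set X, MeasurableSet A → μ A ≠ ⊤ →
    Q.map (fun γ => (γ.1 ∩ A).encard) = (poissonMeasure (μ A).toNNReal).map (fun k : ℕ => (k : ℕ∞))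
  indep : ∀ (n : ℕ) (A : Fin n → Set X), (∀ i, MeasurableSet (A i)) → (∀ i, μ (A i) ≠ ⊤) →
    Pairwise (Function.onFun Disjoint A) →
    iIndepFun (fun i (γ : Config X) => (γ.1 ∩ A i).encard) Q

end Configurations

section SecondQuantization

open Classical in
/-- The class in `L²(ν)` of a square integrable function (and `0` for other functions). -/
def toL2 {S : Type*} [MeasurableSpace S] (ν : Measure S) (f : S → ℝ) : Lp ℝ 2 ν :=
  if h : MemLp f 2 ν then h.toLp f else 0

variable {X : Type*} [MeasurableSpace X]

/-- `n` pairwise disjoint measurable sets of finite measure. -/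
structure DisjointSets (μ : Measure X) (n : ℕ) where
  set : Fin n → Set X
  measurable : ∀ i, MeasurableSet (set i)
  finite : ∀ i, μ (set i) ≠ ⊤
  disjoint : Pairwise (Function.onFun Disjoint set)

/-- The indicator of `A_1 × ⋯ × A_n`, in `L²(X^n, μ^{⊗ n})`. -/
def boxIndicator (μ : Measure X) {n : ℕ} (A : DisjointSets μ n) :
    Lp ℝ 2 (Measure.pi fun _ : Fin n => μ) :=
  toL2 _ fun x => ∏ i, (A.set i).indicator (fun _ => (1 : ℝ)) (x i)

/-- The tensor power `f^{⊗ n}`, in `L²(X^n, μ^{⊗ n})`. -/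
def tensorPower (μ : Measure X) (n : ℕ) (f : Lp ℝ 2 μ) :
    Lp ℝ 2 (Measure.pi fun _ : Fin n => μ) :=
  toL2 _ fun x => ∏ i, f (x i)

variable [TopologicalSpace X]

/-- The product `∏ᵢ (γ(Aᵢ) - μ(Aᵢ))` of compensated numbers of points, in `L²(Q)`. -/
def compensatedProduct (μ : Measure X) (Q : Measure (Config X)) {n : ℕ} (A : DisjointSets μ n) :
    Lp ℝ 2 Q :=
  toL2 Q fun γ => ∏ i, (((γ.1 ∩ A.set i).ncard : ℝ) - μ.real (A.set i))

/-- The `n`-fold multiple stochastic integral `I_n` with respect to the compensated Poisson random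
measure: the continuous linear map from `L²(X^n, μ^{⊗ n})` to `L²(Q)` taking the indicator of
`A_1 × ⋯ × A_n`, with disjoint `A_i`, to `∏ᵢ (γ(Aᵢ) - μ(Aᵢ))`. -/
def multipleIntegral (μ : Measure X) (Q : Measure (Config X)) (n : ℕ) :
    Lp ℝ 2 (Measure.pi fun _ : Fin n => μ) →L[ℝ] Lp ℝ 2 Q :=
  (Finsupp.linearCombination ℝ
      fun A : DisjointSets μ n => compensatedProduct μ Q A).extendOfNorm
    (Finsupp.linearCombination ℝ fun A : DisjointSets μ n => boxIndicator μ A)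

/-- The second quantization `Exp(T)` of a contraction `T` in `L²(μ)`, carried over from the
symmetric Fock space to `L²(Q)` by the multiple stochastic integrals: the continuous linear
operator in `L²(Q)` taking `I_n(f^{⊗ n})` to `I_n((T f)^{⊗ n})` for all `f ∈ L²(μ)` and `n ≥ 0`
(for `n = 0`, it fixes the constants). -/
def secondQuantization (μ : Measure X) (Q : Measure (Config X)) (T : Lp ℝ 2 μ →L[ℝ] Lp ℝ 2 μ) :
    Lp ℝ 2 Q →L[ℝ] Lp ℝ 2 Q :=
  (Finsupp.linearCombination ℝ
      fun q : ℕ × Lp ℝ 2 μ => multipleIntegral μ Q q.1 (tensorPower μ q.1 (T q.2))).extendOfNorm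
    (Finsupp.linearCombination ℝ
      fun q : ℕ × Lp ℝ 2 μ => multipleIntegral μ Q q.1 (tensorPower μ q.1 q.2))

end SecondQuantization

end

end InfiniteParticles

open InfiniteParticles

/-! The semigroup. A complete Riemannian manifold has compact closed balls
(`ApproxGeodesic.properSpace`), so a configuration is countable and meets every ball in a finite
set. Sort the points of `γ ∈ Theta` roughly by their distance from `x₀`. The bound defining `Theta`
and the polynomial volume growth give `n ≤ const * dist ^ (α * m)` for the `n`-th point. Hence its
distance is at least `c * n ^ (1 / (α * m))`, up to a cutoff at distance 1
(`HasVolumeGrowth.exists_le_of_mem_Theta`). This is exactly the scale of the tail condition, which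
passes from small times to all times because a long move made in two steps contains a step of at
least half the length (`IsMarkovSemigroup.summableTails`). So the probabilities that a particle
moves by more than half of its distance from `x₀` are summable. By Borel–Cantelli only finitely many
particles do so. All the others that end in `B(r)` started in `B(2r)`. Hence the moved points do not
accumulate, and volume doubling puts the new configuration in `Theta` again
(`HasVolumeGrowth.mem_Theta_of_eventually`). Distinctness is the non-coincidence hypothesis, applied
to countably many pairs. The Chapman–Kolmogorov equation holds coordinatewise for product measures;
it descends to configurations because the moved sequence is itself a numeration of the moved
configuration and the law does not depend on the numeration.

The second quantization. Both operators are compared on exponential vectors `∑ I_n(f^{⊗n}) / n!`.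
For `f = -h` with `0 ≤ h ≤ 1` integrable, this vector is `exp(∫ h) * ∏_{x ∈ γ} (1 - h x)`
(`IsPoissonMeasure.coeFn_expVector_neg`). By independence the particle kernel sends `∏ (1 - h)` to
`∏ (1 - p_t h)`. Self-adjointness and the Markov property give `∫ p_t h = ∫ h`, so the exponential
vector of `-h` goes to that of `-T_t h`. With `h` the indicator of `A`, the same computation shows
that the void probabilities of the Poisson measure are preserved, so the Poisson measure is
invariant and the kernel acts on `L²` as a contraction that does not depend on versions. Replacing
`h` by `s * h` and comparing coefficients of `s ^ n` yields the identity on each `I_n(h^{⊗n})`. A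
polynomial argument and density extend it to all `f`. These vectors are total because void events
generate the σ-algebra, so the contraction is `Exp(T_t)`.

Two further ingredients. Since `I_n` and `Exp` are continuous extensions, they are meaningful only
with the bound `‖I_n g‖ ≤ √n! ‖g‖` and the density of boxes with disjoint sides. That density needs
an intensity without atoms, which holds because configurations are sets. And almost every Poisson
configuration lies in `Theta`, by a second moment estimate along sets of volume at most `2 ^ k`. -/

namespace InfiniteParticles

noncomputable section

/-! ### Compactness of closed balls in complete length spaces -/

section LengthSpace

/-- A metric space is approximately geodesic if distances can be split almost additively. -/
def ApproxGeodesic (X : Type*) [MetricSpace X] : Prop :=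
  ∀ (x y : X) (r s : ℝ), 0 ≤ r → 0 < s → dist x y < r + s → ∃ z, dist x z ≤ r ∧ dist z y < s

/-- The distance is an infimum of lengths. Take a path of length less than `r + s` and cut it at a
time when the distance from `x` equals `r`: the first piece has length at least `r`, so the second
has length less than `s`. -/
theorem approxGeodesic_of_isRiemannianManifold {d : ℕ} {X : Type*} [MetricSpace X]
    [ChartedSpace (EuclideanSpace ℝ (Fin d)) X] [IsManifold (𝓡 d) ∞ X]
    [Bundle.RiemannianBundle (fun x : X => TangentSpace (𝓡 d) x)]
    [IsRiemannianManifold (𝓡 d) X] : ApproxGeodesic X := by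
  intro x y r s hr hs hxy
  by_cases hle : dist x y ≤ r
  · exact ⟨y, hle, by simpa using hs⟩
  push Not at hle
  have hlt : Manifold.riemannianEDist (𝓡 d) x y < ENNReal.ofReal (r + s) := by
    rw [← IsRiemannianManifold.out (I := 𝓡 d) x y, edist_dist]
    exact (ENNReal.ofReal_lt_ofReal_iff (by linarith)).2 hxy
  obtain ⟨γ, h0, h1, hγ, hlen⟩ := Manifold.exists_lt_of_riemannianEDist_lt hlt
  have hcont : ContinuousOn (fun t => dist x (γ t)) (Icc 0 1) :=
    continuous_dist.comp_continuousOn (continuousOn_const.prodMk hγ.continuousOn)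
  obtain ⟨t, ht, htr⟩ : r ∈ (fun t => dist x (γ t)) '' Icc (0 : ℝ) 1 := by
    apply intermediate_value_Icc zero_le_one hcont
    simp only [h0, h1, dist_self]
    exact ⟨hr, hle.le⟩
  have htr : dist x (γ t) = r := htr
  have ha : edist x (γ t) ≤ Manifold.pathELength (𝓡 d) γ 0 t := by
    rw [IsRiemannianManifold.out (I := 𝓡 d) x (γ t)]
    exact Manifold.riemannianEDist_le_pathELength (hγ.mono (Icc_subset_Icc le_rfl ht.2)) h0 rfl ht.1
  have hb : edist (γ t) y ≤ Manifold.pathELength (𝓡 d) γ t 1 := by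
    rw [IsRiemannianManifold.out (I := 𝓡 d) (γ t) y]
    exact Manifold.riemannianEDist_le_pathELength (hγ.mono (Icc_subset_Icc ht.1 le_rfl)) rfl h1 ht.2
  have hsum : edist x (γ t) + edist (γ t) y < ENNReal.ofReal (r + s) := by
    refine lt_of_le_of_lt (add_le_add ha hb) ?_
    rwa [Manifold.pathELength_add ht.1 ht.2]
  rw [edist_dist, edist_dist, ← ENNReal.ofReal_add dist_nonneg dist_nonneg,
    ENNReal.ofReal_lt_ofReal_iff (by linarith)] at hsum
  exact ⟨γ t, htr.le, by linarith⟩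

/-- The Hopf–Rinow–Cohn-Vossen theorem. -/
theorem ApproxGeodesic.properSpace {X : Type*} [MetricSpace X] [CompleteSpace X]
    [LocallyCompactSpace X] (h : ApproxGeodesic X) : ProperSpace X := by
  suffices H : ∀ (x : X) (r : ℝ), IsCompact (Metric.closedBall x r) from ⟨H⟩
  intro x
  by_contra! hne
  obtain ⟨r₁, hr₁⟩ := hne
  -- The radii of compact balls form a bounded down-set. Its supremum `R` belongs to it, and so does
  -- a larger radius, which is the contradiction.
  set S : Set ℝ := {r | IsCompact (Metric.closedBall x r)} with hS
  have hdown : ∀ r ∈ S, ∀ r' ≤ r, r' ∈ S := fun r hr r' hle =>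
    hr.of_isClosed_subset Metric.isClosed_closedBall (Metric.closedBall_subset_closedBall hle)
  have hbdd : ∀ r ∈ S, r ≤ r₁ := fun r hr => by
    by_contra! hlt
    exact hr₁ (hdown r hr r₁ hlt.le)
  have h0 : (0 : ℝ) ∈ S := by simp [hS]
  set R := sSup S with hR
  have hR0 : 0 ≤ R := le_csSup ⟨r₁, hbdd⟩ h0
  have hlt : ∀ r < R, r ∈ S := fun r hr => by
    obtain ⟨r', hr', hlt⟩ := exists_lt_of_lt_csSup ⟨0, h0⟩ hr
    exact hdown r' hr' r hlt.le
  have hRS : R ∈ S := by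
    refine TotallyBounded.isCompact_of_isClosed ?_ Metric.isClosed_closedBall
    rw [Metric.totallyBounded_iff]
    intro ε hε
    by_cases hRε : R < ε
    · exact ⟨{x}, finite_singleton x, fun y hy => by
        simpa using lt_of_le_of_lt (Metric.mem_closedBall.1 hy) hRε⟩
    push Not at hRε
    obtain ⟨t, -, htf, ht⟩ := Metric.totallyBounded_iff.1
      (hlt (R - ε / 4) (by linarith)).totallyBounded (ε / 2) (half_pos hε) |>.imp
        fun t ht => (⟨trivial, ht⟩ : True ∧ _)
    refine ⟨t, htf, fun y hy => ?_⟩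
    rw [Metric.mem_closedBall, dist_comm] at hy
    -- Every point of the ball of radius `R` is within `ε / 2` of the compact ball of radius `R - ε
    -- / 4`, so a finite `ε / 2`-net of the smaller ball is an `ε`-net of the larger one.
    obtain ⟨z, hz1, hz2⟩ := h x y (R - ε / 4) (ε / 2) (by linarith) (half_pos hε) (by linarith)
    have hz : z ∈ Metric.closedBall x (R - ε / 4) := by rwa [Metric.mem_closedBall, dist_comm]
    obtain ⟨w, hw, hzw⟩ := mem_iUnion₂.1 (ht hz)
    refine mem_iUnion₂.2 ⟨w, hw, ?_⟩
    rw [Metric.mem_ball] at hzw ⊢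
    linarith [dist_triangle y z w, dist_comm y z]
  -- Local compactness puts a whole `δ`-thickening of the ball inside a compact set; splitting
  -- distances shows that the thickening contains the ball of radius `R + δ / 2`.
  obtain ⟨K, hK, hsub⟩ := exists_compact_superset (hRS : IsCompact (Metric.closedBall x R))
  obtain ⟨δ, hδ, hδs⟩ := (hRS : IsCompact (Metric.closedBall x R)).exists_thickening_subset_open
    isOpen_interior hsub
  have : R + δ / 2 ∈ S := by
    refine hK.of_isClosed_subset Metric.isClosed_closedBall fun y hy => ?_
    rw [Metric.mem_closedBall, dist_comm] at hy
    obtain ⟨z, hz1, hz2⟩ := h x y R δ hR0 hδ (by linarith)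
    refine interior_subset (hδs (Metric.mem_thickening_iff.2 ⟨z, ?_, ?_⟩))
    · rwa [Metric.mem_closedBall, dist_comm]
    · rwa [dist_comm]
  have := le_csSup ⟨r₁, hbdd⟩ this
  linarith

end LengthSpace

/-! ### Local finiteness of the Riemannian volume -/

section VolumeFinite

variable {d : ℕ} {X : Type*} [MetricSpace X] [ChartedSpace (EuclideanSpace ℝ (Fin d)) X]
    [IsManifold (𝓡 d) ∞ X]
    [Bundle.RiemannianBundle (fun x : X => TangentSpace (𝓡 d) x)]
    [IsContMDiffRiemannianBundle (𝓡 d) ∞ (EuclideanSpace ℝ (Fin d))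
      (fun x : X => TangentSpace (𝓡 d) x)]

theorem isContinuousRiemannianBundle_tangentSpace :
    IsContinuousRiemannianBundle (EuclideanSpace ℝ (Fin d))
      (fun x : X => TangentSpace (𝓡 d) x) := by
  obtain ⟨g, hg, h⟩ := IsContMDiffRiemannianBundle.exists_contMDiff (IB := 𝓡 d) (n := ∞)
    (F := EuclideanSpace ℝ (Fin d)) (E := fun x : X => TangentSpace (𝓡 d) x)
  exact ⟨g, hg.continuous, h⟩

/-- Near `c` the derivative of the inverse chart is bounded in the Riemannian norm, so the
coordinate vectors are bounded, and the Leibniz expansion bounds the Gram determinant. -/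
theorem eventually_volumeDensity_le (c : X) :
    ∃ D : ℝ, ∀ᶠ u in 𝓝 (chartAt (EuclideanSpace ℝ (Fin d)) c c), volumeDensity c u ≤ D := by
  have := isContinuousRiemannianBundle_tangentSpace (d := d) (X := X)
  have : IsManifold (𝓡 d) 1 X := IsManifold.of_le (n := ∞) (by simp)
  obtain ⟨C, hC, h⟩ := eventually_norm_mfderivWithin_symm_extChartAt_lt (𝓡 d) c
  simp only [mfld_simps, nhdsWithin_univ, mfderivWithin_univ] at h
  have key : ∀ᶠ u in 𝓝 (chartAt (EuclideanSpace ℝ (Fin d)) c c), ∀ i,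
      ‖coordVector c u i‖ ≤ C := by
    filter_upwards [h] with u hu i
    have h1 : ‖EuclideanSpace.single i (1 : ℝ)‖ = 1 := by simp
    let _ := normedAddCommGroupTangentSpaceVectorSpace u
    let _ := normedSpaceTangentSpaceVectorSpace u
    have h2 := ContinuousLinearMap.le_of_opNorm_le _ hu.le (EuclideanSpace.single i (1 : ℝ))
    exact h2.trans ((congrArg (C * ·) h1).le.trans (mul_one C).le)
  refine ⟨Real.sqrt ((Fintype.card (Fin d)).factorial • (C * C) ^ Fintype.card (Fin d)), ?_⟩
  filter_upwards [key] with u hu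
  refine Real.sqrt_le_sqrt ((le_abs_self _).trans ?_)
  refine Matrix.det_le (abv := AbsoluteValue.abs) fun i j => ?_
  exact (abs_real_inner_le_norm _ _).trans
    (mul_le_mul (hu i) (hu j) (norm_nonneg _) hC.le)

/-- One ball of finite volume is the seed from which the growth condition makes every ball around
`x₀` finite. -/
theorem exists_riemannianVolume_closedBall_lt_top [SecondCountableTopology X] [MeasurableSpace X]
    [BorelSpace X] (c : X) :
    ∃ r : ℝ, 0 < r ∧ riemannianVolume d X (Metric.closedBall c r) < ⊤ := by
  obtain ⟨D, hD⟩ := eventually_volumeDensity_le (d := d) c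
  set e := chartAt (EuclideanSpace ℝ (Fin d)) c with he
  have hce : ContinuousAt e c := e.continuousAt (mem_chart_source _ c)
  have h1 := hce.eventually (hD.and (Metric.closedBall_mem_nhds (e c) one_pos))
  have h2 := h1.and (chart_source_mem_nhds (EuclideanSpace ℝ (Fin d)) c)
  obtain ⟨r, hr, hrs⟩ := Metric.nhds_basis_closedBall.mem_iff.1 h2
  refine ⟨r, hr, ?_⟩
  rw [isRiemannianVolume_riemannianVolume (d := d) (X := X) c _ Metric.isClosed_closedBall.measurableSet
    fun x hx => (hrs hx).2]
  have hm : MeasurableSet (e '' Metric.closedBall c r) :=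
    measurableSet_chart_image c Metric.isClosed_closedBall.measurableSet fun x hx => (hrs hx).2
  calc ∫⁻ u in e '' Metric.closedBall c r, ENNReal.ofReal (volumeDensity c u)
      ≤ ∫⁻ u in e '' Metric.closedBall c r, ENNReal.ofReal D := by
        refine setLIntegral_mono' hm ?_
        rintro _ ⟨x, hx, rfl⟩
        exact ENNReal.ofReal_le_ofReal (hrs hx).1.1
    _ ≤ ∫⁻ u in Metric.closedBall (e c) 1, ENNReal.ofReal D := by
        refine lintegral_mono_set ?_
        rintro _ ⟨x, hx, rfl⟩
        exact (hrs hx).1.2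
    _ < ⊤ := by
        rw [setLIntegral_const]
        exact ENNReal.mul_lt_top ENNReal.ofReal_lt_top measure_closedBall_lt_top

end VolumeFinite
end
end InfiniteParticles

namespace InfiniteParticles

noncomputable section

/-! ### Configurations as counting measures -/

section CountingMeasure

variable {X : Type*} [MetricSpace X]

theorem Config.finite_inter_of_isBounded [ProperSpace X] (γ : Config X) {A : Set X}
    (hA : Bornology.IsBounded A) : (γ.1 ∩ A).Finite :=
  (γ.2.2 _ hA.isCompact_closure).subset (inter_subset_inter_right _ subset_closure)

theorem Config.countable [ProperSpace X] (γ : Config X) : γ.1.Countable := by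
  obtain ⟨x, -⟩ := γ.2.1.nonempty
  have : γ.1 = ⋃ n : ℕ, γ.1 ∩ Metric.closedBall x n := by
    rw [← inter_iUnion, Metric.iUnion_closedBall_nat, inter_univ]
  rw [this]
  exact countable_iUnion fun n => (γ.2.2 _ (isCompact_closedBall x n)).countable

variable [MeasurableSpace X]

/-- The counting measure `∑_{x ∈ γ} ε_x` of a configuration. -/
def cfgMeasure (γ : Config X) : Measure X := Measure.count.restrict γ.1

theorem cfgMeasure_eq_encard (γ : Config X) {A : Set X} (hA : MeasurableSet A)
    (hγ : MeasurableSet γ.1) : cfgMeasure γ A = ((γ.1 ∩ A).encard : ℝ≥0∞) := by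
  rw [cfgMeasure, Measure.restrict_apply hA, Measure.count_apply (hA.inter hγ), inter_comm]

variable [BorelSpace X] [ProperSpace X]

theorem Config.measurableSet (γ : Config X) : MeasurableSet γ.1 := γ.countable.measurableSet

theorem cfgMeasure_apply (γ : Config X) {A : Set X} (hA : MeasurableSet A) :
    cfgMeasure γ A = ((γ.1 ∩ A).encard : ℝ≥0∞) :=
  cfgMeasure_eq_encard γ hA γ.measurableSet

theorem cfgMeasure_lt_top (γ : Config X) {A : Set X} (hA : Bornology.IsBounded A) :
    cfgMeasure γ A < ⊤ := by
  have h := γ.finite_inter_of_isBounded hA.closure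
  calc cfgMeasure γ A ≤ cfgMeasure γ (closure A) := measure_mono subset_closure
    _ < ⊤ := by
      rw [cfgMeasure_apply γ isClosed_closure.measurableSet]
      have := h.encard_lt_top
      simpa using this

theorem lintegral_cfgMeasure (γ : Config X) (f : X → ℝ≥0∞) :
    ∫⁻ x, f x ∂(cfgMeasure γ) = ∑' x : γ.1, f x := by
  rw [cfgMeasure, lintegral_countable f γ.countable]
  simp

theorem IsNumeration.lintegral_cfgMeasure {x : ℕ → X} {γ : Config X} (hx : IsNumeration x γ)
    (f : X → ℝ≥0∞) : ∫⁻ y, f y ∂(cfgMeasure γ) = ∑' n, f (x n) := by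
  rw [InfiniteParticles.lintegral_cfgMeasure, ← hx.2]
  exact tsum_range f hx.1

theorem IsNumeration.cfgMeasure_apply {x : ℕ → X} {γ : Config X} (hx : IsNumeration x γ)
    {A : Set X} (hA : MeasurableSet A) : cfgMeasure γ A = ∑' n, A.indicator 1 (x n) := by
  rw [← lintegral_indicator_one hA, hx.lintegral_cfgMeasure]

end CountingMeasure

/-! ### The vague Borel σ-algebra and the numbers of points -/

section VagueMeasurability

instance {X : Type*} [TopologicalSpace X] : BorelSpace (Config X) := ⟨rfl⟩

variable {X : Type*} [MetricSpace X]

theorem continuous_tsum_config (φ : CompactlySupportedContinuousMap X ℝ) :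
    Continuous fun γ : Config X => ∑' x : γ.1, φ x.1 :=
  continuous_iInf_dom (i := φ) continuous_induced_dom

theorem Config.tsum_eq_sum_of_support_subset (γ : Config X) {K : Set X} (hK : (γ.1 ∩ K).Finite)
    {f : X → ℝ} (hf : ∀ x, x ∉ K → f x = 0) :
    ∑' x : γ.1, f x = ∑ x ∈ hK.toFinset, f x := by
  rw [tsum_subtype γ.1 f, tsum_eq_sum (s := hK.toFinset)]
  · refine Finset.sum_congr rfl fun x hx => ?_
    simp only [Finite.mem_toFinset] at hx
    simp [hx.1]
  · intro x hx
    simp only [Finite.mem_toFinset, mem_inter_iff, not_and] at hx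
    by_cases h : x ∈ γ.1
    · simp [h, hf x (hx h)]
    · simp [h]

variable [ProperSpace X] [MeasurableSpace X] [BorelSpace X]

/-- The indicator of a compact set is the limit of thickened indicators supported in one common
compact set, which contains only finitely many points of `γ`, so the sums converge termwise. -/
theorem measurable_cfgMeasure_isCompact {K : Set X} (hK : IsCompact K) :
    Measurable fun γ : Config X => cfgMeasure γ K := by
  have hδ : ∀ n : ℕ, (0 : ℝ) < 1 / (n + 1) := fun n => Nat.one_div_pos_of_nat
  have hK1 : IsCompact (Metric.cthickening 1 K) := hK.cthickening
  have h0 : ∀ n x, x ∉ Metric.cthickening 1 K → thickenedIndicator (hδ n) K x = 0 := by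
    intro n x hx
    refine thickenedIndicator_zero (hδ n) K fun h => hx ?_
    refine Metric.thickening_subset_cthickening _ _ (Metric.thickening_mono ?_ _ h)
    rw [div_le_one (by positivity)]
    linarith [(Nat.cast_nonneg n : (0 : ℝ) ≤ n)]
  let φ : ℕ → CompactlySupportedContinuousMap X ℝ := fun n =>
    ⟨⟨fun x => (thickenedIndicator (hδ n) K x : ℝ), by fun_prop⟩,
      HasCompactSupport.intro hK1 fun x hx => congrArg NNReal.toReal (h0 n x hx)⟩
  have hlim : Measurable fun γ : Config X => ∑' x : γ.1, K.indicator (fun _ => (1 : ℝ)) x.1 := by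
    refine measurable_of_tendsto_metrizable (fun n => (continuous_tsum_config (φ n)).measurable) ?_
    rw [tendsto_pi_nhds]
    intro γ
    have hf := γ.2.2 _ hK1
    rw [γ.tsum_eq_sum_of_support_subset hf (f := K.indicator fun _ => (1 : ℝ)) fun x hx =>
      indicator_of_notMem (fun h => hx (Metric.self_subset_cthickening K h)) _]
    have : ∀ n, ∑' x : γ.1, φ n x.1 = ∑ x ∈ hf.toFinset, φ n x := fun n =>
      γ.tsum_eq_sum_of_support_subset hf fun x hx => by
        exact congrArg NNReal.toReal (h0 n x hx)
    simp_rw [this]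
    refine tendsto_finsetSum _ fun x _ => ?_
    have h1 := tendsto_pi_nhds.1 (thickenedIndicator_tendsto_indicator_closure hδ
      tendsto_one_div_add_atTop_nhds_zero_nat K) x
    rw [hK.isClosed.closure_eq] at h1
    have h2 := (NNReal.continuous_coe.tendsto _).comp h1
    have h3 : ((K.indicator (fun _ => (1 : ℝ≥0)) x : ℝ≥0) : ℝ) = K.indicator (fun _ => 1) x := by
      by_cases h : x ∈ K <;> simp [h]
    exact h3 ▸ h2
  have : (fun γ : Config X => cfgMeasure γ K)
      = fun γ => ENNReal.ofReal (∑' x : γ.1, K.indicator (fun _ => (1 : ℝ)) x.1) := by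
    ext γ
    have hf := γ.2.2 _ hK
    rw [cfgMeasure_apply γ hK.measurableSet, γ.tsum_eq_sum_of_support_subset hf
      (f := K.indicator fun _ => (1 : ℝ)) fun x hx => indicator_of_notMem hx _]
    rw [Finset.sum_congr rfl (g := fun _ => (1 : ℝ)) fun x hx => by
      simp only [Finite.mem_toFinset] at hx
      exact indicator_of_mem hx.2 _]
    rw [hf.encard_eq_coe_toFinset_card]
    simp
  rw [this]
  exact hlim.ennreal_ofReal

/-- Dynkin's argument starts from closed sets. It needs finite measures, hence the restriction to
balls followed by a supremum. -/
theorem measurable_cfgMeasure_apply {A : Set X} (hA : MeasurableSet A) :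
    Measurable fun γ : Config X => cfgMeasure γ A := by
  rcases isEmpty_or_nonempty X with h | ⟨⟨x⟩⟩
  · have : IsEmpty (Config X) := ⟨fun γ => by
      obtain ⟨x, -⟩ := γ.2.1.nonempty
      exact h.elim x⟩
    exact measurable_of_empty _
  have hfin : ∀ (n : ℕ) (γ : Config X),
      IsFiniteMeasure ((cfgMeasure γ).restrict (Metric.closedBall x n)) := fun n γ =>
    ⟨by simpa using cfgMeasure_lt_top γ Metric.isBounded_closedBall⟩
  have hn : ∀ n : ℕ, Measurable fun γ : Config X =>
      (cfgMeasure γ).restrict (Metric.closedBall x n) := by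
    intro n
    have := hfin n
    refine Measurable.measure_of_isPiSystem
      (BorelSpace.measurable_eq.trans borel_eq_generateFrom_isClosed) isPiSystem_isClosed ?_ ?_
    · intro s hs
      simp_rw [Measure.restrict_apply (IsClosed.measurableSet hs)]
      exact measurable_cfgMeasure_isCompact ((isCompact_closedBall x n).inter_left hs)
    · simp_rw [Measure.restrict_apply MeasurableSet.univ, univ_inter]
      exact measurable_cfgMeasure_isCompact (isCompact_closedBall x n)
  have : (fun γ : Config X => cfgMeasure γ A)
      = fun γ => ⨆ n : ℕ, (cfgMeasure γ).restrict (Metric.closedBall x n) A := by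
    ext γ
    have hm : Monotone fun n : ℕ => A ∩ Metric.closedBall x n := fun a b hab =>
      inter_subset_inter_right _ (Metric.closedBall_subset_closedBall (by exact_mod_cast hab))
    simp_rw [Measure.restrict_apply hA]
    rw [← hm.measure_iUnion, ← inter_iUnion, Metric.iUnion_closedBall_nat, inter_univ]
  rw [this]
  exact Measurable.iSup fun n => (Measure.measurable_coe hA).comp (hn n)

theorem measurable_encard_inter {A : Set X} (hA : MeasurableSet A) :
    Measurable fun γ : Config X => (γ.1 ∩ A).encard := by
  have h := measurable_cfgMeasure_apply hA
  simp_rw [fun γ => cfgMeasure_apply γ hA] at h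
  refine measurable_to_countable' fun k => ?_
  have : (fun γ : Config X => (γ.1 ∩ A).encard) ⁻¹' {k}
      = (fun γ : Config X => ((γ.1 ∩ A).encard : ℝ≥0∞)) ⁻¹' {(k : ℝ≥0∞)} := by
    ext γ
    simp
  rw [this]
  exact h (measurableSet_singleton _)

/-- The vague topology is an infimum over uncountably many test functions, so its Borel σ-algebra is
accessible only after reduction to countably many. A plain uniform error would be multiplied by an
uncontrolled number of points; the error is therefore measured against a cutoff `χ` belonging to the
countable family itself. -/
theorem exists_countable_approximating_family (X : Type*) [MetricSpace X] [ProperSpace X] :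
    ∃ D : Set (CompactlySupportedContinuousMap X ℝ), D.Countable ∧
      ∀ φ : CompactlySupportedContinuousMap X ℝ, ∃ χ ∈ D, ∀ ε : ℝ, 0 < ε →
        ∃ ψ ∈ D, ∀ x, |φ x - ψ x| ≤ ε * χ x := by
  rcases isEmpty_or_nonempty X with h | ⟨⟨o⟩⟩
  · exact ⟨{0}, countable_singleton _, fun φ => ⟨0, rfl, fun ε _ => ⟨0, rfl, fun x => h.elim x⟩⟩⟩
  let S : ℕ → Set (CompactlySupportedContinuousMap X ℝ) := fun n =>
    {φ | ∀ x, x ∉ Metric.closedBall o n → φ x = 0}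
  have hdense : ∀ n, ∃ D : Set (CompactlySupportedContinuousMap X ℝ), D.Countable ∧ D ⊆ S n ∧
      ∀ φ ∈ S n, ∀ ε : ℝ, 0 < ε → ∃ ψ ∈ D, ∀ x ∈ Metric.closedBall o n, |φ x - ψ x| ≤ ε := by
    intro n
    let _ : TopologicalSpace (S n) :=
      TopologicalSpace.induced (fun φ : S n => (φ.1.toContinuousMap : C(X, ℝ))) inferInstance
    have : SecondCountableTopology (S n) :=
      TopologicalSpace.secondCountableTopology_induced (S n) C(X, ℝ) _
    obtain ⟨s, hs, hd⟩ := TopologicalSpace.exists_countable_dense (S n)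
    refine ⟨Subtype.val '' s, hs.image _, by rintro _ ⟨ψ, -, rfl⟩; exact ψ.2, fun φ hφ ε hε => ?_⟩
    have h1 := (ContinuousMap.tendsto_iff_forall_isCompact_tendstoUniformlyOn
      (f := φ.toContinuousMap)).1 tendsto_id _ (isCompact_closedBall o n)
    have h2 := Metric.tendstoUniformlyOn_iff.1 h1 ε hε
    have h3 : ∀ᶠ ψ in 𝓝 (⟨φ, hφ⟩ : S n), ∀ x ∈ Metric.closedBall o n, dist (φ x) (ψ.1 x) < ε :=
      (continuous_induced_dom.tendsto (⟨φ, hφ⟩ : S n)).eventually h2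
    obtain ⟨ψ, hψs, hψ⟩ := hd.inter_nhds_nonempty h3
    exact ⟨ψ.1, ⟨ψ, hψs, rfl⟩, fun x hx => (hψ x hx).le⟩
  choose D hDc hDS hD using hdense
  have hcut : ∀ n : ℕ, ∃ χ : CompactlySupportedContinuousMap X ℝ,
      (∀ x ∈ Metric.closedBall o n, χ x = 1) ∧ ∀ x, 0 ≤ χ x := by
    intro n
    obtain ⟨f, h1, -, h3, h4⟩ := exists_continuous_one_zero_of_isCompact
      (isCompact_closedBall o (n : ℝ)) isClosed_empty (disjoint_empty _)
    exact ⟨⟨f, h3⟩, fun x hx => h1 hx, fun x => (h4 x).1⟩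
  choose χ hχ1 hχ0 using hcut
  refine ⟨range χ ∪ ⋃ n, D n, (countable_range χ).union (countable_iUnion hDc), fun φ => ?_⟩
  obtain ⟨r, hr⟩ := φ.hasCompactSupport'.isCompact.isBounded.subset_closedBall o
  obtain ⟨n, hn⟩ := exists_nat_ge r
  have hφ : φ ∈ S n := fun x hx => by
    by_contra h
    exact hx (Metric.closedBall_subset_closedBall hn (hr (subset_tsupport _ h)))
  refine ⟨χ n, Or.inl ⟨n, rfl⟩, fun ε hε => ?_⟩
  obtain ⟨ψ, hψ, hψε⟩ := hD n φ hφ ε hε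
  refine ⟨ψ, Or.inr (mem_iUnion.2 ⟨n, hψ⟩), fun x => ?_⟩
  by_cases hx : x ∈ Metric.closedBall o n
  · rw [hχ1 n x hx, mul_one]
    exact hψε x hx
  · rw [hφ x hx, hDS n hψ x hx, sub_zero, abs_zero]
    exact mul_nonneg hε.le (hχ0 n x)

omit [ProperSpace X] [MeasurableSpace X] [BorelSpace X] in
theorem Config.summable_of_isCompact (γ : Config X) {K : Set X} (hK : IsCompact K) {f : X → ℝ}
    (hf : ∀ x, x ∉ K → f x = 0) : Summable fun x : γ.1 => f x.1 := by
  refine (summable_subtype_iff_indicator (f := f) (s := γ.1)).2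
    (summable_of_ne_finset_zero (s := (γ.2.2 _ hK).toFinset) fun x hx => ?_)
  simp only [Finite.mem_toFinset, mem_inter_iff, not_and] at hx
  by_cases h : x ∈ γ.1
  · rw [indicator_of_mem h, hf x (hx h)]
  · exact indicator_of_notMem h _

omit [ProperSpace X] [MeasurableSpace X] [BorelSpace X] in
theorem Config.summable (γ : Config X) (φ : CompactlySupportedContinuousMap X ℝ) :
    Summable fun x : γ.1 => φ x.1 :=
  γ.summable_of_isCompact φ.hasCompactSupport'.isCompact fun _ hx => image_eq_zero_of_notMem_tsupport hx

/-- The vague topology is determined by countably many test functions. -/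
theorem exists_countable_isInducing (X : Type*) [MetricSpace X] [ProperSpace X] :
    ∃ D : Set (CompactlySupportedContinuousMap X ℝ), D.Countable ∧
      Topology.IsInducing fun (γ : Config X) (ψ : D) => ∑' x : γ.1, ψ.1 x.1 := by
  obtain ⟨D, hDc, hD⟩ := exists_countable_approximating_family X
  refine ⟨D, hDc, ⟨le_antisymm ?_ ?_⟩⟩
  · exact continuous_iff_le_induced.1 (continuous_pi fun ψ => continuous_tsum_config ψ.1)
  · refine le_iInf fun φ => continuous_iff_le_induced.1 ?_
    let _ : TopologicalSpace (Config X) := TopologicalSpace.induced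
      (fun (γ : Config X) (ψ : D) => ∑' x : γ.1, ψ.1 x.1) inferInstance
    have hc : ∀ ψ ∈ D, Continuous fun γ : Config X => ∑' x : γ.1, ψ x.1 := fun ψ hψ =>
      (continuous_apply (⟨ψ, hψ⟩ : D)).comp
        (continuous_induced_dom (f := fun (γ : Config X) (ψ : D) => ∑' x : γ.1, ψ.1 x.1))
    -- On the neighbourhood of `γ` where the sum of `χ` stays below `M`, replacing `φ` by `ψ`
    -- changes the sum by at most `δ / 2`.
    refine continuous_of_locally_uniform_approx_of_continuousAt fun γ u hu => ?_
    obtain ⟨δ, hδ, hδu⟩ := Metric.mem_uniformity_dist.1 hu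
    obtain ⟨χ, hχ, hφ⟩ := hD φ
    set M := |∑' x : γ.1, χ x.1| + 1 with hM
    have hM0 : 0 < M := by positivity
    obtain ⟨ψ, hψ, hφψ⟩ := hφ (δ / (2 * M)) (by positivity)
    refine ⟨{ξ | ∑' x : ξ.1, χ x.1 < M}, ?_, fun ξ => ∑' x : ξ.1, ψ x.1, (hc ψ hψ).continuousAt,
      fun ξ hξ => hδu ?_⟩
    · refine (isOpen_Iio.preimage (hc χ hχ)).mem_nhds ?_
      simp only [mem_preimage, mem_Iio, hM]
      linarith [le_abs_self (∑' x : γ.1, χ x.1)]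
    · rw [Real.dist_eq, ← (ξ.summable φ).tsum_sub (ξ.summable ψ)]
      have h1 : |∑' x : ξ.1, (φ x.1 - ψ x.1)| ≤ ∑' x : ξ.1, δ / (2 * M) * χ x.1 := by
        rw [← Real.norm_eq_abs]
        exact tsum_of_norm_bounded (((ξ.summable χ).mul_left _).hasSum) fun x => hφψ x.1
      rw [tsum_mul_left] at h1
      refine h1.trans_lt ?_
      calc δ / (2 * M) * ∑' x : ξ.1, χ x.1 ≤ δ / (2 * M) * M :=
            mul_le_mul_of_nonneg_left (le_of_lt hξ) (by positivity)
        _ = δ / 2 := by field_simp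
        _ < δ := half_lt_self hδ

theorem Config.tsum_eq_lintegral_sub (γ : Config X) (φ : CompactlySupportedContinuousMap X ℝ) :
    ∑' x : γ.1, φ x.1 = (∫⁻ x, ENNReal.ofReal (φ x) ∂(cfgMeasure γ)).toReal
      - (∫⁻ x, ENNReal.ofReal (-φ x) ∂(cfgMeasure γ)).toReal := by
  have h0 : ∀ x, x ∉ tsupport φ → φ x = 0 := fun _ hx => image_eq_zero_of_notMem_tsupport hx
  have hK := φ.hasCompactSupport'.isCompact
  rw [lintegral_cfgMeasure, lintegral_cfgMeasure, ENNReal.tsum_toReal_eq (by simp),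
    ENNReal.tsum_toReal_eq (by simp)]
  simp_rw [ENNReal.toReal_ofReal']
  rw [← (γ.summable_of_isCompact hK (f := fun x => max (φ x) 0) fun x hx => by
      simp [h0 x hx]).tsum_sub (γ.summable_of_isCompact hK (f := fun x => max (-φ x) 0)
      fun x hx => by simp [h0 x hx])]
  refine tsum_congr fun x => ?_
  rcases le_total (φ x.1) 0 with h | h <;> simp [h]

/-- A map into the configuration space is measurable as soon as the numbers of points in Borel sets
are measurable. -/
theorem measurable_config_of_cfgMeasure {Ω : Type*} {mΩ : MeasurableSpace Ω} {Y : Ω → Config X}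
    (h : ∀ A, MeasurableSet A → Measurable fun w => cfgMeasure (Y w) A) : Measurable Y := by
  obtain ⟨D, hDc, hD⟩ := exists_countable_isInducing X
  have : Countable D := hDc
  have hm : instMeasurableSpaceConfig (X := X) = MeasurableSpace.comap
      (fun (γ : Config X) (ψ : D) => ∑' x : γ.1, ψ.1 x.1) (borel (D → ℝ)) := by
    rw [← borel_comap, ← hD.eq_induced]
    rfl
  have hY : Measurable fun w => cfgMeasure (Y w) := Measure.measurable_of_measurable_coe _ h
  refine Measurable.of_le_map ?_
  -- Since `D` is countable, the Borel σ-algebra of `D → ℝ` is the product σ-algebra, and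
  -- coordinates suffice.
  rw [hm, ← BorelSpace.measurable_eq]
  refine (MeasurableSpace.comap_le_iff_le_map.2 ?_)
  rw [MeasurableSpace.map_comp]
  refine measurable_iff_le_map.1 (measurable_pi_lambda _ fun ψ => ?_)
  have hlin : ∀ f : X → ℝ≥0∞, Measurable f →
      Measurable fun w => ∫⁻ x, f x ∂(cfgMeasure (Y w)) := fun f hf =>
    (Measure.measurable_lintegral hf).comp hY
  simp only [Function.comp_def, Config.tsum_eq_lintegral_sub]
  exact (hlin _ ψ.1.continuous.measurable.ennreal_ofReal).ennreal_toReal.sub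
    (hlin _ ψ.1.continuous.measurable.neg.ennreal_ofReal).ennreal_toReal

end VagueMeasurability
end
end InfiniteParticles

namespace InfiniteParticles

noncomputable section

/-! ### Dyadic partitions separating points -/

section Cells

variable {X : Type*} [MetricSpace X] [ProperSpace X] [MeasurableSpace X] [BorelSpace X]

/-- A measurable injection into the open unit interval. -/
def sepFun (x : X) : ℝ := Real.sigmoid (embeddingReal X x)

theorem measurable_sepFun : Measurable (sepFun : X → ℝ) :=
  Real.sigmoid_strictMono.monotone.measurable.comp (measurableEmbedding_embeddingReal X).measurable

theorem injective_sepFun : Function.Injective (sepFun : X → ℝ) :=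
  Real.sigmoid_strictMono.injective.comp (measurableEmbedding_embeddingReal X).injective

theorem sepFun_pos (x : X) : 0 < sepFun x := Real.sigmoid_pos _

theorem sepFun_lt_one (x : X) : sepFun x < 1 := Real.sigmoid_lt_one _

/-- The index of the cell of the `M`-th dyadic partition containing `x`. -/
def cellIdx (M : ℕ) (x : X) : ℕ := ⌊2 ^ M * sepFun x⌋₊

theorem measurable_cellIdx (M : ℕ) : Measurable (cellIdx M : X → ℕ) :=
  Nat.measurable_floor.comp (measurable_sepFun.const_mul _)

theorem cellIdx_lt (M : ℕ) (x : X) : cellIdx M x < 2 ^ M := by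
  rw [cellIdx, Nat.floor_lt (by have := sepFun_pos x; positivity)]
  push_cast
  exact mul_lt_of_lt_one_right (by positivity) (sepFun_lt_one x)

theorem eventually_cellIdx_ne {x y : X} (h : x ≠ y) :
    ∀ᶠ M in atTop, cellIdx M x ≠ cellIdx M y := by
  have h0 : 0 < |sepFun x - sepFun y| := abs_pos.2 (sub_ne_zero.2 (injective_sepFun.ne h))
  have h1 : Tendsto (fun M : ℕ => (2 : ℝ) ^ M * |sepFun x - sepFun y|) atTop atTop :=
    (tendsto_pow_atTop_atTop_of_one_lt one_lt_two).atTop_mul_const h0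
  filter_upwards [h1.eventually_ge_atTop 1] with M hM heq
  rw [cellIdx, cellIdx] at heq
  have hx : (0 : ℝ) ≤ 2 ^ M * sepFun x := by have := sepFun_pos x; positivity
  have hy : (0 : ℝ) ≤ 2 ^ M * sepFun y := by have := sepFun_pos y; positivity
  have a1 := Nat.floor_le hx
  have a2 := Nat.lt_floor_add_one (2 ^ M * sepFun x)
  have b1 := Nat.floor_le hy
  have b2 := Nat.lt_floor_add_one (2 ^ M * sepFun y)
  rw [heq] at a1 a2
  have : |(2 : ℝ) ^ M * sepFun x - 2 ^ M * sepFun y| < 1 := by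
    rw [abs_lt]; constructor <;> linarith
  rw [← mul_sub, abs_mul, abs_of_pos (by positivity : (0 : ℝ) < 2 ^ M)] at this
  linarith

/-- This is all that is required of the partitions: their cells need not be metrically small, they
only have to separate any finite set eventually. -/
theorem eventually_injOn_cellIdx {s : Set X} (hs : s.Finite) :
    ∀ᶠ M in atTop, InjOn (cellIdx M) s := by
  have : ∀ᶠ M in atTop, ∀ x ∈ s, ∀ y ∈ s, x ≠ y → cellIdx M x ≠ cellIdx M y := by
    refine (hs.eventually_all).2 fun x _ => (hs.eventually_all).2 fun y _ => ?_
    by_cases h : x = y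
    · exact Eventually.of_forall fun _ h' => (h' h).elim
    · filter_upwards [eventually_cellIdx_ne h] with M hM _ using hM
  filter_upwards [this] with M hM x hx y hy hxy
  by_contra h
  exact hM x hx y hy h hxy

end Cells

/-! ### Sequences that numerate configurations -/

section GoodSequences

variable {X : Type*} [MetricSpace X] [ProperSpace X]

/-- In a proper space, having no cluster point means leaving every ball eventually. This turns the
condition into countably many measurable ones. -/
theorem mem_goodSeq_iff (o : X) {x : ℕ → X} : x ∈ goodSeq X ↔
    Function.Injective x ∧ ∀ N : ℕ, ∀ᶠ n in atTop, x n ∉ Metric.closedBall o N := by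
  refine and_congr_right fun _ => ⟨fun h N => ?_, fun h y hy => ?_⟩
  · by_contra hN
    rw [not_eventually] at hN
    simp only [not_not] at hN
    obtain ⟨a, -, ha⟩ := (isCompact_closedBall o (N : ℝ)).exists_mapClusterPt_of_frequently hN
    exact h a ha
  · obtain ⟨N, hN⟩ := exists_nat_gt (dist y o)
    have hnhds : Metric.closedBall o (N : ℝ) ∈ 𝓝 y :=
      mem_of_superset (Metric.isOpen_ball.mem_nhds (Metric.mem_ball.2 hN)) Metric.ball_subset_closedBall
    exact (hy.frequently hnhds) (h N)

theorem IsNumeration.mem_goodSeq {x : ℕ → X} {γ : Config X} (hx : IsNumeration x γ) :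
    x ∈ goodSeq X := by
  refine (mem_goodSeq_iff (x 0)).2 ⟨hx.1, fun N => ?_⟩
  have hf : (x ⁻¹' (γ.1 ∩ Metric.closedBall (x 0) N)).Finite :=
    (γ.finite_inter_of_isBounded Metric.isBounded_closedBall).preimage hx.1.injOn
  rw [← Nat.cofinite_eq_atTop]
  refine hf.eventually_cofinite_notMem.mono fun n hn h => hn ⟨?_, h⟩
  rw [← hx.2]
  exact mem_range_self n

omit [ProperSpace X] in
theorem isNumeration_seqToConfig (x : goodSeq X) : IsNumeration x.1 (seqToConfig x) :=
  ⟨x.2.1, rfl⟩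

theorem IsNumeration.seqToConfig_eq {x : ℕ → X} {γ : Config X} (hx : IsNumeration x γ) :
    seqToConfig ⟨x, hx.mem_goodSeq⟩ = γ := Subtype.ext hx.2

variable [MeasurableSpace X] [BorelSpace X]

theorem measurableSet_goodSeq : MeasurableSet (goodSeq X) := by
  rcases isEmpty_or_nonempty X with h | ⟨⟨o⟩⟩
  · have : goodSeq X = ∅ := eq_empty_of_forall_notMem fun x => h.elim (x 0)
    rw [this]
    exact MeasurableSet.empty
  have : goodSeq X = (⋂ (i : ℕ) (j : ℕ) (_ : i ≠ j), {x | x i ≠ x j}) ∩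
      ⋂ N : ℕ, ⋃ n : ℕ, ⋂ (k : ℕ) (_ : n ≤ k), {x | x k ∉ Metric.closedBall o (N : ℝ)} := by
    ext x
    rw [mem_goodSeq_iff o]
    simp only [mem_inter_iff, mem_iInter, mem_iUnion, mem_ofPred_eq, eventually_atTop]
    refine and_congr_left fun _ => ⟨fun h i j hij => h.ne hij, fun h i j hij => ?_⟩
    by_contra hne
    exact h i j hne hij
  rw [this]
  refine MeasurableSet.inter (MeasurableSet.iInter fun i => MeasurableSet.iInter fun j =>
    MeasurableSet.iInter fun _ => ?_) (MeasurableSet.iInter fun N => MeasurableSet.iUnion fun n =>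
    MeasurableSet.iInter fun k => MeasurableSet.iInter fun _ => ?_)
  · exact (measurableSet_eq_fun (measurable_pi_apply i) (measurable_pi_apply j)).compl
  · exact (measurable_pi_apply k Metric.isClosed_closedBall.measurableSet).compl

theorem measurable_seqToConfig : Measurable (seqToConfig : goodSeq X → Config X) := by
  refine measurable_config_of_cfgMeasure fun A hA => ?_
  simp_rw [fun x : goodSeq X => (isNumeration_seqToConfig x).cfgMeasure_apply hA]
  exact Measurable.tsum fun n => (measurable_one.indicator hA).comp
    ((measurable_pi_apply n).comp measurable_subtype_coe)

open Classical in
/-- The map `seqToConfig`, extended by the constant `γ₀` to all sequences. -/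
def toConfig (γ₀ : Config X) (x : ℕ → X) : Config X :=
  if h : x ∈ goodSeq X then seqToConfig ⟨x, h⟩ else γ₀

theorem measurable_toConfig (γ₀ : Config X) : Measurable (toConfig γ₀) := by
  classical
  exact Measurable.dite (s := goodSeq X) measurable_seqToConfig measurable_const measurableSet_goodSeq

omit [ProperSpace X] [MeasurableSpace X] [BorelSpace X] in
theorem toConfig_of_mem (γ₀ : Config X) {x : ℕ → X} (h : x ∈ goodSeq X) :
    toConfig γ₀ x = seqToConfig ⟨x, h⟩ := dif_pos h

omit [MeasurableSpace X] [BorelSpace X] in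
theorem IsNumeration.toConfig_eq (γ₀ : Config X) {x : ℕ → X} {γ : Config X}
    (hx : IsNumeration x γ) : toConfig γ₀ x = γ :=
  (toConfig_of_mem γ₀ hx.mem_goodSeq).trans hx.seqToConfig_eq

omit [ProperSpace X] [MeasurableSpace X] [BorelSpace X] in
theorem isNumeration_toConfig (γ₀ : Config X) {x : ℕ → X} (h : x ∈ goodSeq X) :
    IsNumeration x (toConfig γ₀ x) := by
  rw [toConfig_of_mem γ₀ h]
  exact isNumeration_seqToConfig ⟨x, h⟩

/-- Replaces the passage through the subtype by a push-forward under a total measurable map; the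
default value `γ₀` is taken only on a null set. -/
theorem configLaw_eq_map (γ₀ : Config X) {ν : ℕ → Measure X}
    (h : ∀ᵐ x ∂(Measure.infinitePi ν), x ∈ goodSeq X) :
    configLaw ν = (Measure.infinitePi ν).map (toConfig γ₀) := by
  ext A hA
  rw [configLaw, Measure.map_apply measurable_seqToConfig hA,
    Measure.map_apply (measurable_toConfig γ₀) hA,
    (MeasurableEmbedding.subtype_coe measurableSet_goodSeq).comap_apply]
  refine measure_congr ?_
  filter_upwards [h] with x hx
  refine propext ⟨?_, fun h' => ⟨⟨x, hx⟩, ?_, rfl⟩⟩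
  · rintro ⟨y, hy, rfl⟩
    show toConfig γ₀ y.1 ∈ A
    rwa [toConfig_of_mem γ₀ hx]
  · have : toConfig γ₀ x ∈ A := h'
    rwa [toConfig_of_mem γ₀ hx] at this

end GoodSequences

/-! ### A measurable numeration, sorted by distance -/

section Enumeration

variable {X : Type*} [MetricSpace X] [ProperSpace X] [MeasurableSpace X] [BorelSpace X]

/-- A measurable injection into the half-line with bounded sublevel sets. -/
def sortKey (o : X) (x : X) : ℝ := ⌊dist x o⌋₊ + sepFun x

theorem measurable_sortKey (o : X) : Measurable (sortKey o) :=
  (measurable_from_nat.comp (Nat.measurable_floor.comp (measurable_id.dist measurable_const))).add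
    measurable_sepFun

theorem floor_sortKey (o x : X) : ⌊sortKey o x⌋₊ = ⌊dist x o⌋₊ := by
  rw [Nat.floor_eq_iff (by have := sepFun_pos x; unfold sortKey; positivity)]
  have := sepFun_pos x
  have := sepFun_lt_one x
  unfold sortKey
  constructor <;> linarith

theorem injective_sortKey (o : X) : Function.Injective (sortKey o) := by
  intro x y h
  have h1 := congrArg Nat.floor h
  rw [floor_sortKey, floor_sortKey] at h1
  refine injective_sepFun ?_
  unfold sortKey at h
  rw [h1] at h
  exact add_left_cancel h

theorem measurableEmbedding_sortKey (o : X) : MeasurableEmbedding (sortKey o) :=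
  (measurable_sortKey o).measurableEmbedding (injective_sortKey o)

theorem isBounded_sortKey_le (o : X) (c : ℝ) : Bornology.IsBounded {x | sortKey o x ≤ c} := by
  refine (Metric.isBounded_closedBall (x := o) (r := c + 1)).subset fun x hx => ?_
  have h1 := Nat.lt_floor_add_one (dist x o)
  have h2 := sepFun_pos x
  simp only [mem_ofPred_eq, sortKey] at hx
  rw [Metric.mem_closedBall]
  linarith

theorem Config.finite_sortKey_le (γ : Config X) (o : X) (c : ℝ) :
    (γ.1 ∩ {x | sortKey o x ≤ c}).Finite :=
  γ.finite_inter_of_isBounded (isBounded_sortKey_le o c)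

theorem Config.finite_sortKey_lt (γ : Config X) (o : X) (c : ℝ) :
    (γ.1 ∩ {x | sortKey o x < c}).Finite :=
  (γ.finite_sortKey_le o c).subset (inter_subset_inter_right _ fun _ h =>
    le_of_lt (mem_ofPred_eq ▸ h))

/-- The number of points of `γ` before `x`. -/
def sortRank (o : X) (γ : Config X) (x : X) : ℕ := (γ.1 ∩ {y | sortKey o y < sortKey o x}).ncard

theorem sortRank_lt_sortRank {o : X} {γ : Config X} {x y : X} (hx : x ∈ γ.1)
    (h : sortKey o x < sortKey o y) : sortRank o γ x < sortRank o γ y := by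
  refine ncard_lt_ncard ⟨fun z hz => ⟨hz.1, hz.2.trans h⟩, fun hsub => ?_⟩ (γ.finite_sortKey_lt o _)
  have : sortKey o x < sortKey o x :=
    (hsub (⟨hx, h⟩ : x ∈ γ.1 ∩ {z | sortKey o z < sortKey o y})).2
  exact lt_irrefl _ this

theorem injOn_sortRank (o : X) (γ : Config X) : InjOn (sortRank o γ) γ.1 := by
  intro x hx y hy h
  by_contra hne
  rcases lt_or_gt_of_ne ((injective_sortKey o).ne hne) with h1 | h1
  · exact (sortRank_lt_sortRank hx h1).ne h
  · exact (sortRank_lt_sortRank hy h1).ne' h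

/-- The ranks form an initial segment of `ℕ`, since the last point before one of rank `k + 1` has
rank `k`. They are unbounded because `γ` is infinite and the rank is injective. -/
theorem exists_sortRank_eq (o : X) (γ : Config X) (n : ℕ) : ∃ x ∈ γ.1, sortRank o γ x = n := by
  have hpred : ∀ k, (∃ x ∈ γ.1, sortRank o γ x = k + 1) → ∃ x ∈ γ.1, sortRank o γ x = k := by
    rintro k ⟨x, hx, hk⟩
    have hne : (γ.1 ∩ {y | sortKey o y < sortKey o x}).Nonempty := by
      rw [← ncard_pos (γ.finite_sortKey_lt o _)]
      show 0 < sortRank o γ x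
      omega
    obtain ⟨y, hy, hmax⟩ := exists_max_image _ (sortKey o) (γ.finite_sortKey_lt o _) hne
    refine ⟨y, hy.1, ?_⟩
    have : γ.1 ∩ {z | sortKey o z < sortKey o x}
        = insert y (γ.1 ∩ {z | sortKey o z < sortKey o y}) := by
      ext z
      constructor
      · intro hz
        rcases (hmax z hz).lt_or_eq with h | h
        · exact Or.inr ⟨hz.1, h⟩
        · exact Or.inl (injective_sortKey o h)
      · rintro (rfl | hz)
        · exact hy
        · have h1 : sortKey o z < sortKey o y := hz.2
          exact ⟨hz.1, h1.trans hy.2⟩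
    have h2 : sortRank o γ x = sortRank o γ y + 1 := by
      rw [sortRank, this, ncard_insert_of_notMem (fun h => lt_irrefl (sortKey o y) h.2)
        (γ.finite_sortKey_lt o _)]
      rfl
    omega
  have hdown : ∀ j k, (∃ x ∈ γ.1, sortRank o γ x = k + j) → ∃ x ∈ γ.1, sortRank o γ x = k := by
    intro j
    induction j with
    | zero => exact fun k h => h
    | succ j ih => exact fun k h => ih k (hpred _ h)
  have hinf : (sortRank o γ '' γ.1).Infinite := γ.2.1.image (injOn_sortRank o γ)
  obtain ⟨_, ⟨x, hx, rfl⟩, hlt⟩ := hinf.exists_gt n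
  exact hdown (sortRank o γ x - n) n ⟨x, hx, by omega⟩

/-- The `n`-th point of `γ`, sorted by distance from `o` up to bounded errors. -/
def enum (o : X) (γ : Config X) (n : ℕ) : X := (exists_sortRank_eq o γ n).choose

theorem enum_mem (o : X) (γ : Config X) (n : ℕ) : enum o γ n ∈ γ.1 :=
  (exists_sortRank_eq o γ n).choose_spec.1

theorem sortRank_enum (o : X) (γ : Config X) (n : ℕ) : sortRank o γ (enum o γ n) = n :=
  (exists_sortRank_eq o γ n).choose_spec.2

theorem isNumeration_enum (o : X) (γ : Config X) : IsNumeration (enum o γ) γ := by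
  refine ⟨fun i j h => ?_, Subset.antisymm ?_ fun x hx => ⟨sortRank o γ x, ?_⟩⟩
  · rw [← sortRank_enum o γ i, h, sortRank_enum]
  · rintro _ ⟨n, rfl⟩
    exact enum_mem o γ n
  · exact injOn_sortRank o γ (enum_mem o γ _) hx (sortRank_enum o γ _)

/-- Expresses the position of the `n`-th point through a number of points, which is known to be
measurable. The `+ 1` comes from counting ranks from 0. -/
theorem sortKey_enum_le_iff (o : X) (γ : Config X) (n : ℕ) (c : ℝ) :
    sortKey o (enum o γ n) ≤ c ↔ ((n + 1 : ℕ) : ℕ∞) ≤ (γ.1 ∩ {x | sortKey o x ≤ c}).encard := by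
  rw [← (γ.finite_sortKey_le o c).cast_ncard_eq, Nat.cast_le]
  constructor
  · intro h
    rw [Nat.succ_le_iff]
    nth_rewrite 1 [← sortRank_enum o γ n]
    refine ncard_lt_ncard ⟨fun y hy => ⟨hy.1, (le_of_lt (show sortKey o y < sortKey o (enum o γ n) from hy.2)).trans h⟩, fun hsub => ?_⟩
      (γ.finite_sortKey_le o c)
    exact lt_irrefl (sortKey o (enum o γ n))
      (hsub (⟨enum_mem o γ n, h⟩ : _ ∈ γ.1 ∩ {x | sortKey o x ≤ c})).2
  · intro h
    by_contra! hlt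
    have h1 : (γ.1 ∩ {x | sortKey o x ≤ c}).ncard ≤ sortRank o γ (enum o γ n) :=
      ncard_le_ncard (fun y hy => ⟨hy.1, lt_of_le_of_lt (show sortKey o y ≤ c from hy.2) hlt⟩) (γ.finite_sortKey_lt o _)
    rw [sortRank_enum] at h1
    omega

theorem measurable_enum (o : X) (n : ℕ) : Measurable fun γ : Config X => enum o γ n := by
  -- Measurability into `X` may be tested after the embedding into `ℝ`, where half-lines suffice.
  rw [← (measurableEmbedding_sortKey o).measurable_comp_iff]
  refine measurable_of_Iic fun c => ?_
  have : (sortKey o ∘ fun γ : Config X => enum o γ n) ⁻¹' Iic c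
      = {γ | ((n + 1 : ℕ) : ℕ∞) ≤ (γ.1 ∩ {x | sortKey o x ≤ c}).encard} := by
    ext γ
    exact sortKey_enum_le_iff o γ n c
  rw [this]
  exact measurable_encard_inter (measurableSet_le (measurable_sortKey o) measurable_const)
    (to_countable (Ici ((n + 1 : ℕ) : ℕ∞))).measurableSet

end Enumeration

/-! ### Void events determine laws of configurations -/

section VoidEvents

variable {X : Type*} [MetricSpace X] [ProperSpace X] [MeasurableSpace X] [BorelSpace X]

/-- The event that `A` contains no point. -/
def voidEvent (A : Set X) : Set (Config X) := {γ | γ.1 ∩ A = ∅}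

theorem measurableSet_voidEvent {A : Set X} (hA : MeasurableSet A) : MeasurableSet (voidEvent A) := by
  have : voidEvent A = (fun γ : Config X => (γ.1 ∩ A).encard) ⁻¹' {0} := by
    ext γ
    simp [voidEvent]
  rw [this]
  exact measurable_encard_inter hA (measurableSet_singleton _)

omit [ProperSpace X] [BorelSpace X] in
theorem isPiSystem_voidEvent :
    IsPiSystem {V : Set (Config X) | ∃ A, MeasurableSet A ∧ Bornology.IsBounded A ∧ V = voidEvent A} := by
  rintro _ ⟨A, hA, hAb, rfl⟩ _ ⟨B, hB, hBb, rfl⟩ -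
  refine ⟨A ∪ B, hA.union hB, hAb.union hBb, ?_⟩
  ext γ
  simp [voidEvent, inter_union_distrib_left]

/-- Rényi's theorem: the void events generate the `σ`-algebra of the configuration space. -/
theorem config_eq_generateFrom_voidEvent : instMeasurableSpaceConfig (X := X) =
    MeasurableSpace.generateFrom
      {V | ∃ A, MeasurableSet A ∧ Bornology.IsBounded A ∧ V = voidEvent A} := by
  refine le_antisymm ?_ (MeasurableSpace.generateFrom_le ?_)
  swap
  · rintro _ ⟨A, hA, -, rfl⟩
    exact measurableSet_voidEvent hA
  rcases isEmpty_or_nonempty X with h | ⟨⟨o⟩⟩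
  · intro s _
    have : s = ∅ := eq_empty_of_forall_notMem fun γ => by
      obtain ⟨x, -⟩ := γ.2.1.nonempty
      exact h.elim x
    rw [this]
    exact @MeasurableSet.empty _ (MeasurableSpace.generateFrom _)
  generalize hm' : MeasurableSpace.generateFrom
      {V : Set (Config X) | ∃ A, MeasurableSet A ∧ Bornology.IsBounded A ∧ V = voidEvent A} = m'
  have hvoid : ∀ A : Set X, MeasurableSet A → Bornology.IsBounded A → MeasurableSet[m'] (voidEvent A) :=
    fun A hA hAb => hm' ▸ MeasurableSpace.measurableSet_generateFrom ⟨A, hA, hAb, rfl⟩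
  suffices H : Measurable[m', instMeasurableSpaceConfig] (id : Config X → Config X) from
    fun s hs => H hs
  refine @measurable_config_of_cfgMeasure X _ _ _ _ (Config X) m' id fun A hA => ?_
  have hb : ∀ B, MeasurableSet B → Bornology.IsBounded B →
      @Measurable _ _ m' _ fun γ : Config X => cfgMeasure γ B := by
    -- The number of points in a bounded `B` is the eventual value of the number of occupied cells:
    -- once the partition separates the finitely many points, the two agree. Each cell is occupied
    -- exactly off a void event.
    intro B hB hBb
    refine @measurable_of_tendsto_metrizable _ _ m' _ _ _ _ (fun (M : ℕ) γ =>
      ∑ j ∈ Finset.range (2 ^ M), (voidEvent (B ∩ cellIdx M ⁻¹' {j}))ᶜ.indicator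
        (fun _ => (1 : ℝ≥0∞)) γ) _ (fun M => ?_) (tendsto_pi_nhds.2 fun γ => ?_)
    · refine Finset.measurable_sum _ fun j _ => Measurable.indicator measurable_const
        (MeasurableSet.compl (hvoid _ ?_ ?_))
      · exact hB.inter (measurable_cellIdx M (measurableSet_singleton j))
      · exact hBb.subset inter_subset_left
    · have hf := γ.finite_inter_of_isBounded hBb
      refine tendsto_const_nhds.congr' ?_
      filter_upwards [eventually_injOn_cellIdx hf] with M hM
      have h1 : ∀ j, (voidEvent (B ∩ cellIdx M ⁻¹' {j}))ᶜ.indicator (fun _ => (1 : ℝ≥0∞)) γ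
          = if j ∈ hf.toFinset.image (cellIdx M) then 1 else 0 := by
        intro j
        have h2 : γ ∈ (voidEvent (B ∩ cellIdx M ⁻¹' {j}))ᶜ ↔
            j ∈ hf.toFinset.image (cellIdx M) := by
          simp only [voidEvent, mem_compl_iff, mem_ofPred_eq, Finset.mem_image,
            Finite.mem_toFinset, ← ne_eq, ← nonempty_iff_ne_empty]
          constructor
          · rintro ⟨x, hx, hxB, hxj⟩
            exact ⟨x, ⟨hx, hxB⟩, hxj⟩
          · rintro ⟨x, ⟨hx, hxB⟩, hxj⟩
            exact ⟨x, hx, hxB, hxj⟩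
        by_cases hj : j ∈ hf.toFinset.image (cellIdx M)
        · rw [if_pos hj, indicator_of_mem (h2.2 hj)]
        · rw [if_neg hj, indicator_of_notMem (mt h2.1 hj)]
      simp_rw [h1]
      rw [Finset.sum_ite_mem, Finset.inter_eq_right.2, Finset.sum_const, Finset.card_image_of_injOn,
        cfgMeasure_apply γ hB, hf.encard_eq_coe_toFinset_card]
      · simp
      · intro x hx y hy
        simp only [Finite.coe_toFinset] at hx hy
        exact hM hx hy
      · intro j hj
        obtain ⟨x, -, rfl⟩ := Finset.mem_image.1 hj
        exact Finset.mem_range.2 (cellIdx_lt M x)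
  have : (fun γ : Config X => cfgMeasure (id γ) A)
      = fun γ => ⨆ n : ℕ, cfgMeasure γ (A ∩ Metric.closedBall o n) := by
    ext γ
    have hm : Monotone fun n : ℕ => A ∩ Metric.closedBall o n := fun a b hab =>
      inter_subset_inter_right _ (Metric.closedBall_subset_closedBall (by exact_mod_cast hab))
    rw [← hm.measure_iUnion, ← inter_iUnion, Metric.iUnion_closedBall_nat, inter_univ, id]
  rw [this]
  exact Measurable.iSup fun n => hb _ (hA.inter Metric.isClosed_closedBall.measurableSet)
    (Metric.isBounded_closedBall.subset inter_subset_right)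

theorem ext_of_voidEvent {P Q : Measure (Config X)} [IsProbabilityMeasure P] [IsProbabilityMeasure Q]
    (h : ∀ A, MeasurableSet A → Bornology.IsBounded A → P (voidEvent A) = Q (voidEvent A)) :
    P = Q := by
  refine ext_of_generate_finite _ config_eq_generateFrom_voidEvent isPiSystem_voidEvent ?_ (by simp)
  rintro _ ⟨A, hA, hAb, rfl⟩
  exact h A hA hAb

end VoidEvents
end
end InfiniteParticles

namespace InfiniteParticles

noncomputable section

/-! ### Volume growth and the position of the `n`-th point -/

section VolumeGrowth

variable {X : Type*} [MetricSpace X] [MeasurableSpace X]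

/-- Polynomial volume growth of the balls around `x₀`, which have finite positive volume. -/
structure HasVolumeGrowth (v : Measure X) (x₀ : X) (m : ℕ) (C : ℝ) : Prop where
  pos_const : 0 < C
  growth : ∀ r β : ℝ, 0 < r → 1 ≤ β → v (Metric.closedBall x₀ (β * r))
    ≤ ENNReal.ofReal (C * β ^ m) * v (Metric.closedBall x₀ r)
  lt_top : ∀ r, v (Metric.closedBall x₀ r) < ⊤
  pos : ∀ r, 0 < r → 0 < v (Metric.closedBall x₀ r)

/-- Growth propagates finiteness upwards from one ball. It would propagate nullity in the same way,
so a null ball of positive radius is incompatible with infinite total volume. -/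
theorem hasVolumeGrowth_of_univ_eq_top {v : Measure X} {x₀ : X} {m : ℕ} {C : ℝ} (hC : 0 < C)
    (h : ∀ r β : ℝ, 0 < r → 1 ≤ β → v (Metric.closedBall x₀ (β * r))
      ≤ ENNReal.ofReal (C * β ^ m) * v (Metric.closedBall x₀ r))
    (hloc : ∃ r : ℝ, 0 < r ∧ v (Metric.closedBall x₀ r) < ⊤) (htop : v univ = ⊤) :
    HasVolumeGrowth v x₀ m C := by
  refine ⟨hC, h, fun R => ?_, fun R hR => ?_⟩
  · obtain ⟨r, hr, hrt⟩ := hloc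
    rcases le_total R r with hRr | hRr
    · exact (measure_mono (Metric.closedBall_subset_closedBall hRr)).trans_lt hrt
    · have := h r (R / r) hr ((one_le_div hr).2 hRr)
      rw [div_mul_cancel₀ _ hr.ne'] at this
      exact this.trans_lt (ENNReal.mul_lt_top ENNReal.ofReal_lt_top hrt)
  · rw [pos_iff_ne_zero]
    intro h0
    have hz : ∀ n : ℕ, v (Metric.closedBall x₀ n) = 0 := by
      intro n
      rcases le_total (n : ℝ) R with hn | hn
      · exact measure_mono_null (Metric.closedBall_subset_closedBall hn) h0
      · have := h R (n / R) hR ((one_le_div hR).2 hn)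
        rw [div_mul_cancel₀ _ hR.ne', h0, mul_zero] at this
        exact le_antisymm this zero_le
    have := measure_iUnion_null hz
    rw [Metric.iUnion_closedBall_nat, htop] at this
    exact ENNReal.top_ne_zero this

variable [ProperSpace X] [BorelSpace X]

theorem measurableSet_Theta (v : Measure X) (x₀ : X) (α : ℝ) : MeasurableSet (Theta v x₀ α) := by
  have : Theta v x₀ α = ⋃ K : ℕ, ⋂ (r : ℕ) (_ : 1 ≤ r),
      {γ | cfgMeasure γ (Metric.closedBall x₀ r) ≤ K * v (Metric.closedBall x₀ r) ^ α} := by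
    ext γ
    simp only [Theta, mem_ofPred_eq, mem_iUnion, mem_iInter,
      cfgMeasure_apply γ Metric.isClosed_closedBall.measurableSet]
  rw [this]
  exact MeasurableSet.iUnion fun K => MeasurableSet.iInter fun r => MeasurableSet.iInter fun _ =>
    measurableSet_le (measurable_cfgMeasure_apply Metric.isClosed_closedBall.measurableSet)
      measurable_const

variable {v : Measure X} {x₀ : X} {m : ℕ} {C : ℝ}

/-- A ball of integer radius just beyond `x` contains all points of smaller rank and `x` itself, so
`rank + 1 ≤ K * vol ^ α ≤ L * radius ^ (α * m)`. Solving for the radius produces the exponent of the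
tail condition. -/
theorem HasVolumeGrowth.exists_le_of_mem_Theta (hv : HasVolumeGrowth v x₀ m C) (hm : 1 ≤ m)
    {α : ℝ} (hα : 1 ≤ α) {γ : Config X} (hγ : γ ∈ Theta v x₀ α) :
    ∃ c : ℝ, 0 < c ∧ ∀ x ∈ γ.1,
      c * ((sortRank x₀ γ x + 1 : ℕ) : ℝ) ^ (1 / (α * m)) ≤ max (dist x x₀) 1 := by
  obtain ⟨K, hK⟩ := hγ
  have hα0 : 0 < α := by linarith
  have hm0 : (0 : ℝ) < m := by exact_mod_cast hm
  have hαm : 0 < α * m := mul_pos hα0 hm0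
  set V := v (Metric.closedBall x₀ 1) with hV
  have hVt : V ≠ ⊤ := (hv.lt_top 1).ne
  set L : ℝ := K * (C * V.toReal) ^ α with hL
  have hL0 : 0 ≤ L := by
    have := hv.pos_const
    positivity
  have hmain : ∀ x ∈ γ.1, ((sortRank x₀ γ x + 1 : ℕ) : ℝ)
      ≤ L * ((⌊dist x x₀⌋₊ + 1 : ℕ) : ℝ) ^ (α * m) := by
    intro x hx
    -- A positive integer radius, as the definition of `Theta` requires; sorting by the integer part
    -- of the distance keeps all earlier points inside this ball.
    set r : ℕ := ⌊dist x x₀⌋₊ + 1 with hr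
    have h1 : ((sortRank x₀ γ x + 1 : ℕ) : ℕ∞) ≤ (γ.1 ∩ Metric.closedBall x₀ r).encard := by
      have hf : (γ.1 ∩ Metric.closedBall x₀ (r : ℝ)).Finite :=
        γ.finite_inter_of_isBounded Metric.isBounded_closedBall
      have hdist : ∀ y, sortKey x₀ y ≤ sortKey x₀ x → y ∈ Metric.closedBall x₀ (r : ℝ) := by
        intro y hy
        have h2 := Nat.floor_le_floor hy
        rw [floor_sortKey, floor_sortKey] at h2
        have h3 := Nat.lt_floor_add_one (dist y x₀)
        rw [Metric.mem_closedBall, hr]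
        have : ((⌊dist y x₀⌋₊ + 1 : ℕ) : ℝ) ≤ ((⌊dist x x₀⌋₊ + 1 : ℕ) : ℝ) := by
          exact_mod_cast Nat.succ_le_succ h2
        push_cast at this ⊢
        linarith
      rw [← hf.cast_ncard_eq, Nat.cast_le, Nat.succ_le_iff]
      refine ncard_lt_ncard ⟨fun y hy => ⟨hy.1, hdist y (le_of_lt hy.2)⟩, fun hsub => ?_⟩ hf
      exact lt_irrefl (sortKey x₀ x)
        (hsub (⟨hx, hdist x le_rfl⟩ : x ∈ γ.1 ∩ Metric.closedBall x₀ (r : ℝ))).2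
    have h2 : ((sortRank x₀ γ x + 1 : ℕ) : ℝ≥0∞)
        ≤ ((γ.1 ∩ Metric.closedBall x₀ r).encard : ℝ≥0∞) := by
      have := ENat.toENNReal_mono h1
      simpa using this
    have hr1 : (1 : ℝ) ≤ (r : ℝ) := by exact_mod_cast Nat.succ_le_succ (Nat.zero_le _)
    have h3 := hv.growth 1 r one_pos hr1
    rw [mul_one] at h3
    have h4 : ((sortRank x₀ γ x + 1 : ℕ) : ℝ≥0∞)
        ≤ K * (ENNReal.ofReal (C * (r : ℝ) ^ m) * V) ^ α :=
      h2.trans ((hK r (Nat.succ_le_succ (Nat.zero_le _))).trans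
        (mul_le_mul_right (ENNReal.rpow_le_rpow h3 hα0.le) _))
    have hC := hv.pos_const
    have h5 : (K * (ENNReal.ofReal (C * (r : ℝ) ^ m) * V) ^ α : ℝ≥0∞)
        = ENNReal.ofReal (L * (r : ℝ) ^ (α * m)) := by
      rw [← ENNReal.ofReal_toReal hVt, ← ENNReal.ofReal_mul (by positivity),
        ENNReal.ofReal_rpow_of_nonneg (by positivity) hα0.le, ← ENNReal.ofReal_natCast,
        ← ENNReal.ofReal_mul (by positivity)]
      congr 1
      rw [hL, show C * (r : ℝ) ^ m * V.toReal = (C * V.toReal) * (r : ℝ) ^ m by ring,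
        Real.mul_rpow (by positivity) (by positivity), ← Real.rpow_natCast, ← Real.rpow_mul
        (by positivity), mul_comm (m : ℝ) α]
      ring
    rw [h5, ← ENNReal.ofReal_natCast, ENNReal.ofReal_le_ofReal_iff (by positivity)] at h4
    exact h4
  -- The maximum with 1 makes `B` positive, since `L` is only known to be nonnegative.
  set B : ℝ := max L 1 ^ (1 / (α * m)) with hB
  have hB0 : 0 < B := Real.rpow_pos_of_pos (by positivity) _
  refine ⟨1 / (2 * B), by positivity, fun x hx => ?_⟩
  have h1 := hmain x hx
  have hfl : ((⌊dist x x₀⌋₊ + 1 : ℕ) : ℝ) ≤ 2 * max (dist x x₀) 1 := by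
    push_cast
    linarith [Nat.floor_le (dist_nonneg : 0 ≤ dist x x₀), le_max_left (dist x x₀) 1,
      le_max_right (dist x x₀) 1]
  have h2 : ((sortRank x₀ γ x + 1 : ℕ) : ℝ) ^ (1 / (α * m))
      ≤ B * (2 * max (dist x x₀) 1) := by
    calc ((sortRank x₀ γ x + 1 : ℕ) : ℝ) ^ (1 / (α * m))
        ≤ (max L 1 * (2 * max (dist x x₀) 1) ^ (α * m)) ^ (1 / (α * m)) := by
          refine Real.rpow_le_rpow (by positivity) (h1.trans ?_) (by positivity)
          exact mul_le_mul (le_max_left _ _) (Real.rpow_le_rpow (by positivity) hfl hαm.le)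
            (by positivity) (by positivity)
      _ = B * (2 * max (dist x x₀) 1) := by
          rw [Real.mul_rpow (by positivity) (by positivity), ← Real.rpow_mul (by positivity),
            mul_one_div_cancel hαm.ne', Real.rpow_one]
  rw [one_div, inv_mul_le_iff₀ (by positivity)]
  linarith

end VolumeGrowth

/-! ### Independent motion of sequences -/

section SequenceKernels

variable {X : Type*} [MeasurableSpace X]

/-- The law of independent particles started at the points of a sequence. -/
def seqKernel (κ : Kernel X X) [IsMarkovKernel κ] : Kernel (ℕ → X) (ℕ → X) where
  toFun x := Measure.infinitePi fun n => κ (x n)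
  measurable' := by
    refine Measurable.measure_of_isPiSystem_of_isProbabilityMeasure
      (S := squareCylinders fun _ : ℕ => {s : Set X | MeasurableSet s})
      generateFrom_squareCylinders.symm
      (isPiSystem_squareCylinders (fun _ => MeasurableSpace.isPiSystem_measurableSet)
        fun _ => MeasurableSet.univ) ?_
    rintro _ ⟨s, t, ht, rfl⟩
    have ht' : ∀ i, MeasurableSet (t i) := fun i => ht i (mem_univ i)
    simp_rw [Measure.infinitePi_pi _ fun i _ => ht' i]
    exact Finset.measurable_prod _ fun i _ =>
      (κ.measurable_coe (ht' i)).comp (measurable_pi_apply i)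

theorem seqKernel_apply (κ : Kernel X X) [IsMarkovKernel κ] (x : ℕ → X) :
    seqKernel κ x = Measure.infinitePi fun n => κ (x n) := rfl

instance (κ : Kernel X X) [IsMarkovKernel κ] : IsMarkovKernel (seqKernel κ) :=
  ⟨fun x => by rw [seqKernel_apply]; infer_instance⟩

theorem lintegral_prod_infinitePi (ν : ℕ → Measure X) [∀ n, IsProbabilityMeasure (ν n)]
    (s : Finset ℕ) {f : ℕ → X → ℝ≥0∞} (hf : ∀ n, Measurable (f n)) :
    ∫⁻ y, ∏ n ∈ s, f n (y n) ∂(Measure.infinitePi ν) = ∏ n ∈ s, ∫⁻ y, f n y ∂(ν n) := by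
  refine (lintegral_prod_eq_prod_lintegral_of_indepFun s (fun n (y : ℕ → X) => f n (y n))
    (iIndepFun_infinitePi hf) fun n => (hf n).comp (measurable_pi_apply n)).trans ?_
  refine Finset.prod_congr rfl fun n _ => ?_
  rw [← Measure.infinitePi_map_eval ν n, lintegral_map (hf n) (measurable_pi_apply n)]

/-- A product measure is determined by cylinders, on which independence reduces the composition to
one coordinate at a time. -/
theorem seqKernel_comp (κ η ρ : Kernel X X) [IsMarkovKernel κ] [IsMarkovKernel η]
    [IsMarkovKernel ρ] (h : ρ = η ∘ₖ κ) : seqKernel ρ = seqKernel η ∘ₖ seqKernel κ := by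
  ext1 x
  symm
  rw [seqKernel_apply]
  refine Measure.eq_infinitePi _ fun s t ht => ?_
  rw [Kernel.comp_apply' _ _ _ (MeasurableSet.pi s.countable_toSet fun i _ => ht i)]
  simp_rw [seqKernel_apply, Measure.infinitePi_pi _ fun i _ => ht i]
  rw [lintegral_prod_infinitePi _ s (f := fun n y => η y (t n)) fun n => η.measurable_coe (ht n)]
  refine Finset.prod_congr rfl fun n _ => ?_
  rw [h, Kernel.comp_apply' _ _ _ (ht n)]

/-- Coincidences are excluded by countably many null sets, accumulation by the Borel–Cantelli lemma
for each ball of integer radius. -/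
theorem ae_mem_goodSeq {X : Type*} [MetricSpace X] [ProperSpace X] [MeasurableSpace X]
    [BorelSpace X] (o : X) (ν : ℕ → Measure X) [∀ n, IsProbabilityMeasure (ν n)]
    (hdiag : ∀ i j, i ≠ j → ((ν i).prod (ν j)) {q : X × X | q.1 = q.2} = 0)
    (hsum : ∀ N : ℕ, ∑' n, ν n (Metric.closedBall o N) < ⊤) :
    ∀ᵐ y ∂(Measure.infinitePi ν), y ∈ goodSeq X := by
  have h1 : ∀ i j, i ≠ j → ∀ᵐ y ∂(Measure.infinitePi ν), y i ≠ y j := by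
    intro i j hij
    have hm : MeasurableSet {q : X × X | q.1 = q.2} := measurableSet_eq_fun measurable_fst measurable_snd
    have h4 := hdiag i j hij
    rw [← Measure.infinitePi_map_eval_prod (P := ν) hij, Measure.map_apply (by fun_prop) hm] at h4
    filter_upwards [measure_eq_zero_iff_ae_notMem.1 h4] with y hy using hy
  have h2 : ∀ N : ℕ, ∀ᵐ y ∂(Measure.infinitePi ν), ∀ᶠ n in atTop, y n ∉ Metric.closedBall o N := by
    intro N
    refine ae_eventually_notMem (s := fun n => {y : ℕ → X | y n ∈ Metric.closedBall o (N : ℝ)}) ?_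
    refine (lt_of_le_of_lt (le_of_eq ?_) (hsum N)).ne
    refine tsum_congr fun n => ?_
    rw [← Measure.infinitePi_map_eval ν n,
      Measure.map_apply (measurable_pi_apply n) Metric.isClosed_closedBall.measurableSet]
    rfl
  rw [← ae_all_iff] at h2
  have h1' : ∀ᵐ y ∂(Measure.infinitePi ν), ∀ i j, i ≠ j → y i ≠ y j := by
    rw [ae_all_iff]; intro i
    rw [ae_all_iff]; intro j
    by_cases hij : i = j
    · exact Eventually.of_forall fun y h => (h hij).elim
    · filter_upwards [h1 i j hij] with y hy _ using hy
  filter_upwards [h1', h2] with y hy1 hy2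
  refine (mem_goodSeq_iff o).2 ⟨fun i j hij => ?_, hy2⟩
  by_contra h
  exact hy1 i j h hij

/-- Two numerations differ by a permutation of `ℕ`; it permutes the factors of the product measure
and leaves the range of a sequence unchanged. -/
theorem configLaw_congr_numeration {X : Type*} [MetricSpace X] [ProperSpace X] [MeasurableSpace X]
    [BorelSpace X] (κ : Kernel X X) [IsMarkovKernel κ] {γ : Config X} {x y : ℕ → X}
    (hx : IsNumeration x γ) (hy : IsNumeration y γ)
    (hgood : ∀ᵐ u ∂(Measure.infinitePi fun n => κ (x n)), u ∈ goodSeq X) :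
    configLaw (fun n => κ (y n)) = configLaw fun n => κ (x n) := by
  obtain ⟨σ, hσ⟩ : ∃ σ : ℕ ≃ ℕ, ∀ n, y n = x (σ n) := by
    have h : ∀ n, ∃ k, x k = y n := fun n => by
      have : y n ∈ range x := by rw [hx.2, ← hy.2]; exact mem_range_self n
      exact this
    choose f hf using h
    refine ⟨Equiv.ofBijective f ⟨fun a b hab => hy.1 ?_, fun k => ?_⟩, fun n => (hf n).symm⟩
    · rw [← hf, ← hf, hab]
    · have : x k ∈ range y := by rw [hy.2, ← hx.2]; exact mem_range_self k
      obtain ⟨n, hn⟩ := this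
      exact ⟨n, hx.1 ((hf n).trans hn)⟩
  have hmap : Measure.infinitePi (fun n => κ (y n))
      = (Measure.infinitePi fun n => κ (x n)).map fun u n => u (σ n) := by
    have := Measure.map_infinitePi_infinitePi_of_inj (P := fun n => κ (x n)) σ.injective
    simp_rw [hσ]
    exact this.symm
  have hm : Measurable fun (u : ℕ → X) n => u (σ n) := by fun_prop
  have hg : ∀ u : ℕ → X, u ∈ goodSeq X → (fun n => u (σ n)) ∈ goodSeq X := by
    intro u hu
    exact (show IsNumeration (fun n => u (σ n)) (seqToConfig ⟨u, hu⟩) from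
      ⟨hu.1.comp σ.injective, (σ.surjective.range_comp u)⟩).mem_goodSeq
  have hgood' : ∀ᵐ u ∂(Measure.infinitePi fun n => κ (y n)), u ∈ goodSeq X := by
    rw [hmap]
    refine (ae_map_iff hm.aemeasurable (p := fun u => u ∈ goodSeq X) measurableSet_goodSeq).2 ?_
    filter_upwards [hgood] with u hu using hg u hu
  rw [configLaw_eq_map γ hgood, configLaw_eq_map γ hgood', hmap,
    Measure.map_map (measurable_toConfig γ) hm]
  refine Measure.map_congr ?_
  filter_upwards [hgood] with u hu
  exact (show IsNumeration (fun n => u (σ n)) (toConfig γ u) from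
    ⟨hu.1.comp σ.injective, (σ.surjective.range_comp u).trans
      (isNumeration_toConfig γ hu).2⟩).toConfig_eq γ

end SequenceKernels
end
end InfiniteParticles

namespace InfiniteParticles

noncomputable section

/-! ### Tail summability for all times -/

section Tails

variable {X : Type*} [MetricSpace X] [MeasurableSpace X] [BorelSpace X]

/-- The largest probability of moving further than `ρ`. -/
def tailSup (κ : Kernel X X) (ρ : ℝ) : ℝ≥0∞ := ⨆ x : X, κ x (Metric.closedBall x ρ)ᶜ

omit [BorelSpace X] in
theorem le_tailSup (κ : Kernel X X) (ρ : ℝ) (x : X) : κ x (Metric.closedBall x ρ)ᶜ ≤ tailSup κ ρ :=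
  le_iSup (fun x : X => κ x (Metric.closedBall x ρ)ᶜ) x

/-- A total displacement beyond `ρ` forces one of the two steps beyond `ρ / 2`; the supremum over
starting points makes the second bound uniform in the intermediate position. -/
theorem tailSup_comp_le (κ η : Kernel X X) [IsMarkovKernel κ] [IsMarkovKernel η] (ρ : ℝ) :
    tailSup (η ∘ₖ κ) ρ ≤ tailSup κ (ρ / 2) + tailSup η (ρ / 2) := by
  refine iSup_le fun x => ?_
  have hm : ∀ r, MeasurableSet (Metric.closedBall x r)ᶜ := fun r =>
    Metric.isClosed_closedBall.measurableSet.compl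
  rw [Kernel.comp_apply' _ _ _ (hm _)]
  calc ∫⁻ y, η y (Metric.closedBall x ρ)ᶜ ∂(κ x)
      ≤ ∫⁻ y, ((Metric.closedBall x (ρ / 2))ᶜ.indicator 1 y + tailSup η (ρ / 2)) ∂(κ x) := by
        refine lintegral_mono fun y => ?_
        by_cases hy : y ∈ Metric.closedBall x (ρ / 2)
        · refine le_add_left ((measure_mono ?_).trans (le_tailSup η (ρ / 2) y))
          refine compl_subset_compl.2 fun u hu => ?_
          rw [Metric.mem_closedBall] at *
          linarith [dist_triangle u y x]
        · rw [indicator_of_mem (mem_compl hy)]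
          exact le_add_right prob_le_one
    _ = κ x (Metric.closedBall x (ρ / 2))ᶜ + tailSup η (ρ / 2) := by
        rw [lintegral_add_right _ measurable_const, lintegral_indicator_one (hm _), lintegral_const,
          measure_univ, mul_one]
    _ ≤ _ := add_le_add_left (le_tailSup κ _ x) _

/-- Summability of the tails on the scale `n ^ τ`. -/
def SummableTails (τ : ℝ) (κ : Kernel X X) : Prop :=
  ∀ δ : ℝ, 0 < δ → ∑' n : ℕ, tailSup κ (δ * ((n + 1 : ℕ) : ℝ) ^ τ) < ⊤

theorem SummableTails.comp {τ : ℝ} {κ η : Kernel X X} [IsMarkovKernel κ] [IsMarkovKernel η]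
    (hκ : SummableTails τ κ) (hη : SummableTails τ η) : SummableTails τ (η ∘ₖ κ) := by
  intro δ hδ
  refine lt_of_le_of_lt (ENNReal.tsum_le_tsum fun n => tailSup_comp_le κ η _) ?_
  rw [ENNReal.tsum_add]
  have h : ∀ n : ℕ, δ * ((n + 1 : ℕ) : ℝ) ^ τ / 2 = δ / 2 * ((n + 1 : ℕ) : ℝ) ^ τ := fun n => by ring
  simp_rw [h]
  exact ENNReal.add_lt_top.2 ⟨hκ _ (half_pos hδ), hη _ (half_pos hδ)⟩

theorem summableTails_id (τ : ℝ) : SummableTails τ (Kernel.id : Kernel X X) := by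
  intro δ hδ
  have : ∀ n : ℕ, tailSup (Kernel.id : Kernel X X) (δ * ((n + 1 : ℕ) : ℝ) ^ τ) = 0 := by
    intro n
    refine le_antisymm (iSup_le fun x => ?_) zero_le
    rw [Kernel.id_apply, Measure.dirac_apply' _ Metric.isClosed_closedBall.measurableSet.compl,
      indicator_of_notMem]
    rw [notMem_compl_iff]
    exact Metric.mem_closedBall_self (by positivity)
  simp_rw [this]
  simp

/-- Write `t` as `k` steps of length `t / k < ε`. Each composition only halves `δ`, and `δ` is
arbitrary. -/
theorem IsMarkovSemigroup.summableTails {τ : ℝ} {p : ℝ≥0 → Kernel X X} (hp : IsMarkovSemigroup p)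
    {ε : ℝ≥0} (hε : 0 < ε) (h : ∀ t, 0 < t → t < ε → SummableTails τ (p t)) (t : ℝ≥0) :
    SummableTails τ (p t) := by
  have hmul : ∀ s, SummableTails τ (p s) → ∀ k : ℕ, SummableTails τ (p (k * s)) := by
    intro s hs k
    induction k with
    | zero =>
      rw [Nat.cast_zero, zero_mul, hp.zero]
      exact summableTails_id τ
    | succ k ih =>
      have := hp.markov s
      have := hp.markov (k * s)
      rw [Nat.cast_succ, add_mul, one_mul, hp.add]
      exact ih.comp hs
  rcases eq_or_ne t 0 with rfl | ht
  · rw [hp.zero]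
    exact summableTails_id τ
  obtain ⟨k, hk⟩ := exists_nat_gt (t / ε)
  have hk0 : (0 : ℝ≥0) < k := lt_of_le_of_lt zero_le hk
  have h1 : t / k < ε := by
    rw [div_lt_iff₀ hk0]
    rwa [div_lt_iff₀ hε, mul_comm] at hk
  have := hmul _ (h (t / k) (div_pos (pos_iff_ne_zero.2 ht) hk0) h1) k
  rwa [mul_div_cancel₀ _ hk0.ne'] at this

end Tails

/-! ### Moved configurations stay in `Theta` -/

section ThetaInvariance

variable {X : Type*} [MetricSpace X] [MeasurableSpace X] [BorelSpace X] [ProperSpace X]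
  {v : Measure X} {x₀ : X} {m : ℕ} {C : ℝ} {α : ℝ} {γ : Config X} {κ : Kernel X X}

/-- By the rank estimate the allowed displacement is at least `η * c * (rank + 1) ^ (1 / (α * m))`.
Distinct points have distinct ranks, so the sum is part of the uniform tail series. -/
theorem HasVolumeGrowth.tsum_tail_lt_top (hv : HasVolumeGrowth v x₀ m C) (hm : 1 ≤ m)
    (hα : 1 ≤ α) (hγ : γ ∈ Theta v x₀ α) (hκ : SummableTails (1 / (α * m)) κ) {x : ℕ → X}
    (hx : IsNumeration x γ) {η : ℝ} (hη : 0 < η) :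
    ∑' n, κ (x n) (Metric.closedBall (x n) (η * max (dist (x n) x₀) 1))ᶜ < ⊤ := by
  obtain ⟨c, hc, h⟩ := hv.exists_le_of_mem_Theta hm hα hγ
  have hxm : ∀ n, x n ∈ γ.1 := fun n => by rw [← hx.2]; exact mem_range_self n
  have hinj : Function.Injective fun n => sortRank x₀ γ (x n) := fun i j hij =>
    hx.1 (injOn_sortRank x₀ γ (hxm i) (hxm j) hij)
  refine lt_of_le_of_lt (ENNReal.tsum_le_tsum fun n => ?_) (lt_of_le_of_lt
    (ENNReal.tsum_comp_le_tsum_of_injective hinj _) (hκ (η * c) (by positivity)))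
  refine (measure_mono (compl_subset_compl.2 (Metric.closedBall_subset_closedBall ?_))).trans
    (le_tailSup κ _ (x n))
  rw [mul_assoc]
  exact mul_le_mul_of_nonneg_left (h (x n) (hxm n)) hη.le

/-- A particle outside a ball of radius `2|R| + 2` must travel more than half its distance from `x₀`
to enter `B(R)`. The finitely many particles inside contribute at most 1 each. -/
theorem HasVolumeGrowth.tsum_closedBall_lt_top [IsMarkovKernel κ] (hv : HasVolumeGrowth v x₀ m C)
    (hm : 1 ≤ m) (hα : 1 ≤ α) (hγ : γ ∈ Theta v x₀ α) (hκ : SummableTails (1 / (α * m)) κ)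
    {x : ℕ → X} (hx : IsNumeration x γ) (R : ℝ) :
    ∑' n, κ (x n) (Metric.closedBall x₀ R) < ⊤ := by
  have hB : MeasurableSet (Metric.closedBall x₀ (2 * |R| + 2)) :=
    Metric.isClosed_closedBall.measurableSet
  refine lt_of_le_of_lt (ENNReal.tsum_le_tsum (g := fun n =>
    κ (x n) (Metric.closedBall (x n) (1 / 2 * max (dist (x n) x₀) 1))ᶜ
      + (Metric.closedBall x₀ (2 * |R| + 2)).indicator 1 (x n)) fun n => ?_) ?_
  · by_cases h : x n ∈ Metric.closedBall x₀ (2 * |R| + 2)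
    · rw [indicator_of_mem h]
      exact le_add_left prob_le_one
    · refine le_add_right (measure_mono fun y hy hy' => ?_)
      rw [Metric.mem_closedBall] at *
      have := le_abs_self R
      have := abs_nonneg R
      rw [max_eq_left (by linarith)] at hy'
      linarith [dist_triangle (x n) y x₀, dist_comm y (x n)]
  · rw [ENNReal.tsum_add, ← hx.cfgMeasure_apply hB]
    exact ENNReal.add_lt_top.2 ⟨hv.tsum_tail_lt_top hm hα hγ hκ hx one_half_pos,
      cfgMeasure_lt_top γ Metric.isBounded_closedBall⟩

/-- Apart from `N` exceptional particles, those in `B(r)` after the motion were in `B(2r)` before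
it, and the growth condition compares the volumes of the two balls. -/
theorem HasVolumeGrowth.mem_Theta_of_eventually (hv : HasVolumeGrowth v x₀ m C) (hα : 1 ≤ α)
    (hγ : γ ∈ Theta v x₀ α) {x y : ℕ → X} (hx : IsNumeration x γ) {ξ : Config X}
    (hy : IsNumeration y ξ)
    (h : ∀ᶠ n in atTop, y n ∈ Metric.closedBall (x n) (1 / 2 * max (dist (x n) x₀) 1)) :
    ξ ∈ Theta v x₀ α := by
  obtain ⟨K, hK⟩ := hγ
  obtain ⟨N, hN⟩ := eventually_atTop.1 h
  have hα0 : 0 ≤ α := by linarith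
  set V := v (Metric.closedBall x₀ 1) with hV
  set D : ℝ≥0∞ := ENNReal.ofReal (C * 2 ^ m) with hD
  have hVt : V ^ α ≠ ⊤ := ENNReal.rpow_ne_top_of_nonneg hα0 (hv.lt_top 1).ne
  have hV0 : V ^ α ≠ 0 := by
    rw [ne_eq, ENNReal.rpow_eq_zero_iff_of_pos (by linarith)]
    exact (hv.pos 1 one_pos).ne'
  -- The `N` exceptional particles are absorbed using `vol(B(r)) ≥ vol(B(1)) > 0`; the other summand
  -- is the doubling constant to the power `α` times the old `K`.
  obtain ⟨L, hL⟩ := ENNReal.exists_nat_gt (r := N / V ^ α + K * D ^ α) (ENNReal.add_ne_top.2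
    ⟨ENNReal.div_ne_top (ENNReal.natCast_ne_top N) hV0, ENNReal.mul_ne_top (ENNReal.natCast_ne_top K)
      (ENNReal.rpow_ne_top_of_nonneg hα0 ENNReal.ofReal_ne_top)⟩)
  refine ⟨L, fun r hr => ?_⟩
  have hr1 : (1 : ℝ) ≤ r := by exact_mod_cast hr
  have hm : ∀ s, MeasurableSet (Metric.closedBall x₀ s) := fun s =>
    Metric.isClosed_closedBall.measurableSet
  have h2r : ((2 * r : ℕ) : ℝ) = 2 * r := by push_cast; ring
  rw [← cfgMeasure_apply ξ (hm _), hy.cfgMeasure_apply (hm _)]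
  calc ∑' n, (Metric.closedBall x₀ (r : ℝ)).indicator 1 (y n)
      ≤ ∑' n, ((Finset.range N : Set ℕ).indicator 1 n
          + (Metric.closedBall x₀ ((2 * r : ℕ) : ℝ)).indicator 1 (x n)) := by
        refine ENNReal.tsum_le_tsum fun n => ?_
        by_cases hyn : y n ∈ Metric.closedBall x₀ (r : ℝ)
        · rw [indicator_of_mem hyn]
          by_cases hn : n < N
          · rw [indicator_of_mem (by simpa using hn)]
            exact le_add_right le_rfl
          · rw [indicator_of_mem (s := Metric.closedBall x₀ ((2 * r : ℕ) : ℝ)) ?_]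
            · exact le_add_left le_rfl
            have h1 := hN n (not_lt.1 hn)
            rw [Metric.mem_closedBall] at *
            rw [h2r]
            have h3 := dist_triangle (x n) (y n) x₀
            rw [dist_comm (x n) (y n)] at h3
            rcases max_cases (dist (x n) x₀) 1 with ⟨h4, h5⟩ | ⟨h4, h5⟩
            · rw [h4] at h1; linarith
            · linarith
        · rw [indicator_of_notMem hyn]
          exact zero_le
    _ = N + cfgMeasure γ (Metric.closedBall x₀ ((2 * r : ℕ) : ℝ)) := by
        rw [ENNReal.tsum_add, ← hx.cfgMeasure_apply (hm _), tsum_eq_sum (s := Finset.range N)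
          fun n hn => indicator_of_notMem (by simpa using hn) _]
        congr 1
        rw [Finset.sum_congr rfl fun n hn => indicator_of_mem (by simpa using hn) _]
        simp
    _ ≤ N / V ^ α * v (Metric.closedBall x₀ r) ^ α
          + K * D ^ α * v (Metric.closedBall x₀ r) ^ α := by
        refine add_le_add ?_ ?_
        · calc (N : ℝ≥0∞) = N / V ^ α * V ^ α := (ENNReal.div_mul_cancel hV0 hVt).symm
            _ ≤ _ := mul_le_mul_right (ENNReal.rpow_le_rpow
              (measure_mono (Metric.closedBall_subset_closedBall hr1)) hα0) _
        · rw [cfgMeasure_apply γ (hm _), mul_assoc, ← ENNReal.mul_rpow_of_nonneg _ _ hα0]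
          refine (hK (2 * r) (by omega)).trans (mul_le_mul_right (ENNReal.rpow_le_rpow ?_ hα0) _)
          rw [h2r]
          exact hv.growth r 2 (by linarith) one_le_two
    _ ≤ L * v (Metric.closedBall x₀ r) ^ α := by
        rw [← add_mul]
        exact mul_le_mul_left hL.le _

/-- Non-coincidence of independent particles with kernel `κ`. -/
def NonCoinciding (κ : Kernel X X) : Prop :=
  ∀ x y, x ≠ y → ((κ x).prod (κ y)) {q : X × X | q.1 = q.2} = 0

variable [IsMarkovKernel κ]

theorem HasVolumeGrowth.ae_mem_goodSeq (hv : HasVolumeGrowth v x₀ m C) (hm : 1 ≤ m)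
    (hα : 1 ≤ α) (hγ : γ ∈ Theta v x₀ α) (hκ : SummableTails (1 / (α * m)) κ)
    (hco : NonCoinciding κ) {x : ℕ → X} (hx : IsNumeration x γ) :
    ∀ᵐ y ∂(seqKernel κ x), y ∈ goodSeq X :=
  InfiniteParticles.ae_mem_goodSeq x₀ _ (fun _ _ hij => hco _ _ (hx.1.ne hij)) fun N =>
    hv.tsum_closedBall_lt_top hm hα hγ hκ hx N

/-- Borel–Cantelli with `η = 1 / 2`: almost surely all but finitely many particles move by at most
half of `max dist 1`. -/
theorem HasVolumeGrowth.ae_toConfig_mem_Theta (hv : HasVolumeGrowth v x₀ m C) (hm : 1 ≤ m)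
    (hα : 1 ≤ α) (hγ : γ ∈ Theta v x₀ α) (hκ : SummableTails (1 / (α * m)) κ)
    (hco : NonCoinciding κ) {x : ℕ → X} (hx : IsNumeration x γ) (γ₀ : Config X) :
    ∀ᵐ y ∂(seqKernel κ x), y ∈ goodSeq X ∧ toConfig γ₀ y ∈ Theta v x₀ α := by
  have h := hv.tsum_tail_lt_top hm hα hγ hκ hx one_half_pos
  have h1 : ∀ᵐ y ∂(seqKernel κ x), ∀ᶠ n in atTop,
      y n ∉ (Metric.closedBall (x n) (1 / 2 * max (dist (x n) x₀) 1))ᶜ := by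
    refine ae_eventually_notMem
      (s := fun n => {y : ℕ → X | y n ∈ (Metric.closedBall (x n) (1 / 2 * max (dist (x n) x₀) 1))ᶜ}) ?_
    refine (lt_of_le_of_lt (le_of_eq (tsum_congr fun n => ?_)) h).ne
    rw [seqKernel_apply, ← Measure.infinitePi_map_eval (fun n => κ (x n)) n,
      Measure.map_apply (measurable_pi_apply n) Metric.isClosed_closedBall.measurableSet.compl]
    rfl
  filter_upwards [hv.ae_mem_goodSeq hm hα hγ hκ hco hx, h1] with y hy hy1
  refine ⟨hy, hv.mem_Theta_of_eventually hα hγ hx (isNumeration_toConfig γ₀ hy) ?_⟩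
  filter_upwards [hy1] with n hn
  exact notMem_compl_iff.1 hn

end ThetaInvariance

/-! ### The semigroup on configurations -/

section ConfigKernel

variable {X : Type*} [MetricSpace X] [MeasurableSpace X] [BorelSpace X] [ProperSpace X]

/-- The law of independent particles started at the points of a configuration. -/
def cfgKernel (o : X) (κ : Kernel X X) [IsMarkovKernel κ] : Kernel (Config X) (Config X) where
  toFun γ := configLaw fun n => κ (enum o γ n)
  measurable' := by
    refine Measure.measurable_of_measurable_coe _ fun A hA => ?_
    have hm : MeasurableSet ((Subtype.val : goodSeq X → ℕ → X) '' (seqToConfig ⁻¹' A)) :=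
      (MeasurableEmbedding.subtype_coe measurableSet_goodSeq).measurableSet_image.2
        (measurable_seqToConfig hA)
    have he : ∀ γ, configLaw (fun n => κ (enum o γ n)) A
        = seqKernel κ (enum o γ) ((Subtype.val : goodSeq X → ℕ → X) '' (seqToConfig ⁻¹' A)) := by
      intro γ
      rw [configLaw, Measure.map_apply measurable_seqToConfig hA,
        (MeasurableEmbedding.subtype_coe measurableSet_goodSeq).comap_apply, seqKernel_apply]
    simp_rw [he]
    -- This is where the numeration must depend measurably on the configuration.
    exact ((seqKernel κ).measurable_coe hm).comp
      (measurable_pi_lambda _ fun n => measurable_enum o n)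

theorem cfgKernel_apply (o : X) (κ : Kernel X X) [IsMarkovKernel κ] (γ : Config X) :
    cfgKernel o κ γ = configLaw fun n => κ (enum o γ n) := rfl

variable {v : Measure X} {x₀ : X} {m : ℕ} {C : ℝ} {α : ℝ} {γ : Config X} {κ : Kernel X X}
  [IsMarkovKernel κ]

theorem HasVolumeGrowth.configLaw_eq (hv : HasVolumeGrowth v x₀ m C) (hm : 1 ≤ m)
    (hα : 1 ≤ α) (hγ : γ ∈ Theta v x₀ α) (hκ : SummableTails (1 / (α * m)) κ)
    (hco : NonCoinciding κ) {x : ℕ → X} (hx : IsNumeration x γ) (γ₀ : Config X) :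
    configLaw (fun n => κ (x n)) = (seqKernel κ x).map (toConfig γ₀) :=
  configLaw_eq_map γ₀ (hv.ae_mem_goodSeq hm hα hγ hκ hco hx)

theorem HasVolumeGrowth.cfgKernel_eq (hv : HasVolumeGrowth v x₀ m C) (hm : 1 ≤ m)
    (hα : 1 ≤ α) (hγ : γ ∈ Theta v x₀ α) (hκ : SummableTails (1 / (α * m)) κ)
    (hco : NonCoinciding κ) {x : ℕ → X} (hx : IsNumeration x γ) :
    cfgKernel x₀ κ γ = configLaw fun n => κ (x n) := by
  rw [cfgKernel_apply]
  exact configLaw_congr_numeration κ hx (isNumeration_enum x₀ γ)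
    (hv.ae_mem_goodSeq hm hα hγ hκ hco hx)

theorem HasVolumeGrowth.cfgKernel_eq_map (hv : HasVolumeGrowth v x₀ m C) (hm : 1 ≤ m)
    (hα : 1 ≤ α) (hγ : γ ∈ Theta v x₀ α) (hκ : SummableTails (1 / (α * m)) κ)
    (hco : NonCoinciding κ) {x : ℕ → X} (hx : IsNumeration x γ) (γ₀ : Config X) :
    cfgKernel x₀ κ γ = (seqKernel κ x).map (toConfig γ₀) := by
  rw [hv.cfgKernel_eq hm hα hγ hκ hco hx, hv.configLaw_eq hm hα hγ hκ hco hx γ₀]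

theorem HasVolumeGrowth.isProbabilityMeasure_cfgKernel (hv : HasVolumeGrowth v x₀ m C) (hm : 1 ≤ m)
    (hα : 1 ≤ α) (hγ : γ ∈ Theta v x₀ α) (hκ : SummableTails (1 / (α * m)) κ)
    (hco : NonCoinciding κ) : IsProbabilityMeasure (cfgKernel x₀ κ γ) := by
  rw [hv.cfgKernel_eq_map hm hα hγ hκ hco (isNumeration_enum x₀ γ) γ]
  exact Measure.isProbabilityMeasure_map (measurable_toConfig γ).aemeasurable

theorem HasVolumeGrowth.ae_mem_Theta (hv : HasVolumeGrowth v x₀ m C) (hm : 1 ≤ m)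
    (hα : 1 ≤ α) (hγ : γ ∈ Theta v x₀ α) (hκ : SummableTails (1 / (α * m)) κ)
    (hco : NonCoinciding κ) : ∀ᵐ ξ ∂(cfgKernel x₀ κ γ), ξ ∈ Theta v x₀ α := by
  rw [hv.cfgKernel_eq_map hm hα hγ hκ hco (isNumeration_enum x₀ γ) γ]
  refine (ae_map_iff (measurable_toConfig γ).aemeasurable (p := fun ξ => ξ ∈ Theta v x₀ α)
    (measurableSet_Theta v x₀ α)).2 ?_
  filter_upwards [hv.ae_toConfig_mem_Theta hm hα hγ hκ hco (isNumeration_enum x₀ γ) γ] with y hy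
    using hy.2

/-- The Chapman–Kolmogorov equation for independent particles. -/
theorem HasVolumeGrowth.cfgKernel_comp {η ρ : Kernel X X} [IsMarkovKernel η] [IsMarkovKernel ρ]
    (hv : HasVolumeGrowth v x₀ m C) (hm : 1 ≤ m)
    (hα : 1 ≤ α) (hγ : γ ∈ Theta v x₀ α) (hκ : SummableTails (1 / (α * m)) κ)
    (hco : NonCoinciding κ) (hη : SummableTails (1 / (α * m)) η) (hcoη : NonCoinciding η)
    (hcoρ : NonCoinciding ρ) (h : ρ = η ∘ₖ κ) {A : Set (Config X)} (hA : MeasurableSet A) :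
    cfgKernel x₀ ρ γ A = ∫⁻ ξ, cfgKernel x₀ η ξ A ∂(cfgKernel x₀ κ γ) := by
  have hx := isNumeration_enum x₀ γ
  have hρ : SummableTails (1 / (α * m)) ρ := h ▸ hκ.comp hη
  have hm' := measurable_toConfig γ
  rw [hv.cfgKernel_eq_map hm hα hγ hκ hco hx γ, hv.cfgKernel_eq_map hm hα hγ hρ hcoρ hx γ,
    lintegral_map ((cfgKernel x₀ η).measurable_coe hA) hm', seqKernel_comp κ η ρ h,
    Measure.map_apply hm' hA, Kernel.comp_apply' _ _ _ (hm' hA)]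
  refine lintegral_congr_ae ?_
  -- The moved sequence `y` numerates the moved configuration, so the second step may start from `y`
  -- instead of the sorted numeration.
  filter_upwards [hv.ae_toConfig_mem_Theta hm hα hγ hκ hco hx γ] with y hy
  rw [hv.cfgKernel_eq_map hm hα hy.2 hη hcoη (isNumeration_toConfig γ hy.1) γ,
    Measure.map_apply hm' hA]

/-- The kernel of independent particles, on the configurations of `Theta`. -/
def thetaKernel (v : Measure X) (x₀ : X) (α : ℝ) (κ : Kernel X X) [IsMarkovKernel κ] :
    Kernel (Theta v x₀ α) (Theta v x₀ α) :=
  ((cfgKernel x₀ κ).comap Subtype.val measurable_subtype_coe).comapRight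
    (MeasurableEmbedding.subtype_coe (measurableSet_Theta v x₀ α))

/-- The restriction to `Theta` loses no mass, because the law is concentrated there. -/
theorem HasVolumeGrowth.thetaKernel_map (hv : HasVolumeGrowth v x₀ m C) (hm : 1 ≤ m)
    (hα : 1 ≤ α) (hκ : SummableTails (1 / (α * m)) κ) (hco : NonCoinciding κ)
    (γ : Theta v x₀ α) : (thetaKernel v x₀ α κ γ).map Subtype.val = cfgKernel x₀ κ γ.1 := by
  rw [thetaKernel, Kernel.comapRight_apply, Kernel.comap_apply,
    (MeasurableEmbedding.subtype_coe (measurableSet_Theta v x₀ α)).map_comap, Subtype.range_coe]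
  exact Measure.restrict_eq_self_of_ae_mem (hv.ae_mem_Theta hm hα γ.2 hκ hco)

theorem HasVolumeGrowth.isMarkovKernel_thetaKernel (hv : HasVolumeGrowth v x₀ m C) (hm : 1 ≤ m)
    (hα : 1 ≤ α) (hκ : SummableTails (1 / (α * m)) κ) (hco : NonCoinciding κ) :
    IsMarkovKernel (thetaKernel v x₀ α κ) := by
  refine ⟨fun γ => ⟨?_⟩⟩
  have := hv.isProbabilityMeasure_cfgKernel hm hα γ.2 hκ hco
  have h := hv.thetaKernel_map hm hα hκ hco γ
  rw [← preimage_univ (f := Subtype.val), ← Measure.map_apply measurable_subtype_coe MeasurableSet.univ,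
    h, measure_univ]

/-- The infinite particle semigroup. -/
theorem HasVolumeGrowth.isMarkovSemigroup_thetaKernel {p : ℝ≥0 → Kernel X X}
    [∀ t, IsMarkovKernel (p t)]
    (hv : HasVolumeGrowth v x₀ m C) (hm : 1 ≤ m) (hα : 1 ≤ α) (hp : IsMarkovSemigroup p)
    (htail : ∀ t, SummableTails (1 / (α * m)) (p t)) (hco : ∀ t, NonCoinciding (p t)) :
    IsMarkovSemigroup fun t => thetaKernel v x₀ α (p t) := by
  have hinj : ∀ {μ ν : Measure (Theta v x₀ α)}, μ.map Subtype.val = ν.map Subtype.val → μ = ν :=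
    fun {μ ν} h => (MeasurableEmbedding.subtype_coe (measurableSet_Theta v x₀ α)).map_injective h
  refine ⟨fun t => hv.isMarkovKernel_thetaKernel hm hα (htail t) (hco t), ?_, fun s t => ?_⟩
  · ext1 γ
    apply hinj
    have hx := isNumeration_enum x₀ γ.1
    rw [hv.thetaKernel_map hm hα (htail 0) (hco 0) γ,
      hv.cfgKernel_eq_map hm hα γ.2 (htail 0) (hco 0) hx γ.1, Kernel.id_apply,
      Measure.map_dirac' measurable_subtype_coe, seqKernel_apply, hp.zero]
    simp only [Kernel.id_apply]
    rw [Measure.infinitePi_dirac, Measure.map_dirac' (measurable_toConfig γ.1), hx.toConfig_eq]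
  · ext1 γ
    apply hinj
    ext A hA
    rw [hv.thetaKernel_map hm hα (htail _) (hco _) γ,
      hv.cfgKernel_comp hm hα γ.2 (htail s) (hco s) (htail t) (hco t) (hco _) (hp.add s t) hA,
      Measure.map_apply measurable_subtype_coe hA,
      Kernel.comp_apply' _ _ _ (measurable_subtype_coe hA), ← hv.thetaKernel_map hm hα (htail s)
      (hco s) γ, lintegral_map ((cfgKernel x₀ (p t)).measurable_coe hA) measurable_subtype_coe]
    refine lintegral_congr fun ξ => ?_
    rw [← hv.thetaKernel_map hm hα (htail t) (hco t) ξ, Measure.map_apply measurable_subtype_coe hA]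

end ConfigKernel
end
end InfiniteParticles

namespace InfiniteParticles

noncomputable section

/-! ### Moments of the Poisson law -/

section PoissonMoments

/-- The identity `E[N g(N)] = r E[g(N + 1)]`, an index shift in the series; it generates all the
moments used later. -/
theorem hasSum_poissonMeasure_mul_nat (r : ℝ≥0) (g : ℕ → ℝ) {c : ℝ}
    (h : HasSum (fun n : ℕ => Real.exp (-r) * r ^ n / n.factorial * g (n + 1)) c) :
    HasSum (fun n : ℕ => Real.exp (-r) * r ^ n / n.factorial * (n * g n)) (r * c) := by
  rw [← hasSum_nat_add_iff' 1]
  simp only [Finset.range_one, Finset.sum_singleton, Nat.cast_zero, zero_mul, mul_zero, sub_zero]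
  refine (h.mul_left (r : ℝ)).congr_fun fun n => ?_
  have : ((n + 1).factorial : ℝ) = (n + 1) * n.factorial := by
    rw [Nat.factorial_succ]; push_cast; ring
  have h1 : (n.factorial : ℝ) ≠ 0 := by positivity
  have h2 : (n + 1 : ℝ) ≠ 0 := by positivity
  rw [this]
  push_cast
  field_simp
  ring

theorem hasSum_poissonMeasure_id (r : ℝ≥0) :
    HasSum (fun n : ℕ => Real.exp (-r) * r ^ n / n.factorial * (n : ℝ)) r := by
  have := hasSum_poissonMeasure_mul_nat r (fun _ => 1) (c := 1)
    (by simpa using hasSum_one_poissonMeasure r)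
  simpa using this

theorem hasSum_poissonMeasure_sq (r : ℝ≥0) :
    HasSum (fun n : ℕ => Real.exp (-r) * r ^ n / n.factorial * (n : ℝ) ^ 2) (r * (r + 1)) := by
  have := hasSum_poissonMeasure_mul_nat r (fun n => (n : ℝ)) (c := r + 1) (by
    have := (hasSum_poissonMeasure_id r).add (hasSum_one_poissonMeasure r)
    refine this.congr_fun fun n => ?_
    push_cast
    ring)
  simpa [sq] using this

theorem integrable_sq_poissonMeasure (r : ℝ≥0) :
    Integrable (fun n : ℕ => (n : ℝ) ^ 2) (poissonMeasure r) := by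
  rw [integrable_poissonMeasure_iff]
  refine (hasSum_poissonMeasure_sq r).summable.congr fun n => ?_
  rw [Real.norm_of_nonneg (by positivity)]

theorem integrable_id_poissonMeasure (r : ℝ≥0) :
    Integrable (fun n : ℕ => (n : ℝ)) (poissonMeasure r) := by
  rw [integrable_poissonMeasure_iff]
  refine (hasSum_poissonMeasure_id r).summable.congr fun n => ?_
  rw [Real.norm_of_nonneg (by positivity)]

theorem integral_id_poissonMeasure (r : ℝ≥0) : ∫ n : ℕ, (n : ℝ) ∂(poissonMeasure r) = r := by
  rw [integral_poissonMeasure]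
  simpa using (hasSum_poissonMeasure_id r).tsum_eq

theorem integral_sq_poissonMeasure (r : ℝ≥0) :
    ∫ n : ℕ, (n : ℝ) ^ 2 ∂(poissonMeasure r) = r * (r + 1) := by
  rw [integral_poissonMeasure]
  simpa using (hasSum_poissonMeasure_sq r).tsum_eq

theorem integral_sub_poissonMeasure (r : ℝ≥0) :
    ∫ n : ℕ, ((n : ℝ) - r) ∂(poissonMeasure r) = 0 := by
  rw [integral_sub (integrable_id_poissonMeasure r) (integrable_const _),
    integral_id_poissonMeasure]
  simp

theorem integrable_sub_sq_poissonMeasure (r : ℝ≥0) :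
    Integrable (fun n : ℕ => ((n : ℝ) - r) ^ 2) (poissonMeasure r) := by
  have : (fun n : ℕ => ((n : ℝ) - r) ^ 2) = fun n : ℕ => ((n : ℝ) ^ 2 - 2 * r * n) + r ^ 2 := by
    ext n; ring
  rw [this]
  exact ((integrable_sq_poissonMeasure r).sub ((integrable_id_poissonMeasure r).const_mul _)).add
    (integrable_const _)

theorem integral_sub_sq_poissonMeasure (r : ℝ≥0) :
    ∫ n : ℕ, ((n : ℝ) - r) ^ 2 ∂(poissonMeasure r) = r := by
  have : (fun n : ℕ => ((n : ℝ) - r) ^ 2) = fun n : ℕ => ((n : ℝ) ^ 2 - 2 * r * n) + r ^ 2 := by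
    ext n; ring
  have h1 : Integrable (fun n : ℕ => (n : ℝ) ^ 2 - 2 * r * n) (poissonMeasure r) :=
    (integrable_sq_poissonMeasure r).sub ((integrable_id_poissonMeasure r).const_mul _)
  rw [this, integral_add h1 (integrable_const _),
    integral_sub (integrable_sq_poissonMeasure r) ((integrable_id_poissonMeasure r).const_mul _),
    integral_const_mul, integral_sq_poissonMeasure, integral_id_poissonMeasure]
  simp
  ring

end PoissonMoments

/-! ### Compensated numbers of points -/

section Counts

variable {X : Type*} [MetricSpace X] [ProperSpace X] [MeasurableSpace X] [BorelSpace X]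
  {μ : Measure X} {Q : Measure (Config X)}

theorem measurable_ncard_inter {A : Set X} (hA : MeasurableSet A) :
    Measurable fun γ : Config X => (γ.1 ∩ A).ncard :=
  (Measurable.of_discrete (f := ENat.toNat)).comp (measurable_encard_inter hA)

/-- The count of the empty set has a Poisson law, and a push-forward by a measurable map preserves
the total mass. -/
theorem IsPoissonMeasure.isProbabilityMeasure (hQ : IsPoissonMeasure μ Q) :
    IsProbabilityMeasure Q := by
  have h := hQ.count_law ∅ MeasurableSet.empty (by simp)
  have h1 : IsProbabilityMeasure (Q.map fun γ => (γ.1 ∩ ∅).encard) := by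
    rw [h]; infer_instance
  exact (Measure.isProbabilityMeasure_map_iff
    (measurable_encard_inter MeasurableSet.empty).aemeasurable).1 h1

theorem IsPoissonMeasure.ae_finite_inter (hQ : IsPoissonMeasure μ Q) {A : Set X}
    (hA : MeasurableSet A) (hμ : μ A ≠ ⊤) : ∀ᵐ γ ∂Q, (γ.1 ∩ A).Finite := by
  have h : ∀ᵐ k ∂(Q.map fun γ => (γ.1 ∩ A).encard), k ≠ ⊤ := by
    rw [hQ.count_law A hA hμ, ae_map_iff Measurable.of_discrete.aemeasurable (by simp)]
    simp
  rw [ae_map_iff (measurable_encard_inter hA).aemeasurable (by simp)] at h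
  filter_upwards [h] with γ hγ
  exact Set.encard_ne_top_iff.1 hγ

theorem IsPoissonMeasure.map_ncard (hQ : IsPoissonMeasure μ Q) {A : Set X}
    (hA : MeasurableSet A) (hμ : μ A ≠ ⊤) :
    Q.map (fun γ => (γ.1 ∩ A).ncard) = poissonMeasure (μ A).toNNReal := by
  have : (fun γ : Config X => (γ.1 ∩ A).ncard) = ENat.toNat ∘ fun γ => (γ.1 ∩ A).encard := rfl
  rw [this, ← Measure.map_map Measurable.of_discrete (measurable_encard_inter hA),
    hQ.count_law A hA hμ, Measure.map_map Measurable.of_discrete Measurable.of_discrete]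
  exact Measure.map_id

/-- The compensated number of points in `A`. -/
def compCount (μ : Measure X) (A : Set X) (γ : Config X) : ℝ := ((γ.1 ∩ A).ncard : ℝ) - μ.real A

theorem measurable_compCount {A : Set X} (hA : MeasurableSet A) : Measurable (compCount μ A) :=
  (Measurable.of_discrete.comp (measurable_ncard_inter hA)).sub_const _

omit [ProperSpace X] [BorelSpace X] in
theorem compCount_empty : compCount μ (∅ : Set X) = 0 := by
  ext γ; simp [compCount]

theorem IsPoissonMeasure.integral_comp_ncard (hQ : IsPoissonMeasure μ Q) {A : Set X}
    (hA : MeasurableSet A) (hμ : μ A ≠ ⊤) (g : ℕ → ℝ) :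
    ∫ γ, g (γ.1 ∩ A).ncard ∂Q = ∫ n, g n ∂(poissonMeasure (μ A).toNNReal) := by
  rw [← hQ.map_ncard hA hμ, integral_map (measurable_ncard_inter hA).aemeasurable
    Measurable.of_discrete.aestronglyMeasurable]

theorem IsPoissonMeasure.integrable_comp_ncard (hQ : IsPoissonMeasure μ Q) {A : Set X}
    (hA : MeasurableSet A) (hμ : μ A ≠ ⊤) {g : ℕ → ℝ}
    (hg : Integrable g (poissonMeasure (μ A).toNNReal)) :
    Integrable (fun γ : Config X => g (γ.1 ∩ A).ncard) Q := by
  rw [← hQ.map_ncard hA hμ] at hg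
  exact hg.comp_measurable (measurable_ncard_inter hA)

theorem IsPoissonMeasure.integral_compCount (hQ : IsPoissonMeasure μ Q) {A : Set X}
    (hA : MeasurableSet A) (hμ : μ A ≠ ⊤) : ∫ γ, compCount μ A γ ∂Q = 0 :=
  (hQ.integral_comp_ncard hA hμ fun n => (n : ℝ) - μ.real A).trans
    (integral_sub_poissonMeasure _)

theorem IsPoissonMeasure.integral_compCount_sq (hQ : IsPoissonMeasure μ Q) {A : Set X}
    (hA : MeasurableSet A) (hμ : μ A ≠ ⊤) : ∫ γ, compCount μ A γ ^ 2 ∂Q = μ.real A :=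
  (hQ.integral_comp_ncard hA hμ fun n => ((n : ℝ) - μ.real A) ^ 2).trans
    (integral_sub_sq_poissonMeasure _)

theorem IsPoissonMeasure.integrable_compCount_sq (hQ : IsPoissonMeasure μ Q) {A : Set X}
    (hA : MeasurableSet A) (hμ : μ A ≠ ⊤) : Integrable (fun γ => compCount μ A γ ^ 2) Q :=
  hQ.integrable_comp_ncard hA hμ (integrable_sub_sq_poissonMeasure _)

theorem IsPoissonMeasure.integrable_compCount (hQ : IsPoissonMeasure μ Q) {A : Set X}
    (hA : MeasurableSet A) (hμ : μ A ≠ ⊤) : Integrable (compCount μ A) Q :=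
  have := hQ.isProbabilityMeasure
  ((memLp_two_iff_integrable_sq (measurable_compCount hA).aestronglyMeasurable).2
    (hQ.integrable_compCount_sq hA hμ)).integrable one_le_two

omit [ProperSpace X] [BorelSpace X] in
theorem IsPoissonMeasure.iIndepFun_ncard (hQ : IsPoissonMeasure μ Q) {ι : Type*} [Fintype ι]
    {C : ι → Set X} (hC : ∀ i, MeasurableSet (C i)) (hμ : ∀ i, μ (C i) ≠ ⊤)
    (hd : Pairwise (Function.onFun Disjoint C)) :
    iIndepFun (fun i (γ : Config X) => (γ.1 ∩ C i).ncard) Q := by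
  let e := Fintype.equivFin ι
  have h := hQ.indep (Fintype.card ι) (fun k => C (e.symm k)) (fun k => hC _) (fun k => hμ _)
    (fun a b hab => hd (e.symm.injective.ne hab))
  have h1 := (h.precomp (g := e) e.injective).comp (fun _ => ENat.toNat)
    (fun _ => Measurable.of_discrete)
  refine iIndepFun.congr (fun i => ?_) h1
  refine Eventually.of_forall fun γ => ?_
  simp [Set.ncard_def]

variable {ι : Type*} [Fintype ι] {C : ι → Set X}

theorem IsPoissonMeasure.integral_prod_comp_ncard (hQ : IsPoissonMeasure μ Q)
    (hC : ∀ i, MeasurableSet (C i)) (hμ : ∀ i, μ (C i) ≠ ⊤)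
    (hd : Pairwise (Function.onFun Disjoint C)) (g : ι → ℕ → ℝ) :
    ∫ γ, ∏ i, g i (γ.1 ∩ C i).ncard ∂Q = ∏ i, ∫ γ, g i (γ.1 ∩ C i).ncard ∂Q :=
  (hQ.iIndepFun_ncard hC hμ hd).integral_fun_prod_comp
    (fun i => (measurable_ncard_inter (hC i)).aemeasurable)
    (fun _ => Measurable.of_discrete.aestronglyMeasurable)

theorem IsPoissonMeasure.integrable_prod_comp_ncard (hQ : IsPoissonMeasure μ Q)
    (hC : ∀ i, MeasurableSet (C i)) (hμ : ∀ i, μ (C i) ≠ ⊤)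
    (hd : Pairwise (Function.onFun Disjoint C)) (g : ι → ℕ → ℝ)
    (hg : ∀ i, Integrable (fun γ : Config X => g i (γ.1 ∩ C i).ncard) Q) :
    Integrable (fun γ : Config X => ∏ i, g i (γ.1 ∩ C i).ncard) Q := by
  have hm : ∀ i, Measurable fun γ : Config X => g i (γ.1 ∩ C i).ncard := fun i =>
    Measurable.of_discrete.comp (measurable_ncard_inter (hC i))
  refine ⟨(Finset.measurable_fun_prod _ fun i _ => hm i).aestronglyMeasurable, ?_⟩
  rw [hasFiniteIntegral_iff_enorm]
  have h := lintegral_prod_eq_prod_lintegral_of_indepFun Finset.univ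
    (fun i (γ : Config X) => ‖g i (γ.1 ∩ C i).ncard‖ₑ)
    ((hQ.iIndepFun_ncard hC hμ hd).comp (fun i n => ‖g i n‖ₑ) fun _ => Measurable.of_discrete)
    (fun i => (hm i).enorm)
  have h1 : ∀ γ : Config X, ‖∏ i, g i (γ.1 ∩ C i).ncard‖ₑ = ∏ i, ‖g i (γ.1 ∩ C i).ncard‖ₑ := by
    intro γ
    simp_rw [← ofReal_norm, norm_prod]
    exact ENNReal.ofReal_prod_of_nonneg fun _ _ => norm_nonneg _
  simp_rw [h1]
  rw [h]
  exact ENNReal.prod_lt_top fun i _ => (hg i).2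

variable [DecidableEq ι]

/-- Products of compensated counts of disjoint sets are orthogonal. -/
theorem IsPoissonMeasure.integral_prod_compCount_mul (hQ : IsPoissonMeasure μ Q)
    (hC : ∀ i, MeasurableSet (C i)) (hμ : ∀ i, μ (C i) ≠ ⊤)
    (hd : Pairwise (Function.onFun Disjoint C)) (S S' : Finset ι) :
    Integrable (fun γ => (∏ i ∈ S, compCount μ (C i) γ) * ∏ i ∈ S', compCount μ (C i) γ) Q ∧
    ∫ γ, (∏ i ∈ S, compCount μ (C i) γ) * ∏ i ∈ S', compCount μ (C i) γ ∂Q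
      = if S = S' then ∏ i ∈ S, μ.real (C i) else 0 := by
  have := hQ.isProbabilityMeasure
  -- Gathering the factors by set makes independence applicable: a set contributes its variance,
  -- zero or one according to whether it occurs in both products, in exactly one, or in neither.
  set g : ι → ℕ → ℝ := fun i n => (if i ∈ S then (n : ℝ) - μ.real (C i) else 1) *
    (if i ∈ S' then (n : ℝ) - μ.real (C i) else 1) with hg
  have h1 : ∀ γ : Config X, (∏ i ∈ S, compCount μ (C i) γ) * ∏ i ∈ S', compCount μ (C i) γ
      = ∏ i, g i (γ.1 ∩ C i).ncard := by
    intro γ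
    simp only [hg, Finset.prod_mul_distrib, Finset.prod_ite_mem, Finset.univ_inter]
    rfl
  have h2 : ∀ i, Integrable (fun γ : Config X => g i (γ.1 ∩ C i).ncard) Q := by
    intro i
    have e1 : Integrable (fun γ => compCount μ (C i) γ) Q := hQ.integrable_compCount (hC i) (hμ i)
    have e2 := hQ.integrable_compCount_sq (hC i) (hμ i)
    by_cases hi : i ∈ S <;> by_cases hi' : i ∈ S' <;> simp only [hg, hi, hi', if_true, if_false]
    · simpa [compCount, sq] using e2
    · simpa [compCount] using e1
    · simpa [compCount] using e1
    · simp
  simp_rw [h1]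
  refine ⟨hQ.integrable_prod_comp_ncard hC hμ hd g h2, ?_⟩
  rw [hQ.integral_prod_comp_ncard hC hμ hd]
  have h3 : ∀ i, ∫ γ : Config X, g i (γ.1 ∩ C i).ncard ∂Q
      = if i ∈ S then (if i ∈ S' then μ.real (C i) else 0) else (if i ∈ S' then 0 else 1) := by
    intro i
    have e1 := hQ.integral_compCount (hC i) (hμ i)
    have e2 := hQ.integral_compCount_sq (hC i) (hμ i)
    by_cases hi : i ∈ S <;> by_cases hi' : i ∈ S' <;> simp only [hg, hi, hi', if_true, if_false]
    · simpa [compCount, sq] using e2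
    · simpa [compCount] using e1
    · simpa [compCount] using e1
    · simp
  simp_rw [h3]
  split_ifs with h
  · subst h
    rw [← Finset.prod_subset (Finset.subset_univ S) (f := fun i =>
      if i ∈ S then (if i ∈ S then μ.real (C i) else 0) else (if i ∈ S then 0 else 1))]
    · exact Finset.prod_congr rfl fun i hi => by simp [hi]
    · intro i _ hi; simp [hi]
  · obtain ⟨i, hi⟩ : ∃ i, ¬ (i ∈ S ↔ i ∈ S') := by
      by_contra! h'
      exact h (Finset.ext h')
    refine Finset.prod_eq_zero (Finset.mem_univ i) ?_
    by_cases h1 : i ∈ S <;> by_cases h2 : i ∈ S' <;> simp_all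

end Counts

end
end InfiniteParticles

namespace InfiniteParticles

noncomputable section

/-! ### Indicators of boxes -/

section Boxes

variable {X : Type*} [MeasurableSpace X] {μ : Measure X} {n : ℕ}

/-- The indicator function of `A_1 × ⋯ × A_n`. -/
def boxFun {n : ℕ} (A : Fin n → Set X) (x : Fin n → X) : ℝ :=
  ∏ i, (A i).indicator (fun _ => (1 : ℝ)) (x i)

theorem measurable_boxFun {A : Fin n → Set X} (hA : ∀ i, MeasurableSet (A i)) :
    Measurable (boxFun A) :=
  Finset.measurable_fun_prod _ fun i _ =>
    (measurable_const.indicator (hA i)).comp (measurable_pi_apply i)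

theorem integral_boxFun [SigmaFinite μ] {A : Fin n → Set X} (hA : ∀ i, MeasurableSet (A i)) :
    ∫ x, boxFun A x ∂(Measure.pi fun _ : Fin n => μ) = ∏ i, μ.real (A i) := by
  unfold boxFun
  rw [integral_fintype_prod_eq_prod (fun i => (A i).indicator fun _ => (1 : ℝ))]
  exact Finset.prod_congr rfl fun i _ => by
    rw [integral_indicator_const _ (hA i)]; simp

theorem integrable_boxFun [SigmaFinite μ] {A : Fin n → Set X} (hA : ∀ i, MeasurableSet (A i))
    (hμ : ∀ i, μ (A i) ≠ ⊤) : Integrable (boxFun A) (Measure.pi fun _ : Fin n => μ) :=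
  Integrable.fintype_prod fun i =>
    (integrable_indicator_iff (hA i)).2 (integrableOn_const (hμ i))

omit [MeasurableSpace X] in
theorem boxFun_eq_zero_or_one (A : Fin n → Set X) (x : Fin n → X) :
    boxFun A x = 0 ∨ boxFun A x = 1 := by
  by_cases h : ∀ i, x i ∈ A i
  · right; exact Finset.prod_eq_one fun i _ => by simp [h i]
  · push Not at h
    obtain ⟨i, hi⟩ := h
    left; exact Finset.prod_eq_zero (Finset.mem_univ i) (by simp [hi])

omit [MeasurableSpace X] in
theorem boxFun_mul_self (A : Fin n → Set X) (x : Fin n → X) :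
    boxFun A x * boxFun A x = boxFun A x := by
  rcases boxFun_eq_zero_or_one A x with h | h <;> simp [h]

theorem memLp_boxFun [SigmaFinite μ] {A : Fin n → Set X} (hA : ∀ i, MeasurableSet (A i))
    (hμ : ∀ i, μ (A i) ≠ ⊤) : MemLp (boxFun A) 2 (Measure.pi fun _ : Fin n => μ) := by
  rw [memLp_two_iff_integrable_sq (measurable_boxFun hA).aestronglyMeasurable]
  simp_rw [sq, boxFun_mul_self]
  exact integrable_boxFun hA hμ

omit [MeasurableSpace X] in
theorem boxFun_mul_of_ne {ι : Type*} {C : ι → Set X} (hd : Pairwise (Function.onFun Disjoint C))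
    {k l : Fin n → ι} (h : k ≠ l) (x : Fin n → X) :
    boxFun (fun i => C (k i)) x * boxFun (fun i => C (l i)) x = 0 := by
  obtain ⟨i, hi⟩ := Function.ne_iff.1 h
  by_cases hx : x i ∈ C (k i)
  · have : x i ∉ C (l i) := fun h' => disjoint_left.1 (hd hi) hx h'
    rw [mul_eq_zero]; right
    exact Finset.prod_eq_zero (Finset.mem_univ i) (by simp [this])
  · rw [mul_eq_zero]; left
    exact Finset.prod_eq_zero (Finset.mem_univ i) (by simp [hx])

variable {ι : Type*} [Fintype ι] {C : ι → Set X}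

theorem integral_sum_boxFun_sq [SigmaFinite μ] (hC : ∀ i, MeasurableSet (C i))
    (hμ : ∀ i, μ (C i) ≠ ⊤) (hd : Pairwise (Function.onFun Disjoint C)) (a : (Fin n → ι) → ℝ) :
    ∫ x, (∑ k, a k * boxFun (fun i => C (k i)) x) ^ 2 ∂(Measure.pi fun _ : Fin n => μ)
      = ∑ k, a k ^ 2 * ∏ i, μ.real (C (k i)) := by
  classical
  have h1 : ∀ x, (∑ k, a k * boxFun (fun i => C (k i)) x) ^ 2
      = ∑ k, a k ^ 2 * boxFun (fun i => C (k i)) x := by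
    intro x
    rw [sq, Finset.sum_mul_sum]
    refine Finset.sum_congr rfl fun k _ => ?_
    rw [Finset.sum_eq_single k]
    · linear_combination a k ^ 2 * boxFun_mul_self (fun i => C (k i)) x
    · intro l _ hl
      linear_combination a k * a l * boxFun_mul_of_ne hd hl.symm x
    · simp
  simp_rw [h1]
  rw [integral_finsetSum _ fun k _ =>
    (integrable_boxFun (fun i => hC _) fun i => hμ _).const_mul _]
  refine Finset.sum_congr rfl fun k _ => ?_
  rw [integral_const_mul, integral_boxFun fun i => hC _]

end Boxes

/-! ### Second moment bound over one disjoint family -/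

section GramBound

theorem exists_perm_of_image_eq {ι : Type*} [DecidableEq ι] {n : ℕ} {k l : Fin n → ι}
    (hk : Function.Injective k) (h : Finset.univ.image k = Finset.univ.image l) :
    ∃ σ : Equiv.Perm (Fin n), l = k ∘ σ := by
  have hl : Function.Injective l := by
    have h1 : (Finset.univ.image l).card = (Finset.univ : Finset (Fin n)).card := by
      rw [← h, Finset.card_image_of_injective _ hk]
    exact injOn_univ.1 (by simpa using Finset.card_image_iff.1 h1)
  have h1 : ∀ i, ∃ j, k j = l i := fun i => by
    have : l i ∈ Finset.univ.image k := h ▸ Finset.mem_image_of_mem l (Finset.mem_univ i)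
    simpa using this
  choose f hf using h1
  have hfi : Function.Injective f := fun i j hij => hl (by rw [← hf i, ← hf j, hij])
  exact ⟨Equiv.ofBijective f (Finite.injective_iff_bijective.1 hfi), funext fun i => (hf i).symm⟩

/-- The tuples with the same image as an injective `k` are its `n!` rearrangements. -/
theorem sum_image_eq_eq_sum_perm {ι : Type*} [Fintype ι] [DecidableEq ι] {n : ℕ} {k : Fin n → ι}
    (hk : Function.Injective k) (g : (Fin n → ι) → ℝ) :
    ∑ l, (if Finset.univ.image k = Finset.univ.image l then g l else 0)
      = ∑ σ : Equiv.Perm (Fin n), g (k ∘ σ) := by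
  rw [← Finset.sum_filter]
  symm
  refine Finset.sum_bij (fun σ _ => k ∘ σ) (fun σ _ => ?_) (fun σ _ τ _ h => ?_)
    (fun l hl => ?_) (fun _ _ => rfl)
  · simp only [Finset.mem_filter, Finset.mem_univ, true_and]
    rw [← Finset.image_image, Finset.image_univ_equiv]
  · ext i
    exact congrArg Fin.val (hk (congrFun h i))
  · obtain ⟨σ, rfl⟩ := exists_perm_of_image_eq hk (Finset.mem_filter.1 hl).2
    exact ⟨σ, Finset.mem_univ _, rfl⟩

variable {X : Type*} [MetricSpace X] [ProperSpace X] [MeasurableSpace X] [BorelSpace X]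
  {μ : Measure X} {Q : Measure (Config X)} {n : ℕ}

theorem IsPoissonMeasure.memLp_prod_compCount (hQ : IsPoissonMeasure μ Q)
    {ι : Type*} [Fintype ι] {C : ι → Set X}
    (hC : ∀ i, MeasurableSet (C i)) (hμ : ∀ i, μ (C i) ≠ ⊤)
    (hd : Pairwise (Function.onFun Disjoint C)) (S : Finset ι) :
    MemLp (fun γ => ∏ i ∈ S, compCount μ (C i) γ) 2 Q := by
  classical
  rw [memLp_two_iff_integrable_sq
    (Finset.measurable_fun_prod _ fun i _ => measurable_compCount (hC i)).aestronglyMeasurable]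
  simp_rw [sq]
  exact (hQ.integral_prod_compCount_mul hC hμ hd S S).1

/-- For injective `k` the product depends only on the image of `k`, so orthogonality leaves `∑ σ, ∑
k, a k * a (k ∘ σ) * w k` with permutation-invariant weights `w`. Each inner sum is at most `∑ a²
w`, and there are `n!` of them. -/
theorem IsPoissonMeasure.integral_sum_prod_compCount_sq_le (hQ : IsPoissonMeasure μ Q)
    {ι : Type*} [Fintype ι] {C : ι → Set X}
    (hC : ∀ i, MeasurableSet (C i)) (hμ : ∀ i, μ (C i) ≠ ⊤)
    (hd : Pairwise (Function.onFun Disjoint C)) (a : (Fin n → ι) → ℝ)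
    (ha : ∀ k, ¬ Function.Injective k → a k = 0) :
    ∫ γ, (∑ k, a k * ∏ i, compCount μ (C (k i)) γ) ^ 2 ∂Q
      ≤ n.factorial * ∑ k, a k ^ 2 * ∏ i, μ.real (C (k i)) := by
  classical
  set w : (Fin n → ι) → ℝ := fun k => ∏ i, μ.real (C (k i)) with hw
  set R : Finset ι → Config X → ℝ := fun S γ => ∏ i ∈ S, compCount μ (C i) γ with hR
  have h1 : ∀ γ, (∑ k, a k * ∏ i, compCount μ (C (k i)) γ) ^ 2
      = ∑ k, ∑ l, a k * a l * (R (Finset.univ.image k) γ * R (Finset.univ.image l) γ) := by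
    intro γ
    have h0 : ∀ k, a k * ∏ i, compCount μ (C (k i)) γ = a k * R (Finset.univ.image k) γ := by
      intro k
      by_cases hk : Function.Injective k
      · simp only [hR]
        rw [Finset.prod_image fun _ _ _ _ h => hk h]
      · simp [ha k hk]
    simp_rw [h0]
    rw [sq, Finset.sum_mul_sum]
    exact Finset.sum_congr rfl fun k _ => Finset.sum_congr rfl fun l _ => by ring
  have hI := fun S S' => hQ.integral_prod_compCount_mul hC hμ hd S S'
  have h2 : ∫ γ, (∑ k, a k * ∏ i, compCount μ (C (k i)) γ) ^ 2 ∂Q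
      = ∑ k, ∑ σ : Equiv.Perm (Fin n), a k * a (k ∘ σ) * w k := by
    simp_rw [h1]
    rw [integral_finsetSum _ fun k _ => integrable_finsetSum _ fun l _ => (hI _ _).1.const_mul _]
    refine Finset.sum_congr rfl fun k _ => ?_
    rw [integral_finsetSum _ fun l _ => (hI _ _).1.const_mul _]
    by_cases hk : Function.Injective k
    · rw [← sum_image_eq_eq_sum_perm hk fun l => a k * a l * w k]
      refine Finset.sum_congr rfl fun l _ => ?_
      rw [integral_const_mul]
      refine (congrArg (a k * a l * ·) (hI _ _).2).trans ?_
      split_ifs with h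
      · rw [Finset.prod_image fun _ _ _ _ h => hk h]
      · simp
    · simp [ha k hk]
  have h3 : ∀ σ : Equiv.Perm (Fin n), ∑ k, a (k ∘ σ) ^ 2 * w k = ∑ k, a k ^ 2 * w k := by
    intro σ
    refine Fintype.sum_equiv (Equiv.arrowCongr σ.symm (Equiv.refl ι)) _ _ fun k => ?_
    have : w (k ∘ σ) = w k := Equiv.prod_comp σ fun i => μ.real (C (k i))
    change a (k ∘ σ) ^ 2 * w k = a (k ∘ σ) ^ 2 * w (k ∘ σ)
    rw [this]
  have hw0 : ∀ k, 0 ≤ w k := fun k => Finset.prod_nonneg fun i _ => measureReal_nonneg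
  rw [h2, Finset.sum_comm]
  calc ∑ σ : Equiv.Perm (Fin n), ∑ k, a k * a (k ∘ σ) * w k
      ≤ ∑ σ : Equiv.Perm (Fin n), ∑ k, ((1 / 2) * (a k ^ 2 * w k)
          + (1 / 2) * (a (k ∘ σ) ^ 2 * w k)) := by
        gcongr with σ _ k _
        nlinarith [mul_nonneg (sq_nonneg (a k - a (k ∘ σ))) (hw0 k)]
    _ = ∑ σ : Equiv.Perm (Fin n), ∑ k, a k ^ 2 * w k := by
        refine Finset.sum_congr rfl fun σ _ => ?_
        rw [Finset.sum_add_distrib, ← Finset.mul_sum, ← Finset.mul_sum, h3]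
        ring
    _ = n.factorial * ∑ k, a k ^ 2 * w k := by
        rw [Finset.sum_const, nsmul_eq_mul, Finset.card_univ, Fintype.card_perm, Fintype.card_fin]

end GramBound

/-! ### Common refinement of finitely many sets -/

section Refinement

/-- The atoms of the algebra of sets generated by a finite family. -/
def atomSet {X κ : Type*} (B : κ → Set X) (T : Finset κ) : Set X :=
  {x | T.Nonempty ∧ ∀ k, x ∈ B k ↔ k ∈ T}

variable {X κ : Type*} {B : κ → Set X}

theorem atomSet_subset {T : Finset κ} {k : κ} (h : k ∈ T) : atomSet B T ⊆ B k :=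
  fun _ hx => (hx.2 k).2 h

theorem pairwise_disjoint_atomSet : Pairwise (Function.onFun Disjoint (atomSet B)) := by
  intro T T' h
  refine disjoint_left.2 fun x hx hx' => h ?_
  ext k
  rw [← hx.2, ← hx'.2]

theorem measurableSet_atomSet [MeasurableSpace X] [Finite κ] (hB : ∀ k, MeasurableSet (B k))
    (T : Finset κ) : MeasurableSet (atomSet B T) := by
  have : atomSet B T = {_x | T.Nonempty} ∩ ⋂ k, {x | x ∈ B k ↔ k ∈ T} := by
    ext x; simp [atomSet]
  rw [this]
  refine (MeasurableSet.const _).inter (MeasurableSet.iInter fun k => ?_)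
  by_cases h : k ∈ T
  · simpa [h] using hB k
  · have h1 := (hB k).compl
    simp only [h, iff_false]
    exact h1

theorem measure_atomSet_ne_top [MeasurableSpace X] {μ : Measure X} (hB : ∀ k, μ (B k) ≠ ⊤)
    (T : Finset κ) : μ (atomSet B T) ≠ ⊤ := by
  rcases T.eq_empty_or_nonempty with rfl | ⟨k, hk⟩
  -- The set of points outside every `B k` might have infinite measure; the nonemptiness condition
  -- turns the corresponding atom into the empty set.
  · simp [atomSet]
  · exact ((measure_mono (atomSet_subset hk)).trans_lt (hB k).lt_top).ne

open Classical in
theorem iUnion_atomSet [Fintype κ] (k : κ) :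
    ⋃ T ∈ Finset.univ.filter (fun T : Finset κ => k ∈ T), atomSet B T = B k := by
  ext x
  simp only [Finset.mem_filter, Finset.mem_univ, true_and, mem_iUnion]
  constructor
  · rintro ⟨T, h, hx⟩
    exact atomSet_subset h hx
  · intro hx
    exact ⟨Finset.univ.filter fun j => x ∈ B j, by simpa using hx, ⟨k, by simpa using hx⟩,
      fun j => by simp⟩

/-- A choice of atoms `k` is compatible with `A` if the atoms are distinct, and the `i`-th of them
is contained in `A i`. -/
def Compatible {n : ℕ} (A : Fin n → κ) (k : Fin n → Finset κ) : Prop :=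
  Function.Injective k ∧ ∀ i, A i ∈ k i

-- Expand the product over atoms. A choice that repeats an atom contributes nothing, because that
-- atom would lie in two disjoint sets. Abstract `f` and `g` allow one expansion to serve both
-- indicators and compensated counts.
open Classical in
theorem prod_eq_sum_compatible [Fintype κ] {n : ℕ} {A : Fin n → κ}
    (hA : Pairwise (Function.onFun Disjoint fun i => B (A i))) (f : Fin n → ℝ)
    (g : Fin n → Finset κ → ℝ) (hf : ∀ i, f i = ∑ T with A i ∈ T, g i T)
    (hg : ∀ i T, atomSet B T = ∅ → g i T = 0) :
    ∏ i, f i = ∑ k, (if Compatible A k then 1 else 0) * ∏ i, g i (k i) := by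
  simp_rw [hf]
  rw [Finset.prod_univ_sum]
  have h0 : Fintype.piFinset (fun i => Finset.univ.filter fun T : Finset κ => A i ∈ T)
      = Finset.univ.filter fun k : Fin n → Finset κ => ∀ i, A i ∈ k i := by
    ext k; simp [Fintype.mem_piFinset]
  rw [h0, Finset.sum_filter]
  refine Finset.sum_congr rfl fun k _ => ?_
  by_cases h : ∀ i, A i ∈ k i
  · by_cases hk : Function.Injective k
    · rw [if_pos h, if_pos ⟨hk, h⟩, one_mul]
    · rw [if_pos h, if_neg fun h' => hk h'.1, zero_mul]
      simp only [Function.Injective, not_forall] at hk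
      obtain ⟨i, j, hij, hne⟩ := hk
      refine Finset.prod_eq_zero (Finset.mem_univ i) (hg i _ ?_)
      refine eq_empty_iff_forall_notMem.2 fun x hx => ?_
      exact disjoint_left.1 (hA hne) (atomSet_subset (h i) hx) (atomSet_subset (hij ▸ h j) hx)
  · rw [if_neg h, if_neg fun h' => h h'.2, zero_mul]

open Classical in
theorem indicator_eq_sum_atomSet [Fintype κ] (k : κ) (x : X) :
    (B k).indicator (fun _ => (1 : ℝ)) x
      = ∑ T : Finset κ with k ∈ T, (atomSet B T).indicator (fun _ => (1 : ℝ)) x := by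
  conv_lhs => rw [← iUnion_atomSet (B := B) k]
  rw [Finset.indicator_biUnion]
  exact fun T _ T' _ h => pairwise_disjoint_atomSet h

end Refinement

/-! ### Second moment bound for arbitrary boxes with disjoint sides -/

section Bound

variable {X : Type*} [MetricSpace X] [ProperSpace X] [MeasurableSpace X] [BorelSpace X]
  {μ : Measure X} {Q : Measure (Config X)} {n : ℕ}

-- Finiteness is essential here: `ncard` is zero on infinite sets and would not be additive.
omit [ProperSpace X] in
theorem compCount_biUnion {γ : Config X} {ι : Type*} (s : Finset ι) {C : ι → Set X}
    (hC : ∀ i ∈ s, MeasurableSet (C i)) (hd : Pairwise (Function.onFun Disjoint C))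
    (hμ : ∀ i, μ (C i) ≠ ⊤) (hγ : ∀ i ∈ s, (γ.1 ∩ C i).Finite) :
    compCount μ (⋃ i ∈ s, C i) γ = ∑ i ∈ s, compCount μ (C i) γ := by
  classical
  unfold compCount
  rw [Finset.sum_sub_distrib, measureReal_biUnion_finset (fun i _ j _ h => hd h) hC
    (fun i _ => hμ i), inter_iUnion₂]
  congr 1
  have h1 : (⋃ i ∈ s, γ.1 ∩ C i).ncard = ∑ i ∈ s, (γ.1 ∩ C i).ncard :=
    (s.finite_toSet.ncard_biUnion (s := fun i => γ.1 ∩ C i) hγ fun i _ j _ h =>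
      (hd h).mono inter_subset_right inter_subset_right).trans (finsum_mem_coe_finset _ _)
  exact (congrArg Nat.cast h1).trans (Nat.cast_sum _ _)

/-- Sides of different boxes may overlap. Cutting all of them into common atoms turns both
combinations into sums over one disjoint family with the same off-diagonal coefficients. -/
theorem IsPoissonMeasure.integral_sum_disjointSets_sq_le [SigmaFinite μ]
    (hQ : IsPoissonMeasure μ Q) (s : Finset (DisjointSets μ n)) (x : DisjointSets μ n → ℝ) :
    ∫ γ, (∑ A ∈ s, x A * ∏ i, compCount μ (A.set i) γ) ^ 2 ∂Q
      ≤ n.factorial * ∫ y, (∑ A ∈ s, x A * boxFun A.set y) ^ 2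
          ∂(Measure.pi fun _ : Fin n => μ) := by
  classical
  set B : s × Fin n → Set X := fun q => q.1.1.set q.2 with hB
  have hBm : ∀ q, MeasurableSet (B q) := fun q => q.1.1.measurable q.2
  have hBμ : ∀ q, μ (B q) ≠ ⊤ := fun q => q.1.1.finite q.2
  have hCm := measurableSet_atomSet hBm
  have hCμ := measure_atomSet_ne_top hBμ
  -- The coefficient of a box of atoms is the total weight of the compatible given boxes, those
  -- whose sides contain the chosen atoms.
  set a : (Fin n → Finset (s × Fin n)) → ℝ := fun k =>
    ∑ A : s, x A * if Compatible (fun i => (A, i)) k then 1 else 0 with ha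
  have ha0 : ∀ k, ¬ Function.Injective k → a k = 0 := fun k hk =>
    Finset.sum_eq_zero fun A _ => by rw [if_neg fun h => hk h.1, mul_zero]
  have h1 : ∀ y, ∑ A ∈ s, x A * boxFun A.set y
      = ∑ k, a k * boxFun (fun i => atomSet B (k i)) y := by
    intro y
    simp_rw [ha, Finset.sum_mul]
    rw [Finset.sum_comm, ← Finset.sum_coe_sort]
    refine Finset.sum_congr rfl fun A _ => ?_
    simp_rw [mul_assoc]
    rw [← Finset.mul_sum]
    congr 1
    exact prod_eq_sum_compatible (B := B) (A := fun i => (A, i)) A.1.disjoint _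
      (fun i T => (atomSet B T).indicator (fun _ => (1 : ℝ)) (y i))
      (fun i => indicator_eq_sum_atomSet (B := B) (A, i) (y i)) (fun i T h => by simp [h])
  have h2 : ∀ᵐ γ ∂Q, ∑ A ∈ s, x A * ∏ i, compCount μ (A.set i) γ
      = ∑ k, a k * ∏ i, compCount μ (atomSet B (k i)) γ := by
    have hfin : ∀ᵐ γ ∂Q, ∀ T, (γ.1 ∩ atomSet B T).Finite :=
      ae_all_iff.2 fun T => hQ.ae_finite_inter (hCm T) (hCμ T)
    filter_upwards [hfin] with γ hγ
    simp_rw [ha, Finset.sum_mul]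
    rw [Finset.sum_comm, ← Finset.sum_coe_sort]
    refine Finset.sum_congr rfl fun A _ => ?_
    simp_rw [mul_assoc]
    rw [← Finset.mul_sum]
    congr 1
    refine prod_eq_sum_compatible (B := B) (A := fun i => (A, i)) A.1.disjoint _
      (fun i T => compCount μ (atomSet B T) γ) (fun i => ?_)
      (fun i T h => by rw [h, compCount_empty]; rfl)
    rw [← compCount_biUnion _ (fun T _ => hCm T) pairwise_disjoint_atomSet hCμ fun T _ => hγ T]
    exact congrArg (compCount μ · γ) (iUnion_atomSet (B := B) (A, i)).symm
  simp_rw [h1]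
  rw [integral_congr_ae (h2.mono fun γ h => congrArg (· ^ 2) h)]
  rw [integral_sum_boxFun_sq hCm hCμ pairwise_disjoint_atomSet]
  exact hQ.integral_sum_prod_compCount_sq_le hCm hCμ pairwise_disjoint_atomSet a ha0

end Bound

/-! ### Representatives in `L²` -/

section ClassesInL2

variable {S : Type*} [MeasurableSpace S] {ν : Measure S}

theorem toL2_eq {f : S → ℝ} (h : MemLp f 2 ν) : toL2 ν f = h.toLp f := dif_pos h

theorem coeFn_toL2 {f : S → ℝ} (h : MemLp f 2 ν) : toL2 ν f =ᵐ[ν] f := by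
  rw [toL2_eq h]; exact h.coeFn_toLp

theorem norm_sq_eq_integral_of_ae_eq {F : Lp ℝ 2 ν} {f : S → ℝ} (h : F =ᵐ[ν] f) :
    ‖F‖ ^ 2 = ∫ x, f x ^ 2 ∂ν := by
  rw [← real_inner_self_eq_norm_sq, L2.inner_def]
  refine integral_congr_ae (h.mono fun x hx => ?_)
  simp [hx, sq]

theorem coeFn_linearCombination_toL2 {ι : Type*} {g : ι → S → ℝ} (hg : ∀ i, MemLp (g i) 2 ν)
    (x : ι →₀ ℝ) : Finsupp.linearCombination ℝ (fun i => toL2 ν (g i)) x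
      =ᵐ[ν] fun y => ∑ i ∈ x.support, x i * g i y := by
  rw [Finsupp.linearCombination_apply, Finsupp.sum]
  have h1 : ∀ᵐ y ∂ν, ∀ i : x.support, (x i • toL2 ν (g i) : Lp ℝ 2 ν) y = x i * g i y := by
    refine ae_all_iff.2 fun i => ?_
    filter_upwards [Lp.coeFn_smul (x i) (toL2 ν (g i)), coeFn_toL2 (hg i)] with y h1 h2
    rw [h1, Pi.smul_apply, h2, smul_eq_mul]
  filter_upwards [h1, Lp.coeFn_finsetSum x.support fun i => x i • toL2 ν (g i)] with y h1 h2
  rw [h2, Finset.sum_apply]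
  exact Finset.sum_congr rfl fun i hi => h1 ⟨i, hi⟩

end ClassesInL2

/-! ### Norm bound for multiple integrals -/

section MultipleIntegralBound

variable {X : Type*} [MetricSpace X] [ProperSpace X] [MeasurableSpace X] [BorelSpace X]
  {μ : Measure X} {Q : Measure (Config X)} {n : ℕ}

theorem IsPoissonMeasure.memLp_compensatedProduct (hQ : IsPoissonMeasure μ Q)
    (A : DisjointSets μ n) :
    MemLp (fun γ => ∏ i, (((γ.1 ∩ A.set i).ncard : ℝ) - μ.real (A.set i))) 2 Q :=
  hQ.memLp_prod_compCount A.measurable A.finite A.disjoint Finset.univ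

/-- The estimate under which the prescription on boxes is well defined and extends continuously. -/
theorem IsPoissonMeasure.norm_linearCombination_le [SigmaFinite μ] (hQ : IsPoissonMeasure μ Q)
    (x : DisjointSets μ n →₀ ℝ) :
    ‖Finsupp.linearCombination ℝ (fun A : DisjointSets μ n => compensatedProduct μ Q A) x‖
      ≤ Real.sqrt n.factorial *
        ‖Finsupp.linearCombination ℝ (fun A : DisjointSets μ n => boxIndicator μ A) x‖ := by
  refine abs_le_of_sq_le_sq' ?_ (by positivity) |>.2
  have h1 := norm_sq_eq_integral_of_ae_eq (coeFn_linearCombination_toL2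
    (fun A : DisjointSets μ n => hQ.memLp_compensatedProduct A) x)
  have h2 := norm_sq_eq_integral_of_ae_eq (coeFn_linearCombination_toL2
    (fun A : DisjointSets μ n => memLp_boxFun A.measurable A.finite) x)
  rw [mul_pow, Real.sq_sqrt (by positivity)]
  refine (h1.le.trans ?_).trans_eq (congrArg (_ * ·) h2.symm)
  exact hQ.integral_sum_disjointSets_sq_le x.support x

end MultipleIntegralBound

end
end InfiniteParticles

namespace InfiniteParticles

noncomputable section

/-! ### Density of boxes with disjoint sides -/

section Density

theorem denseRange_linearCombination {E ι : Type*} [NormedAddCommGroup E] [InnerProductSpace ℝ E]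
    [CompleteSpace E] (v : ι → E) (h : ∀ G : E, (∀ i, inner ℝ (v i) G = 0) → G = 0) :
    DenseRange (Finsupp.linearCombination ℝ v) := by
  have h1 : (LinearMap.range (Finsupp.linearCombination ℝ v)).topologicalClosure = ⊤ := by
    rw [Submodule.topologicalClosure_eq_top_iff, Submodule.eq_bot_iff]
    intro G hG
    refine h G fun i => ?_
    refine (Submodule.mem_orthogonal _ _).1 hG _ ⟨Finsupp.single i 1, by simp⟩
  rw [DenseRange, dense_iff_closure_eq]
  have := congrArg (fun K : Submodule ℝ E => (K : Set E)) h1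
  rwa [Submodule.topologicalClosure_coe, LinearMap.coe_range] at this

/-- Fubini: the sections of the diagonal are singletons, which are null. -/
theorem measure_pi_diagonal {X : Type*} [MeasurableSpace X] [MeasurableEq X] {μ : Measure X}
    [SigmaFinite μ] [NullSingletonClass μ] {n : ℕ} {i j : Fin n} (hij : i ≠ j) :
    (Measure.pi fun _ : Fin n => μ) {x | x i = x j} = 0 := by
  obtain _ | n := n
  · exact i.elim0
  have hm := measurePreserving_piFinSuccAbove (fun _ : Fin (n + 1) => μ) i
  obtain ⟨k, rfl⟩ := Fin.exists_succAbove_eq hij.symm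
  set D : Set (X × (Fin n → X)) := {q | q.1 = q.2 k} with hD
  have hDm : MeasurableSet D :=
    measurableSet_eq_fun measurable_fst ((measurable_pi_apply k).comp measurable_snd)
  have h1 : {x : Fin (n + 1) → X | x i = x (i.succAbove k)}
      = (MeasurableEquiv.piFinSuccAbove (fun _ => X) i) ⁻¹' D := by
    rfl
  rw [h1, hm.measure_preimage hDm.nullMeasurableSet, ← Measure.prod_swap,
    Measure.map_apply measurable_swap hDm, Measure.measure_prod_null (measurable_swap hDm)]
  refine Eventually.of_forall fun f => ?_
  have : Prod.mk f ⁻¹' (Prod.swap ⁻¹' D) = {f k} := by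
    ext a; simp [hD]
  exact (congrArg μ this).trans (measure_singleton _)

theorem ae_injective_pi {X : Type*} [MeasurableSpace X] [MeasurableEq X] {μ : Measure X}
    [SigmaFinite μ] [NullSingletonClass μ] {n : ℕ} :
    ∀ᵐ x ∂(Measure.pi fun _ : Fin n => μ), Function.Injective x := by
  have h : ∀ᵐ x ∂(Measure.pi fun _ : Fin n => μ), ∀ i j : Fin n, i ≠ j → x i ≠ x j := by
    refine ae_all_iff.2 fun i => ae_all_iff.2 fun j => ?_
    by_cases hij : i = j
    · simp [hij]
    · have := measure_pi_diagonal (μ := μ) hij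
      rw [measure_eq_zero_iff_ae_notMem] at this
      filter_upwards [this] with x hx _ using hx
  filter_upwards [h] with x hx i j hij
  by_contra h'
  exact hx i j h' hij

/-- A square integrable function whose integrals over measurable boxes contained in a box of finite
measure vanish is zero on that box. -/
theorem ae_eq_zero_of_setIntegral_box {X : Type*} [MeasurableSpace X] {μ : Measure X}
    [SigmaFinite μ] {n : ℕ} {E : Fin n → Set X} (hE : ∀ i, MeasurableSet (E i))
    (hμ : ∀ i, μ (E i) ≠ ⊤) {G : (Fin n → X) → ℝ}
    (hG : MemLp G 2 (Measure.pi fun _ : Fin n => μ))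
    (h : ∀ B : Fin n → Set X, (∀ i, MeasurableSet (B i)) → (∀ i, B i ⊆ E i) →
      ∫ x in univ.pi B, G x ∂(Measure.pi fun _ : Fin n => μ) = 0) :
    ∀ᵐ x ∂(Measure.pi fun _ : Fin n => μ), x ∈ univ.pi E → G x = 0 := by
  set ν := Measure.pi fun _ : Fin n => μ with hν
  have hEm : MeasurableSet (univ.pi E) := MeasurableSet.univ_pi hE
  have hfin : ν (univ.pi E) ≠ ⊤ := by
    rw [hν, Measure.pi_pi]
    exact (ENNReal.prod_lt_top fun i _ => (hμ i).lt_top).ne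
  have : IsFiniteMeasure (ν.restrict (univ.pi E)) := isFiniteMeasure_restrict.2 hfin
  have hGi : Integrable G (ν.restrict (univ.pi E)) :=
    (hG.restrict _).integrable one_le_two
  -- Boxes form a π-system generating the product σ-algebra, and the sets on which the integral
  -- vanishes form a Dynkin class.
  have key : ∀ S, MeasurableSet S → ∫ x in S, G x ∂(ν.restrict (univ.pi E)) = 0 := by
    intro S hS
    refine MeasurableSpace.induction_on_inter
      (C := fun S _ => ∫ x in S, G x ∂(ν.restrict (univ.pi E)) = 0) generateFrom_pi.symm
      isPiSystem_pi (by simp) (fun S hS => ?_) (fun S hS ih => ?_) (fun f hd hf ih => ?_) S hS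
    · obtain ⟨B, hB, rfl⟩ := hS
      rw [Measure.restrict_restrict (MeasurableSet.univ_pi fun i => hB i (mem_univ i)),
        ← Set.pi_inter_distrib]
      exact h _ (fun i => (hB i (mem_univ i)).inter (hE i)) fun i => inter_subset_right
    · have h1 := integral_add_compl hS hGi
      have h2 : ∫ x, G x ∂(ν.restrict (univ.pi E)) = 0 := h E hE fun i => Subset.rfl
      rw [ih, h2] at h1
      linarith
    · rw [integral_iUnion hf hd hGi.integrableOn]
      simp [ih]
  have h2 := hGi.ae_eq_zero_of_forall_setIntegral_eq_zero fun S hS _ => key S hS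
  exact (ae_restrict_iff' hEm).1 h2

variable {X : Type*} [MetricSpace X] [ProperSpace X] [MeasurableSpace X] [BorelSpace X]
  {μ : Measure X} {n : ℕ}

theorem boxFun_eq_indicator {X : Type*} (A : Fin n → Set X) :
    boxFun A = (univ.pi A).indicator fun _ => (1 : ℝ) := by
  ext x
  by_cases h : x ∈ univ.pi A
  · rw [indicator_of_mem h]
    exact Finset.prod_eq_one fun i _ => by simp [h i (mem_univ i)]
  · rw [indicator_of_notMem h]
    simp only [Set.mem_pi, mem_univ, true_imp_iff, not_forall] at h
    obtain ⟨i, hi⟩ := h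
    exact Finset.prod_eq_zero (Finset.mem_univ i) (by simp [hi])

/-- Such boxes miss the diagonals, which are null as the measure has no atoms. Off the diagonals a
point lies in a box whose sides are distinct dyadic cells, and every measurable box inside that one
again has disjoint sides. -/
theorem denseRange_boxIndicator [SigmaFinite μ] [NullSingletonClass μ] :
    DenseRange (Finsupp.linearCombination ℝ fun A : DisjointSets μ n => boxIndicator μ A) := by
  refine denseRange_linearCombination _ ?_
  set ν := Measure.pi fun _ : Fin n => μ with hν
  intro G hG
  have h0 : ∀ A : DisjointSets μ n, ∫ x in univ.pi A.set, G x ∂ν = 0 := by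
    intro A
    rw [← hG A, L2.inner_def, ← integral_indicator (MeasurableSet.univ_pi A.measurable)]
    have h1 : boxIndicator μ A =ᵐ[ν] boxFun A.set := coeFn_toL2 (memLp_boxFun A.measurable A.finite)
    refine integral_congr_ae (h1.mono fun x hx => ?_)
    simp only [hx, boxFun_eq_indicator]
    by_cases hxA : x ∈ univ.pi A.set <;> simp [hxA]
  set E : ℕ → (Fin n → ℕ) → Fin n → Set X := fun M j i =>
    cellIdx M ⁻¹' {j i} ∩ spanningSets μ M with hE
  have hEm : ∀ M j i, MeasurableSet (E M j i) := fun M j i =>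
    (measurable_cellIdx M (measurableSet_singleton _)).inter (measurableSet_spanningSets μ M)
  have hEμ : ∀ M j i, μ (E M j i) ≠ ⊤ := fun M j i =>
    ((measure_mono inter_subset_right).trans_lt (measure_spanningSets_lt_top μ M)).ne
  have h1 : ∀ᵐ x ∂ν, ∀ M (j : Fin n → ℕ), Function.Injective j →
      x ∈ univ.pi (E M j) → G x = 0 := by
    refine ae_all_iff.2 fun M => ae_all_iff.2 fun j => ?_
    by_cases hj : Function.Injective j
    · have := ae_eq_zero_of_setIntegral_box (hEm M j) (hEμ M j) (Lp.memLp G)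
        fun B hB hBE => h0 ⟨B, hB, fun i => ((measure_mono (hBE i)).trans_lt
          (hEμ M j i).lt_top).ne, fun i k hik => by
            refine disjoint_left.2 fun y hy hy' => hj.ne hik ?_
            exact (hBE i hy).1.symm.trans (hBE k hy').1⟩
      filter_upwards [this] with x hx _ using hx
    · exact Eventually.of_forall fun x h => (hj h).elim
  refine Lp.eq_zero_iff_ae_eq_zero.2 ?_
  filter_upwards [h1, ae_injective_pi (μ := μ)] with x hx hxi
  have h2 : ∀ᶠ M in atTop, ∀ i, x i ∈ spanningSets μ M := by
    refine eventually_all.2 fun i => ?_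
    obtain ⟨M, hM⟩ := mem_iUnion.1 ((iUnion_spanningSets μ).symm ▸ mem_univ (x i))
    exact eventually_atTop.2 ⟨M, fun N hN => monotone_spanningSets μ hN hM⟩
  obtain ⟨M, hM1, hM2⟩ := ((eventually_injOn_cellIdx (finite_range x)).and h2).exists
  exact hx M (fun i => cellIdx M (x i))
    (fun i j hij => hxi (hM1 (mem_range_self i) (mem_range_self j) hij)) fun i _ => ⟨rfl, hM2 i⟩

end Density

/-! ### The multiple stochastic integral -/

section MultipleIntegral

variable {X : Type*} [MetricSpace X] [ProperSpace X] [MeasurableSpace X] [BorelSpace X]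
  {μ : Measure X} {Q : Measure (Config X)} {n : ℕ}

/-- An atom would carry two points with positive Poisson probability, while a configuration is a set
and contains each point at most once. -/
theorem IsPoissonMeasure.nullSingletonClass [IsLocallyFiniteMeasure μ] (hQ : IsPoissonMeasure μ Q) :
    NullSingletonClass μ := by
  refine ⟨fun x => ?_⟩
  have hfin : μ {x} ≠ ⊤ := (isCompact_singleton.measure_lt_top).ne
  have h1 := hQ.map_ncard (measurableSet_singleton x) hfin
  have h2 : Q.map (fun γ : Config X => (γ.1 ∩ {x}).ncard) {2} = 0 := by
    rw [Measure.map_apply (measurable_ncard_inter (measurableSet_singleton x))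
      (measurableSet_singleton 2)]
    convert measure_empty (μ := Q)
    refine eq_empty_iff_forall_notMem.2 fun γ hγ => ?_
    have h3 : (γ.1 ∩ {x}).ncard ≤ 1 :=
      (ncard_le_ncard inter_subset_right (finite_singleton x)).trans (ncard_singleton x).le
    have h4 : (γ.1 ∩ {x}).ncard = 2 := hγ
    omega
  rw [h1, poissonMeasure_singleton, ENNReal.ofReal_eq_zero] at h2
  by_contra h
  have h3 : (0 : ℝ) < (μ {x}).toNNReal := by
    exact_mod_cast ENNReal.toNNReal_pos h hfin
  have : (0 : ℝ) < Real.exp (-(μ {x}).toNNReal) * (μ {x}).toNNReal ^ 2 / (2 : ℕ).factorial := by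
    positivity
  linarith

theorem IsPoissonMeasure.multipleIntegral_boxIndicator [IsLocallyFiniteMeasure μ]
    (hQ : IsPoissonMeasure μ Q) (A : DisjointSets μ n) :
    multipleIntegral μ Q n (boxIndicator μ A) = compensatedProduct μ Q A := by
  have := hQ.nullSingletonClass
  have h := LinearMap.extendOfNorm_eq (f := Finsupp.linearCombination ℝ
    fun A : DisjointSets μ n => compensatedProduct μ Q A) denseRange_boxIndicator
    ⟨_, hQ.norm_linearCombination_le⟩ (Finsupp.single A 1)
  simpa [multipleIntegral] using h

theorem IsPoissonMeasure.norm_multipleIntegral_le [IsLocallyFiniteMeasure μ]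
    (hQ : IsPoissonMeasure μ Q) (f : Lp ℝ 2 (Measure.pi fun _ : Fin n => μ)) :
    ‖multipleIntegral μ Q n f‖ ≤ Real.sqrt n.factorial * ‖f‖ := by
  have := hQ.nullSingletonClass
  exact LinearMap.norm_extendOfNorm_apply_le denseRange_boxIndicator _
    hQ.norm_linearCombination_le f

end MultipleIntegral

end
end InfiniteParticles

namespace InfiniteParticles

noncomputable section

/-! ### Tensor powers in `L²` -/

section Tensor

variable {X : Type*} [MeasurableSpace X] {μ : Measure X} [SigmaFinite μ] {n : ℕ}

theorem quasiMeasurePreserving_pi_apply (i : Fin n) :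
    Measure.QuasiMeasurePreserving (fun x : Fin n → X => x i) (Measure.pi fun _ : Fin n => μ) μ :=
  Measure.quasiMeasurePreserving_eval (fun _ : Fin n => μ) i

theorem memLp_prod_pi {f : Fin n → X → ℝ} (hf : ∀ i, MemLp (f i) 2 μ) :
    MemLp (fun x : Fin n → X => ∏ i, f i (x i)) 2 (Measure.pi fun _ : Fin n => μ) := by
  have hm : AEStronglyMeasurable (fun x : Fin n → X => ∏ i, f i (x i))
      (Measure.pi fun _ : Fin n => μ) :=
    Finset.aestronglyMeasurable_fun_prod _ fun i _ =>
      (hf i).1.comp_quasiMeasurePreserving (quasiMeasurePreserving_pi_apply i)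
  rw [memLp_two_iff_integrable_sq hm]
  simp_rw [← Finset.prod_pow]
  exact Integrable.fintype_prod fun i => (memLp_two_iff_integrable_sq (hf i).1).1 (hf i)

theorem prod_pi_congr_ae {f g : Fin n → X → ℝ} (h : ∀ i, f i =ᵐ[μ] g i) :
    (fun x : Fin n → X => ∏ i, f i (x i)) =ᵐ[Measure.pi fun _ : Fin n => μ]
      fun x => ∏ i, g i (x i) := by
  have : ∀ᵐ x ∂(Measure.pi fun _ : Fin n => μ), ∀ i, f i (x i) = g i (x i) :=
    ae_all_iff.2 fun i => (quasiMeasurePreserving_pi_apply i).ae (h i)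
  exact this.mono fun x hx => Finset.prod_congr rfl fun i _ => hx i

theorem integral_prod_pi (f : Fin n → X → ℝ) :
    ∫ x, ∏ i, f i (x i) ∂(Measure.pi fun _ : Fin n => μ) = ∏ i, ∫ x, f i x ∂μ :=
  integral_fintype_prod_eq_prod f

theorem toL2_ext {S : Type*} [MeasurableSpace S] {ν : Measure S} {f : S → ℝ} (hf : MemLp f 2 ν)
    {G : Lp ℝ 2 ν} (h : f =ᵐ[ν] G) : toL2 ν f = G :=
  Lp.ext ((coeFn_toL2 hf).trans h)

/-- The tensor product `f_1 ⊗ ⋯ ⊗ f_n` as a multilinear map. -/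
def tensorMultilinear (μ : Measure X) [SigmaFinite μ] (n : ℕ) :
    MultilinearMap ℝ (fun _ : Fin n => Lp ℝ 2 μ) (Lp ℝ 2 (Measure.pi fun _ : Fin n => μ)) where
  toFun f := toL2 _ fun x => ∏ i, f i (x i)
  map_update_add' := by
    intro _ m i a b
    have hm : ∀ f : Fin n → Lp ℝ 2 μ, MemLp (fun x : Fin n → X => ∏ i, f i (x i)) 2
        (Measure.pi fun _ : Fin n => μ) := fun f => memLp_prod_pi fun i => Lp.memLp (f i)
    refine toL2_ext (hm _) ?_
    filter_upwards [Lp.coeFn_add (toL2 (Measure.pi fun _ : Fin n => μ)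
        fun x => ∏ j, Function.update m i a j (x j)) (toL2 _
        fun x => ∏ j, Function.update m i b j (x j)), coeFn_toL2 (hm (Function.update m i a)),
      coeFn_toL2 (hm (Function.update m i b)),
      (quasiMeasurePreserving_pi_apply i).ae (Lp.coeFn_add a b)] with x h1 h2 h3 h4
    rw [h1, Pi.add_apply, h2, h3, ← Finset.mul_prod_erase _ _ (Finset.mem_univ i),
      ← Finset.mul_prod_erase _ _ (Finset.mem_univ i),
      ← Finset.mul_prod_erase _ _ (Finset.mem_univ i)]
    have h5 : ∀ c, ∏ j ∈ Finset.univ.erase i, Function.update m i c j (x j)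
        = ∏ j ∈ Finset.univ.erase i, m j (x j) := fun c => Finset.prod_congr rfl fun j hj => by
      rw [Function.update_of_ne (Finset.ne_of_mem_erase hj)]
    simp only [h5, Function.update_self]
    rw [h4, Pi.add_apply, add_mul]
  map_update_smul' := by
    intro _ m i c a
    have hm : ∀ f : Fin n → Lp ℝ 2 μ, MemLp (fun x : Fin n → X => ∏ i, f i (x i)) 2
        (Measure.pi fun _ : Fin n => μ) := fun f => memLp_prod_pi fun i => Lp.memLp (f i)
    refine toL2_ext (hm _) ?_
    filter_upwards [Lp.coeFn_smul c (toL2 (Measure.pi fun _ : Fin n => μ)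
        fun x => ∏ j, Function.update m i a j (x j)), coeFn_toL2 (hm (Function.update m i a)),
      (quasiMeasurePreserving_pi_apply i).ae (Lp.coeFn_smul c a)] with x h1 h2 h4
    rw [h1, Pi.smul_apply, h2, ← Finset.mul_prod_erase _ _ (Finset.mem_univ i),
      ← Finset.mul_prod_erase _ _ (Finset.mem_univ i)]
    have h5 : ∀ c, ∏ j ∈ Finset.univ.erase i, Function.update m i c j (x j)
        = ∏ j ∈ Finset.univ.erase i, m j (x j) := fun c => Finset.prod_congr rfl fun j hj => by
      rw [Function.update_of_ne (Finset.ne_of_mem_erase hj)]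
    simp only [h5, Function.update_self]
    rw [h4, Pi.smul_apply, smul_eq_mul, smul_eq_mul, mul_assoc]

theorem coeFn_tensorMultilinear (f : Fin n → Lp ℝ 2 μ) :
    tensorMultilinear μ n f =ᵐ[Measure.pi fun _ : Fin n => μ] fun x => ∏ i, f i (x i) :=
  coeFn_toL2 (memLp_prod_pi fun i => Lp.memLp (f i))

theorem norm_tensorMultilinear (f : Fin n → Lp ℝ 2 μ) :
    ‖tensorMultilinear μ n f‖ = ∏ i, ‖f i‖ := by
  rw [← sq_eq_sq₀ (norm_nonneg _) (Finset.prod_nonneg fun _ _ => norm_nonneg _),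
    norm_sq_eq_integral_of_ae_eq (coeFn_tensorMultilinear f), ← Finset.prod_pow]
  simp_rw [← Finset.prod_pow]
  rw [integral_prod_pi fun i x => f i x ^ 2]
  exact Finset.prod_congr rfl fun i _ => (norm_sq_eq_integral_of_ae_eq (ae_eq_refl _)).symm

/-- The tensor product `f_1 ⊗ ⋯ ⊗ f_n` as a continuous multilinear map. -/
def tensorMap (μ : Measure X) [SigmaFinite μ] (n : ℕ) :
    ContinuousMultilinearMap ℝ (fun _ : Fin n => Lp ℝ 2 μ)
      (Lp ℝ 2 (Measure.pi fun _ : Fin n => μ)) :=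
  (tensorMultilinear μ n).mkContinuous 1 fun f => by rw [norm_tensorMultilinear, one_mul]

theorem tensorPower_eq_tensorMap (f : Lp ℝ 2 μ) :
    tensorPower μ n f = tensorMap μ n fun _ => f := rfl

theorem norm_tensorPower (f : Lp ℝ 2 μ) : ‖tensorPower μ n f‖ = ‖f‖ ^ n := by
  rw [tensorPower_eq_tensorMap]
  exact (norm_tensorMultilinear fun _ => f).trans (by simp)

theorem continuous_tensorPower : Continuous (tensorPower μ n) :=
  (tensorMap μ n).cont.comp (continuous_pi fun _ => continuous_id)

theorem tensorPower_smul (c : ℝ) (f : Lp ℝ 2 μ) :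
    tensorPower μ n (c • f) = c ^ n • tensorPower μ n f := by
  have := (tensorMap μ n).toMultilinearMap.map_smul_univ (fun _ => c) (fun _ => f)
  rw [Finset.prod_const, Finset.card_univ, Fintype.card_fin] at this
  exact this

theorem coeFn_tensorPower {f : Lp ℝ 2 μ} {g : X → ℝ} (h : f =ᵐ[μ] g) :
    tensorPower μ n f =ᵐ[Measure.pi fun _ : Fin n => μ] fun x => ∏ i, g (x i) :=
  (coeFn_tensorMultilinear fun _ => f).trans (prod_pi_congr_ae fun _ => h)

end Tensor

/-! ### Convergence in `L²` and the mean value -/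

section DominatedConvergence

variable {S : Type*} [MeasurableSpace S] {ν : Measure S}

theorem tendsto_Lp_of_dominated {F : ℕ → Lp ℝ 2 ν} {G : Lp ℝ 2 ν} {f : ℕ → S → ℝ} {g b : S → ℝ}
    (hF : ∀ k, F k =ᵐ[ν] f k) (hG : G =ᵐ[ν] g) (hb : MemLp b 2 ν)
    (hfb : ∀ k, ∀ᵐ x ∂ν, |f k x| ≤ b x)
    (h : ∀ᵐ x ∂ν, Tendsto (fun k => f k x) atTop (𝓝 (g x))) : Tendsto F atTop (𝓝 G) := by
  rw [tendsto_iff_norm_sub_tendsto_zero]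
  have hgb : ∀ᵐ x ∂ν, |g x| ≤ b x := by
    filter_upwards [h, ae_all_iff.2 hfb] with x hx hx'
    exact le_of_tendsto' hx.abs hx'
  have h1 : ∀ k, ‖F k - G‖ ^ 2 = ∫ x, (f k x - g x) ^ 2 ∂ν := fun k => by
    refine norm_sq_eq_integral_of_ae_eq ?_
    filter_upwards [Lp.coeFn_sub (F k) G, hF k, hG] with x h1 h2 h3
    rw [h1, Pi.sub_apply, h2, h3]
  have h2 : Tendsto (fun k => ‖F k - G‖ ^ 2) atTop (𝓝 0) := by
    simp_rw [h1]
    have h3 : (0 : ℝ) = ∫ _x, (0 : ℝ) ∂ν := by simp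
    rw [h3]
    refine tendsto_integral_of_dominated_convergence (fun x => 4 * b x ^ 2) (fun k => ?_)
      (((memLp_two_iff_integrable_sq hb.1).1 hb).const_mul 4) (fun k => ?_) ?_
    · exact (((Lp.aestronglyMeasurable (F k)).congr (hF k)).sub
        ((Lp.aestronglyMeasurable G).congr hG)).pow 2
    · filter_upwards [hfb k, hgb] with x h4 h5
      rw [Real.norm_of_nonneg (sq_nonneg _)]
      have := abs_le.1 h4
      have := abs_le.1 h5
      nlinarith
    · filter_upwards [h] with x hx
      have := (hx.sub_const (g x)).pow 2
      simpa using this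
  have h3 := h2.sqrt
  simpa [Real.sqrt_sq (norm_nonneg _)] using h3

/-- The mean value, as a continuous linear form on `L²`. -/
def meanL2 (ν : Measure S) [IsFiniteMeasure ν] : Lp ℝ 2 ν →L[ℝ] ℝ :=
  innerSL ℝ ((memLp_const (p := 2) (μ := ν) (1 : ℝ)).toLp _)

theorem meanL2_apply [IsFiniteMeasure ν] (F : Lp ℝ 2 ν) : meanL2 ν F = ∫ x, F x ∂ν := by
  change inner ℝ ((memLp_const (p := 2) (μ := ν) (1 : ℝ)).toLp _) F = _
  rw [L2.inner_def]
  refine integral_congr_ae ((memLp_const (p := 2) (μ := ν) (1 : ℝ)).coeFn_toLp.mono fun x hx => ?_)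
  dsimp only at hx ⊢
  rw [hx]
  simp

end DominatedConvergence

/-! ### Chaos powers and exponential vectors -/

section Chaos

theorem summable_pow_div_sqrt_factorial {c : ℝ} (hc : 0 ≤ c) :
    Summable fun n : ℕ => c ^ n / Real.sqrt n.factorial := by
  rcases hc.eq_or_lt with rfl | hc
  · refine summable_of_ne_finset_zero (s := {0}) fun n hn => ?_
    simp only [Finset.mem_singleton] at hn
    simp [hn]
  refine summable_of_ratio_test_tendsto_lt_one zero_lt_one
    (Eventually.of_forall fun n => by positivity) ?_
  have h1 : ∀ n : ℕ, ‖c ^ (n + 1) / Real.sqrt (n + 1).factorial‖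
      / ‖c ^ n / Real.sqrt n.factorial‖ = c / Real.sqrt (n + 1 : ℝ) := by
    intro n
    rw [Real.norm_of_nonneg (by positivity), Real.norm_of_nonneg (by positivity),
      Nat.factorial_succ]
    push_cast
    rw [Real.sqrt_mul (by positivity)]
    have : (0 : ℝ) < Real.sqrt n.factorial := Real.sqrt_pos.2 (by positivity)
    have : (0 : ℝ) < Real.sqrt (n + 1 : ℝ) := Real.sqrt_pos.2 (by positivity)
    field_simp
    ring
  simp_rw [h1]
  refine Tendsto.const_div_atTop ?_ c
  exact Real.tendsto_sqrt_atTop.comp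
    (tendsto_atTop_add_const_right _ _ tendsto_natCast_atTop_atTop)

variable {X : Type*} [MetricSpace X] [ProperSpace X] [MeasurableSpace X] [BorelSpace X]
  {μ : Measure X} {Q : Measure (Config X)} {n : ℕ}

/-- The multiple integral `I_n(f^{⊗ n})`. -/
def chaosPower (μ : Measure X) (Q : Measure (Config X)) (n : ℕ) (f : Lp ℝ 2 μ) : Lp ℝ 2 Q :=
  multipleIntegral μ Q n (tensorPower μ n f)

/-- The exponential vector `∑ I_n(f^{⊗ n}) / n!`. -/
def expVector (μ : Measure X) (Q : Measure (Config X)) (f : Lp ℝ 2 μ) : Lp ℝ 2 Q :=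
  ∑' n : ℕ, (n.factorial : ℝ)⁻¹ • chaosPower μ Q n f

variable [IsLocallyFiniteMeasure μ]

theorem continuous_chaosPower : Continuous (chaosPower μ Q n) :=
  (multipleIntegral μ Q n).continuous.comp continuous_tensorPower

theorem chaosPower_smul (c : ℝ) (f : Lp ℝ 2 μ) :
    chaosPower μ Q n (c • f) = c ^ n • chaosPower μ Q n f := by
  rw [chaosPower, tensorPower_smul, map_smul, chaosPower]

theorem inv_factorial_mul_sqrt_factorial (n : ℕ) (c : ℝ) :
    (n.factorial : ℝ)⁻¹ * (Real.sqrt n.factorial * c) = c / Real.sqrt n.factorial := by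
  have h : (0 : ℝ) < Real.sqrt n.factorial := Real.sqrt_pos.2 (by positivity)
  have h2 : (n.factorial : ℝ) = Real.sqrt n.factorial * Real.sqrt n.factorial :=
    (Real.mul_self_sqrt (by positivity)).symm
  rw [← mul_assoc]
  nth_rw 1 [h2]
  field_simp

/-- Dividing `√n!` by `n!` leaves `1 / √n!`, which beats every geometric factor; hence exponential
vectors converge absolutely for all `f`. -/
theorem IsPoissonMeasure.norm_smul_multipleIntegral_le (hQ : IsPoissonMeasure μ Q)
    (g : Lp ℝ 2 (Measure.pi fun _ : Fin n => μ)) {c : ℝ} (hg : ‖g‖ ≤ c ^ n) :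
    ‖(n.factorial : ℝ)⁻¹ • multipleIntegral μ Q n g‖ ≤ c ^ n / Real.sqrt n.factorial := by
  rw [norm_smul, Real.norm_of_nonneg (by positivity), ← inv_factorial_mul_sqrt_factorial]
  gcongr
  exact (hQ.norm_multipleIntegral_le g).trans (by gcongr)

theorem IsPoissonMeasure.norm_smul_chaosPower_le (hQ : IsPoissonMeasure μ Q) (f : Lp ℝ 2 μ)
    {c : ℝ} (hf : ‖f‖ ≤ c) :
    ‖(n.factorial : ℝ)⁻¹ • chaosPower μ Q n f‖ ≤ c ^ n / Real.sqrt n.factorial :=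
  hQ.norm_smul_multipleIntegral_le _ (by rw [norm_tensorPower]; gcongr)

theorem IsPoissonMeasure.summable_norm_chaosPower (hQ : IsPoissonMeasure μ Q) (f : Lp ℝ 2 μ) :
    Summable fun n : ℕ => ‖(n.factorial : ℝ)⁻¹ • chaosPower μ Q n f‖ :=
  Summable.of_nonneg_of_le (fun _ => norm_nonneg _)
    (fun _ => hQ.norm_smul_chaosPower_le f le_rfl) (summable_pow_div_sqrt_factorial (norm_nonneg f))

theorem IsPoissonMeasure.hasSum_expVector (hQ : IsPoissonMeasure μ Q) (f : Lp ℝ 2 μ) :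
    HasSum (fun n : ℕ => (n.factorial : ℝ)⁻¹ • chaosPower μ Q n f) (expVector μ Q f) :=
  (hQ.summable_norm_chaosPower f).of_norm.hasSum

/-- Dominated convergence for the chaos series. The kernels `g k n` need not be tensor powers; this
freedom is used for off-diagonal approximations. -/
theorem IsPoissonMeasure.tendsto_tsum_multipleIntegral (hQ : IsPoissonMeasure μ Q)
    {g : ℕ → ∀ n, Lp ℝ 2 (Measure.pi fun _ : Fin n => μ)}
    {g' : ∀ n, Lp ℝ 2 (Measure.pi fun _ : Fin n => μ)} {c : ℝ} (hc : 0 ≤ c)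
    (hg : ∀ k n, ‖g k n‖ ≤ c ^ n) (h : ∀ n, Tendsto (fun k => g k n) atTop (𝓝 (g' n))) :
    Tendsto (fun k => ∑' n : ℕ, (n.factorial : ℝ)⁻¹ • multipleIntegral μ Q n (g k n)) atTop
      (𝓝 (∑' n : ℕ, (n.factorial : ℝ)⁻¹ • multipleIntegral μ Q n (g' n))) := by
  refine tendsto_tsum_of_dominated_convergence (summable_pow_div_sqrt_factorial hc)
    (fun n => ?_) (Eventually.of_forall fun k n => hQ.norm_smul_multipleIntegral_le _ (hg k n))
  exact (((multipleIntegral μ Q n).continuous.tendsto _).comp (h n)).const_smul _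

theorem IsPoissonMeasure.continuous_expVector (hQ : IsPoissonMeasure μ Q) :
    Continuous (expVector μ Q) := by
  refine continuous_iff_seqContinuous.2 fun f g h => ?_
  obtain ⟨c, hc⟩ := h.norm.bddAbove_range
  have hc' : ∀ k, ‖f k‖ ≤ c := fun k => hc ⟨k, rfl⟩
  refine hQ.tendsto_tsum_multipleIntegral ((norm_nonneg _).trans (hc' 0)) (fun k n => ?_)
    fun n => (continuous_tensorPower.tendsto _).comp h
  rw [norm_tensorPower]
  gcongr
  exact hc' k

omit [IsLocallyFiniteMeasure μ] in
theorem IsPoissonMeasure.coeFn_compensatedProduct (hQ : IsPoissonMeasure μ Q)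
    (A : DisjointSets μ n) :
    compensatedProduct μ Q A =ᵐ[Q] fun γ => ∏ i, compCount μ (A.set i) γ :=
  coeFn_toL2 (hQ.memLp_compensatedProduct A)

theorem IsPoissonMeasure.coeFn_chaosPower_zero (hQ : IsPoissonMeasure μ Q) (f : Lp ℝ 2 μ) :
    chaosPower μ Q 0 f =ᵐ[Q] fun _ => 1 := by
  let A : DisjointSets μ 0 := ⟨fun i => i.elim0, fun i => i.elim0, fun i => i.elim0,
    fun i => i.elim0⟩
  have h : tensorPower μ 0 f = boxIndicator μ A := by
    unfold tensorPower boxIndicator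
    simp
  rw [chaosPower, h, hQ.multipleIntegral_boxIndicator]
  exact (hQ.coeFn_compensatedProduct A).trans (by simp)

/-- By continuity it is enough to consider boxes, where the product of centred independent counts
has mean zero. -/
theorem IsPoissonMeasure.integral_multipleIntegral (hQ : IsPoissonMeasure μ Q) (hn : n ≠ 0)
    (g : Lp ℝ 2 (Measure.pi fun _ : Fin n => μ)) : ∫ γ, multipleIntegral μ Q n g γ ∂Q = 0 := by
  have := hQ.isProbabilityMeasure
  have := hQ.nullSingletonClass
  rw [← meanL2_apply]
  set L : Lp ℝ 2 (Measure.pi fun _ : Fin n => μ) →L[ℝ] ℝ :=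
    (meanL2 Q).comp (multipleIntegral μ Q n) with hL
  suffices L = 0 from congrArg (fun L : _ →L[ℝ] ℝ => L g) this
  refine DFunLike.coe_injective (denseRange_boxIndicator.equalizer L.continuous
    (0 : _ →L[ℝ] ℝ).continuous (funext fun x => ?_))
  suffices L.toLinearMap.comp (Finsupp.linearCombination ℝ fun A : DisjointSets μ n =>
      boxIndicator μ A) = 0 from congrArg (fun L : _ →ₗ[ℝ] ℝ => L x) this
  refine Finsupp.lhom_ext' fun A => LinearMap.ext_ring ?_
  simp only [LinearMap.coe_comp, Function.comp_apply, Finsupp.lsingle_apply,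
    Finsupp.linearCombination_single, one_smul, LinearMap.zero_apply]
  change meanL2 Q (multipleIntegral μ Q n (boxIndicator μ A)) = 0
  classical
  rw [hQ.multipleIntegral_boxIndicator, meanL2_apply,
    integral_congr_ae (hQ.coeFn_compensatedProduct A)]
  have h2 := (hQ.integral_prod_compCount_mul A.measurable A.finite A.disjoint Finset.univ ∅).2
  have h3 : (Finset.univ : Finset (Fin n)) ≠ ∅ := by
    have : Nonempty (Fin n) := ⟨⟨0, Nat.pos_of_ne_zero hn⟩⟩
    exact Finset.univ_nonempty.ne_empty
  simpa [h3] using h2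

theorem IsPoissonMeasure.integral_expVector (hQ : IsPoissonMeasure μ Q) (f : Lp ℝ 2 μ) :
    ∫ γ, expVector μ Q f γ ∂Q = 1 := by
  have := hQ.isProbabilityMeasure
  have h2 := (hQ.hasSum_expVector f).mapL (meanL2 Q)
  have h3 : HasSum (fun n : ℕ => meanL2 Q ((n.factorial : ℝ)⁻¹ • chaosPower μ Q n f)) 1 := by
    convert! hasSum_single 0 fun n hn => ?_
    · rw [map_smul, meanL2_apply, integral_congr_ae (hQ.coeFn_chaosPower_zero f)]
      simp
    · rw [map_smul, meanL2_apply, chaosPower, hQ.integral_multipleIntegral hn, smul_zero]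
  rw [← meanL2_apply]
  exact h2.unique h3

end Chaos

end
end InfiniteParticles

namespace InfiniteParticles

noncomputable section

/-! ### Exponential tilts of the Poisson law -/

section GeneratingFunction

theorem hasSum_poissonMeasure_pow (r : ℝ≥0) (a : ℝ) :
    HasSum (fun n : ℕ => Real.exp (-r) * r ^ n / n.factorial * a ^ n)
      (Real.exp (r * (a - 1))) := by
  have h := (NormedSpace.expSeries_div_hasSum_exp (r * a : ℝ)).mul_left (Real.exp (-r))
  rw [← Real.exp_eq_exp_ℝ, ← Real.exp_add] at h
  convert! h using 1
  · ext n; rw [mul_pow]; ring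
  · ring_nf

theorem hasSum_poissonMeasure_nat_mul_pow (r : ℝ≥0) (a : ℝ) :
    HasSum (fun n : ℕ => Real.exp (-r) * r ^ n / n.factorial * (n * a ^ n))
      (r * (a * Real.exp (r * (a - 1)))) := by
  refine hasSum_poissonMeasure_mul_nat r (fun n => a ^ n) ?_
  refine ((hasSum_poissonMeasure_pow r a).mul_left a).congr_fun fun n => ?_
  ring

theorem integrable_pow_poissonMeasure (r : ℝ≥0) (a : ℝ) :
    Integrable (fun n : ℕ => a ^ n) (poissonMeasure r) := by
  rw [integrable_poissonMeasure_iff]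
  refine (hasSum_poissonMeasure_pow r |a|).summable.congr fun n => ?_
  rw [norm_pow, Real.norm_eq_abs]

theorem integrable_nat_mul_pow_poissonMeasure (r : ℝ≥0) (a : ℝ) :
    Integrable (fun n : ℕ => (n : ℝ) * a ^ n) (poissonMeasure r) := by
  rw [integrable_poissonMeasure_iff]
  refine (hasSum_poissonMeasure_nat_mul_pow r |a|).summable.congr fun n => ?_
  rw [norm_mul, norm_pow, Real.norm_of_nonneg (Nat.cast_nonneg n), Real.norm_eq_abs]

theorem integral_pow_poissonMeasure (r : ℝ≥0) (a : ℝ) :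
    ∫ n : ℕ, a ^ n ∂(poissonMeasure r) = Real.exp (r * (a - 1)) := by
  rw [integral_poissonMeasure]
  simpa using (hasSum_poissonMeasure_pow r a).tsum_eq

theorem integral_nat_mul_pow_poissonMeasure (r : ℝ≥0) (a : ℝ) :
    ∫ n : ℕ, (n : ℝ) * a ^ n ∂(poissonMeasure r) = r * (a * Real.exp (r * (a - 1))) := by
  rw [integral_poissonMeasure]
  simpa using (hasSum_poissonMeasure_nat_mul_pow r a).tsum_eq

/-- The density of the law of a Poisson variable tilted by `(1 + t) ^ n`. -/
def poissonTilt (r t : ℝ) (n : ℕ) : ℝ := (1 + t) ^ n * Real.exp (-(t * r))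

theorem poissonTilt_sq_eq (r t : ℝ) (n : ℕ) :
    poissonTilt r t n ^ 2 = ((1 + t) ^ 2) ^ n * Real.exp (-(2 * (t * r))) := by
  rw [poissonTilt, mul_pow, ← Real.exp_nat_mul, ← pow_mul, ← pow_mul, mul_comm n 2]
  push_cast
  ring_nf

theorem integrable_poissonTilt_sq (r : ℝ≥0) (t : ℝ) :
    Integrable (fun n => poissonTilt r t n ^ 2) (poissonMeasure r) := by
  simp_rw [poissonTilt_sq_eq]
  exact (integrable_pow_poissonMeasure r _).mul_const _

theorem integral_poissonTilt_sq (r : ℝ≥0) (t : ℝ) :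
    ∫ n, poissonTilt r t n ^ 2 ∂(poissonMeasure r) = Real.exp (t ^ 2 * r) := by
  simp_rw [poissonTilt_sq_eq]
  rw [integral_mul_const, integral_pow_poissonMeasure, ← Real.exp_add]
  ring_nf

theorem poissonTilt_mul_eq (r t : ℝ) (n : ℕ) :
    (1 + t * (n - r)) * poissonTilt r t n
      = ((1 - t * r) * (1 + t) ^ n + t * (n * (1 + t) ^ n)) * Real.exp (-(t * r)) := by
  rw [poissonTilt]; ring

theorem integrable_one_add_mul_poissonTilt (r : ℝ≥0) (t : ℝ) :
    Integrable (fun n : ℕ => (1 + t * (n - r)) * poissonTilt r t n) (poissonMeasure r) := by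
  simp_rw [poissonTilt_mul_eq]
  exact (((integrable_pow_poissonMeasure r _).const_mul _).add
    ((integrable_nat_mul_pow_poissonMeasure r _).const_mul _)).mul_const _

/-- The value agrees with the second moment of `1 + t * (n - r)`, so the tilt minus this linear part
is orthogonal to the linear part. -/
theorem integral_one_add_mul_poissonTilt (r : ℝ≥0) (t : ℝ) :
    ∫ n : ℕ, (1 + t * (n - r)) * poissonTilt r t n ∂(poissonMeasure r) = 1 + t ^ 2 * r := by
  simp_rw [poissonTilt_mul_eq]
  rw [integral_mul_const, integral_add ((integrable_pow_poissonMeasure r _).const_mul _)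
    ((integrable_nat_mul_pow_poissonMeasure r _).const_mul _), integral_const_mul,
    integral_const_mul, integral_pow_poissonMeasure, integral_nat_mul_pow_poissonMeasure]
  have : Real.exp (r * (1 + t - 1)) * Real.exp (-(t * r)) = 1 := by
    rw [← Real.exp_add, ← Real.exp_zero]; ring_nf
  linear_combination (1 + t ^ 2 * r) * this

theorem integrable_one_add_sq_poissonMeasure (r : ℝ≥0) (t : ℝ) :
    Integrable (fun n : ℕ => (1 + t * ((n : ℝ) - r)) ^ 2) (poissonMeasure r) := by
  have h : (fun n : ℕ => (1 + t * ((n : ℝ) - r)) ^ 2)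
      = fun n : ℕ => 1 + 2 * t * ((n : ℝ) - r) + t ^ 2 * ((n : ℝ) - r) ^ 2 := by
    ext n; ring
  rw [h]
  exact ((integrable_const _).add (((integrable_id_poissonMeasure r).sub
    (integrable_const _)).const_mul _)).add ((integrable_sub_sq_poissonMeasure r).const_mul _)

theorem integral_one_add_sq_poissonMeasure (r : ℝ≥0) (t : ℝ) :
    ∫ n : ℕ, (1 + t * ((n : ℝ) - r)) ^ 2 ∂(poissonMeasure r) = 1 + t ^ 2 * r := by
  have h : (fun n : ℕ => (1 + t * ((n : ℝ) - r)) ^ 2)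
      = fun n : ℕ => 1 + 2 * t * ((n : ℝ) - r) + t ^ 2 * ((n : ℝ) - r) ^ 2 := by
    ext n; ring
  have h1 : Integrable (fun n : ℕ => 2 * t * ((n : ℝ) - r)) (poissonMeasure r) :=
    ((integrable_id_poissonMeasure r).sub (integrable_const _)).const_mul _
  have h2 : Integrable (fun n : ℕ => 1 + 2 * t * ((n : ℝ) - r)) (poissonMeasure r) :=
    (integrable_const _).add h1
  rw [h, integral_add h2 ((integrable_sub_sq_poissonMeasure r).const_mul _),
    integral_add (integrable_const _) h1, integral_const_mul, integral_const_mul,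
    integral_sub_poissonMeasure, integral_sub_sq_poissonMeasure]
  simp

end GeneratingFunction

/-! ### Off-diagonal exponential vectors as finite products -/

section Expansion

-- Every `n`-element set is the image of exactly `n!` injective tuples; this cancels the `1 / n!` of
-- the exponential series.
open Classical in
theorem sum_injective_image {κ V : Type*} [Fintype κ] [AddCommMonoid V] (n : ℕ)
    (g : Finset κ → V) :
    ∑ k : Fin n → κ, (if Function.Injective k then g (Finset.univ.image k) else 0)
      = n.factorial • ∑ S ∈ Finset.univ.powersetCard n, g S := by
  rw [← Finset.sum_filter]
  have h : ∀ k ∈ Finset.univ.filter (fun k : Fin n → κ => Function.Injective k),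
      Finset.univ.image k ∈ (Finset.univ : Finset κ).powersetCard n := fun k hk => by
    rw [Finset.mem_powersetCard]
    exact ⟨Finset.subset_univ _, by
      rw [Finset.card_image_of_injective _ (Finset.mem_filter.1 hk).2]; simp⟩
  rw [← Finset.sum_fiberwise_of_maps_to h, Finset.smul_sum]
  refine Finset.sum_congr rfl fun S hS => ?_
  rw [Finset.sum_congr rfl fun k hk => congrArg g (Finset.mem_filter.1 hk).2, Finset.sum_const]
  congr 1
  have hcard := (Finset.mem_powersetCard.1 hS).2
  set k₀ : Fin n → κ := fun i => ((S.equivFinOfCardEq hcard).symm i).1 with hk₀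
  have hinj : Function.Injective k₀ := fun i j hij =>
    (S.equivFinOfCardEq hcard).symm.injective (Subtype.ext hij)
  have him : Finset.univ.image k₀ = S := by
    ext c
    simp only [Finset.mem_image, Finset.mem_univ, true_and, hk₀]
    exact ⟨fun ⟨i, hi⟩ => hi ▸ ((S.equivFinOfCardEq hcard).symm i).2,
      fun hc => ⟨S.equivFinOfCardEq hcard ⟨c, hc⟩, by simp⟩⟩
  have h1 := sum_image_eq_eq_sum_perm hinj fun _ => 1
  have h2 : (Finset.univ.filter fun l : Fin n → κ => Function.Injective l).filter
      (fun l => Finset.univ.image l = S)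
      = Finset.univ.filter fun l => Finset.univ.image k₀ = Finset.univ.image l := by
    ext l
    simp only [Finset.mem_filter, Finset.mem_univ, true_and, him]
    constructor
    · rintro ⟨_, h⟩; exact h.symm
    · intro h
      obtain ⟨σ, rfl⟩ := exists_perm_of_image_eq hinj (him.trans h)
      exact ⟨hinj.comp σ.injective, h.symm⟩
  rw [h2]
  rw [← Finset.sum_filter] at h1
  simp only [Finset.sum_const, nsmul_eq_mul, mul_one, Finset.card_univ, Fintype.card_perm,
    Fintype.card_fin] at h1
  exact_mod_cast h1

theorem toL2_sum {S ι : Type*} [MeasurableSpace S] {ν : Measure S} (s : Finset ι) (a : ι → ℝ)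
    {f : ι → S → ℝ} (hf : ∀ i ∈ s, MemLp (f i) 2 ν) :
    toL2 ν (fun x => ∑ i ∈ s, a i * f i x) = ∑ i ∈ s, a i • toL2 ν (f i) := by
  refine toL2_ext (memLp_finsetSum _ fun i hi => (hf i hi).const_mul (a i)) ?_
  have h1 : ∀ᵐ y ∂ν, ∀ i : s, (a i • toL2 ν (f i) : Lp ℝ 2 ν) y = a i * f i y := by
    refine ae_all_iff.2 fun i => ?_
    filter_upwards [Lp.coeFn_smul (a i) (toL2 ν (f i)), coeFn_toL2 (hf i i.2)] with y h1 h2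
    rw [h1, Pi.smul_apply, h2, smul_eq_mul]
  filter_upwards [h1, Lp.coeFn_finsetSum s fun i => a i • toL2 ν (f i)] with y h1 h2
  rw [h2, Finset.sum_apply]
  exact Finset.sum_congr rfl fun i hi => (h1 ⟨i, hi⟩).symm

variable {X : Type*} [MetricSpace X] [ProperSpace X] [MeasurableSpace X] [BorelSpace X]
  {μ : Measure X} {Q : Measure (Config X)}

open Classical in
/-- The function `∑ 1_{k injective} ∏ t_{k i} 1_{C_{k i}}(x_i)`. -/
def offDiagFun {κ : Type*} [Fintype κ] (C : κ → Set X) (t : κ → ℝ) (n : ℕ) (x : Fin n → X) : ℝ :=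
  ∑ k : Fin n → κ, (if Function.Injective k then ∏ i, t (k i) else 0) * boxFun (fun i => C (k i)) x

variable {κ : Type*} [Fintype κ] {C : κ → Set X}

theorem memLp_offDiagFun [SigmaFinite μ] (hC : ∀ i, MeasurableSet (C i)) (hμ : ∀ i, μ (C i) ≠ ⊤)
    (t : κ → ℝ) (n : ℕ) : MemLp (offDiagFun C t n) 2 (Measure.pi fun _ : Fin n => μ) :=
  memLp_finsetSum _ fun _ _ => (memLp_boxFun (fun _ => hC _) (fun _ => hμ _)).const_mul _

theorem IsPoissonMeasure.multipleIntegral_offDiagFun [IsLocallyFiniteMeasure μ]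
    (hQ : IsPoissonMeasure μ Q)
    (hC : ∀ i, MeasurableSet (C i)) (hμ : ∀ i, μ (C i) ≠ ⊤)
    (hd : Pairwise (Function.onFun Disjoint C)) (t : κ → ℝ) (n : ℕ) :
    (n.factorial : ℝ)⁻¹ • multipleIntegral μ Q n (toL2 _ (offDiagFun C t n))
      = ∑ S ∈ Finset.univ.powersetCard n,
        (∏ c ∈ S, t c) • toL2 Q fun γ => ∏ c ∈ S, compCount μ (C c) γ := by
  classical
  unfold offDiagFun
  rw [toL2_sum _ _ fun k _ => memLp_boxFun (fun i => hC _) (fun i => hμ _), map_sum,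
    inv_smul_eq_iff₀ (by positivity), Nat.cast_smul_eq_nsmul, ← sum_injective_image]
  refine Finset.sum_congr rfl fun k _ => ?_
  rw [map_smul]
  split_ifs with hk
  · rw [Finset.prod_image fun _ _ _ _ h => hk h]
    simp_rw [Finset.prod_image fun _ _ _ _ h => hk h]
    congr 1
    exact hQ.multipleIntegral_boxIndicator
      ⟨fun i => C (k i), fun i => hC _, fun i => hμ _, fun i j hij => hd (hk.ne hij)⟩
  · rw [zero_smul]

/-- The series is finite, since no injective tuple is longer than the number of sets. Its terms are
the elementary symmetric sums in the expansion of the product. -/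
theorem IsPoissonMeasure.coeFn_tsum_offDiagFun [IsLocallyFiniteMeasure μ]
    (hQ : IsPoissonMeasure μ Q)
    (hC : ∀ i, MeasurableSet (C i)) (hμ : ∀ i, μ (C i) ≠ ⊤)
    (hd : Pairwise (Function.onFun Disjoint C)) (t : κ → ℝ) :
    (∑' n : ℕ, (n.factorial : ℝ)⁻¹ • multipleIntegral μ Q n (toL2 _ (offDiagFun C t n)) : Lp ℝ 2 Q)
      =ᵐ[Q] fun γ => ∏ c, (1 + t c * compCount μ (C c) γ) := by
  classical
  simp_rw [hQ.multipleIntegral_offDiagFun hC hμ hd]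
  rw [tsum_eq_sum (s := Finset.range (Fintype.card κ + 1)) fun n hn => by
    rw [Finset.powersetCard_eq_empty.2, Finset.sum_empty]
    rw [Finset.mem_range] at hn
    rw [Finset.card_univ]
    omega]
  rw [← Finset.card_univ, ← Finset.sum_powerset, ← toL2_sum _ _ fun S _ =>
    hQ.memLp_prod_compCount hC hμ hd S]
  refine (coeFn_toL2 (memLp_finsetSum _ fun S _ =>
    (hQ.memLp_prod_compCount hC hμ hd S).const_mul _)).trans (Eventually.of_forall fun γ => ?_)
  dsimp only
  rw [Finset.prod_one_add]
  exact Finset.sum_congr rfl fun S _ => Finset.prod_mul_distrib.symm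

end Expansion

end
end InfiniteParticles

namespace InfiniteParticles

noncomputable section

/-! ### Refining step functions along dyadic cells -/

section DyadicCells

variable {X : Type*} [MetricSpace X] [ProperSpace X] [MeasurableSpace X] [BorelSpace X]
  {μ : Measure X} {Q : Measure (Config X)}

/-- The function `∑ t_i 1_{A_i}`. -/
def stepFun {X ι : Type*} [Fintype ι] (A : ι → Set X) (t : ι → ℝ) (x : X) : ℝ :=
  ∑ i, t i * (A i).indicator (fun _ => (1 : ℝ)) x

/-- The intersections of the sets `A_i` with the cells of the `M`-th dyadic partition. -/
def cellSet {ι : Type*} (A : ι → Set X) (M : ℕ) (c : ι × Fin (2 ^ M)) : Set X :=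
  A c.1 ∩ cellIdx M ⁻¹' {c.2.1}

variable {ι : Type*} {A : ι → Set X}

theorem measurableSet_cellSet (hA : ∀ i, MeasurableSet (A i)) (M : ℕ) (c : ι × Fin (2 ^ M)) :
    MeasurableSet (cellSet A M c) :=
  (hA _).inter (measurable_cellIdx M (measurableSet_singleton _))

theorem measure_cellSet_ne_top (hμ : ∀ i, μ (A i) ≠ ⊤) (M : ℕ) (c : ι × Fin (2 ^ M)) :
    μ (cellSet A M c) ≠ ⊤ :=
  ((measure_mono inter_subset_left).trans_lt (hμ c.1).lt_top).ne

theorem pairwise_disjoint_cellSet (hd : Pairwise (Function.onFun Disjoint A)) (M : ℕ) :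
    Pairwise (Function.onFun Disjoint (cellSet A M)) := by
  intro c c' h
  refine disjoint_left.2 fun x hx hx' => h ?_
  refine Prod.ext ?_ (Fin.ext (hx.2.symm.trans hx'.2))
  by_contra h'
  exact disjoint_left.1 (hd h') hx.1 hx'.1

theorem iUnion_cellSet (M : ℕ) (i : ι) :
    ⋃ j ∈ (Finset.univ : Finset (Fin (2 ^ M))), cellSet A M (i, j) = A i := by
  ext x
  simp only [Finset.mem_univ, iUnion_true, mem_iUnion]
  exact ⟨fun ⟨j, h⟩ => h.1, fun h => ⟨⟨cellIdx M x, cellIdx_lt M x⟩, h, rfl⟩⟩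

theorem sum_indicator_cellSet (M : ℕ) (i : ι) (x : X) :
    ∑ j, (cellSet A M (i, j)).indicator (fun _ => (1 : ℝ)) x
      = (A i).indicator (fun _ => (1 : ℝ)) x := by
  rw [Finset.sum_eq_single ⟨cellIdx M x, cellIdx_lt M x⟩]
  · by_cases h : x ∈ A i
    · rw [indicator_of_mem h, indicator_of_mem (show x ∈ cellSet A M (i, ⟨cellIdx M x, cellIdx_lt M x⟩) from ⟨h, rfl⟩)]
    · rw [indicator_of_notMem h, indicator_of_notMem fun h' => h h'.1]
  · intro j _ hj
    exact indicator_of_notMem (fun h => hj (Fin.ext h.2.symm)) _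
  · simp

theorem sum_measureReal_cellSet (hA : ∀ i, MeasurableSet (A i)) (hμ : ∀ i, μ (A i) ≠ ⊤)
    (hd : Pairwise (Function.onFun Disjoint A)) (M : ℕ) (i : ι) :
    ∑ j, μ.real (cellSet A M (i, j)) = μ.real (A i) := by
  have hinj : ∀ {j j' : Fin (2 ^ M)}, j ≠ j' → (i, j) ≠ (i, j') := fun h h' =>
    h (congrArg Prod.snd h')
  have h1 := measureReal_biUnion_finset (s := Finset.univ)
    (f := fun j : Fin (2 ^ M) => cellSet A M (i, j))
    (fun j _ j' _ h => pairwise_disjoint_cellSet hd M (hinj h))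
    (fun j _ => measurableSet_cellSet hA M _) (fun j _ => measure_cellSet_ne_top hμ M _)
  rw [← h1, iUnion_cellSet]

theorem sum_ncard_cellSet (hd : Pairwise (Function.onFun Disjoint A)) {γ : Config X} {i : ι}
    (hγ : (γ.1 ∩ A i).Finite) (M : ℕ) :
    ∑ j, (γ.1 ∩ cellSet A M (i, j)).ncard = (γ.1 ∩ A i).ncard := by
  have hinj : ∀ {j j' : Fin (2 ^ M)}, j ≠ j' → (i, j) ≠ (i, j') := fun h h' =>
    h (congrArg Prod.snd h')
  have h1 := (Finset.univ.finite_toSet.ncard_biUnion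
    (s := fun j : Fin (2 ^ M) => γ.1 ∩ cellSet A M (i, j))
    (fun j _ => hγ.subset (inter_subset_inter_right _ inter_subset_left)) fun j _ j' _ h =>
    (pairwise_disjoint_cellSet hd M (hinj h)).mono inter_subset_right inter_subset_right).trans
    (finsum_mem_coe_finset _ _)
  rw [← h1]
  congr 1
  have h2 := iUnion_cellSet (A := A) M i
  simp only [Finset.mem_univ, iUnion_true] at h2
  simp only [Finset.coe_univ, mem_univ, iUnion_true]
  rw [← inter_iUnion, h2]

/-- The sum is at most the product measure of the pairs lying in a common cell. Distinct points are
eventually separated and the diagonal is null. -/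
theorem tendsto_sum_measureReal_cellSet_sq [NullSingletonClass μ]
    (hμ : ∀ i, μ (A i) ≠ ⊤) (i : ι) :
    Tendsto (fun M => ∑ j, μ.real (cellSet A M (i, j)) ^ 2) atTop (𝓝 0) := by
  set ρ := μ.restrict (A i) with hρ
  have : IsFiniteMeasure ρ := isFiniteMeasure_restrict.2 (hμ i)
  set D : ℕ → Set (X × X) := fun M => {q | cellIdx M q.1 = cellIdx M q.2} with hD
  have hDm : ∀ M, MeasurableSet (D M) := fun M =>
    measurableSet_eq_fun ((measurable_cellIdx M).comp measurable_fst)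
      ((measurable_cellIdx M).comp measurable_snd)
  have h1 : ∀ M, ∑ j, μ.real (cellSet A M (i, j)) ^ 2 ≤ (ρ.prod ρ).real (D M) := by
    intro M
    have h2 : ∀ j, μ.real (cellSet A M (i, j)) ^ 2
        = (ρ.prod ρ).real ((cellIdx M ⁻¹' {j.1}) ×ˢ (cellIdx M ⁻¹' {j.1})) := by
      intro j
      rw [measureReal_prod_prod, sq, hρ, measureReal_restrict_apply
        (measurable_cellIdx M (measurableSet_singleton _)), inter_comm]
      rfl
    simp_rw [h2]
    rw [← measureReal_biUnion_finset]
    · refine measureReal_mono ?_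
      refine iUnion₂_subset fun j _ => ?_
      rintro ⟨x, y⟩ ⟨hx, hy⟩
      exact hx.trans hy.symm
    · intro j _ j' _ h
      refine disjoint_left.2 fun q hq hq' => h ?_
      exact Fin.ext (hq.1.symm.trans hq'.1)
    · intro j _
      exact (measurable_cellIdx M (measurableSet_singleton _)).prod
        (measurable_cellIdx M (measurableSet_singleton _))
  have h0 : (ρ.prod ρ) {q : X × X | q.1 = q.2} = 0 := by
    rw [Measure.measure_prod_null (measurableSet_eq_fun measurable_fst measurable_snd)]
    refine Eventually.of_forall fun x => ?_
    have : Prod.mk x ⁻¹' {q : X × X | q.1 = q.2} = {x} := by ext y; simp [eq_comm]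
    refine (congrArg ρ this).trans ?_
    exact le_antisymm ((Measure.restrict_apply_le _ _).trans (measure_singleton x).le) zero_le
  have h3 : Tendsto (fun M => (ρ.prod ρ) (D M)) atTop (𝓝 ((ρ.prod ρ) ∅)) := by
    refine tendsto_measure_of_ae_tendsto_indicator_of_isFiniteMeasure (μ := ρ.prod ρ) atTop
      MeasurableSet.empty hDm ?_
    filter_upwards [measure_eq_zero_iff_ae_notMem.1 h0] with q hq
    filter_upwards [eventually_cellIdx_ne (x := q.1) (y := q.2) hq] with M hM
    simpa [hD] using hM
  have h4 : Tendsto (fun M => (ρ.prod ρ).real (D M)) atTop (𝓝 0) := by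
    have := (ENNReal.tendsto_toReal (by simp)).comp h3
    rw [measure_empty] at this
    exact this
  exact squeeze_zero (fun M => Finset.sum_nonneg fun j _ => sq_nonneg _) h1 h4

/-- Squeeze each factor by `exp(u - u²) ≤ 1 + u ≤ exp(u)` for `u ≥ 0`. The lower bound comes from
`(1 + u)(1 - u + u²) = 1 + u³`. -/
theorem tendsto_prod_one_add_of_sum_sq {κ : ℕ → Type*} [∀ M, Fintype (κ M)]
    {u : ∀ M, κ M → ℝ} (hu : ∀ M c, 0 ≤ u M c) {a : ℝ} (ha : ∀ M, ∑ c, u M c = a)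
    (h : Tendsto (fun M => ∑ c, u M c ^ 2) atTop (𝓝 0)) :
    Tendsto (fun M => ∏ c, (1 + u M c)) atTop (𝓝 (Real.exp a)) := by
  have h1 : Tendsto (fun M => Real.exp (a - ∑ c, u M c ^ 2)) atTop (𝓝 (Real.exp a)) := by
    have := (h.const_sub a).rexp
    simpa using this
  refine tendsto_of_tendsto_of_tendsto_of_le_of_le h1 tendsto_const_nhds (fun M => ?_) fun M => ?_
  · dsimp only
    rw [← ha M, ← Finset.sum_sub_distrib, Real.exp_sum]
    refine Finset.prod_le_prod (fun c _ => (Real.exp_pos _).le) fun c _ => ?_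
    have h2 := Real.add_one_le_exp (-(u M c - u M c ^ 2))
    have h3 := hu M c
    rw [Real.exp_neg] at h2
    have h4 : 0 < Real.exp (u M c - u M c ^ 2) := Real.exp_pos _
    have h5 : (1 - u M c + u M c ^ 2) * Real.exp (u M c - u M c ^ 2) ≤ 1 := by
      rw [← le_div_iff₀ h4, one_div]
      linarith
    have h6 : 1 ≤ (1 + u M c) * (1 - u M c + u M c ^ 2) := by nlinarith [pow_nonneg h3 3]
    nlinarith [mul_le_mul_of_nonneg_right h6 h4.le]
  · dsimp only
    rw [← ha M, Real.exp_sum]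
    refine Finset.prod_le_prod (fun c _ => by linarith [hu M c]) fun c _ => ?_
    linarith [Real.add_one_le_exp (u M c)]

variable [Fintype ι] (t : ι → ℝ)

theorem sum_mul_indicator_cellSet (M : ℕ) (x : X) :
    ∑ c : ι × Fin (2 ^ M), t c.1 * (cellSet A M c).indicator (fun _ => (1 : ℝ)) x
      = stepFun A t x := by
  rw [Fintype.sum_prod_type, stepFun]
  refine Finset.sum_congr rfl fun i _ => ?_
  dsimp only
  rw [← Finset.mul_sum, sum_indicator_cellSet]

omit [ProperSpace X] [BorelSpace X] [MetricSpace X] in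
theorem memLp_stepFun {X : Type*} [MeasurableSpace X] {μ : Measure X} {A : ι → Set X}
    (hA : ∀ i, MeasurableSet (A i)) (hμ : ∀ i, μ (A i) ≠ ⊤) (t : ι → ℝ) :
    MemLp (stepFun A t) 2 μ :=
  memLp_finsetSum _ fun i _ =>
    (memLp_indicator_const 2 (hA i) (1 : ℝ) (Or.inr (hμ i))).const_mul _

theorem prod_stepFun_eq_sum (M n : ℕ) (x : Fin n → X) :
    ∏ i, stepFun A t (x i) = ∑ k : Fin n → ι × Fin (2 ^ M),
      (∏ i, t (k i).1) * boxFun (fun i => cellSet A M (k i)) x := by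
  simp_rw [← sum_mul_indicator_cellSet t M]
  rw [Finset.prod_univ_sum, Fintype.piFinset_univ]
  exact Finset.sum_congr rfl fun k _ => Finset.prod_mul_distrib

/-- When the coordinates occupy different cells, the terms dropped from the expansion of the tensor
power vanish anyway. -/
theorem offDiagFun_cellSet_eq {M n : ℕ} {x : Fin n → X}
    (hx : Function.Injective fun i => cellIdx M (x i)) :
    offDiagFun (cellSet A M) (fun c => t c.1) n x = ∏ i, stepFun A t (x i) := by
  rw [prod_stepFun_eq_sum t M, offDiagFun]
  refine Finset.sum_congr rfl fun k _ => ?_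
  split_ifs with hk
  · rfl
  · rw [zero_mul]
    symm
    simp only [Function.Injective, not_forall] at hk
    obtain ⟨i, j, hij, hne⟩ := hk
    refine mul_eq_zero_of_right _ ?_
    by_cases hi : x i ∈ cellSet A M (k i)
    · refine Finset.prod_eq_zero (Finset.mem_univ j) (indicator_of_notMem (fun hj => hne ?_) _)
      refine hx (hi.2.trans ?_)
      rw [hij]
      exact hj.2.symm
    · exact Finset.prod_eq_zero (Finset.mem_univ i) (indicator_of_notMem hi _)

theorem abs_offDiagFun_cellSet_le (M n : ℕ) (x : Fin n → X) :
    |offDiagFun (cellSet A M) (fun c => t c.1) n x| ≤ ∏ i, stepFun A (fun i => |t i|) (x i) := by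
  rw [prod_stepFun_eq_sum _ M, offDiagFun]
  refine (Finset.abs_sum_le_sum_abs _ _).trans (Finset.sum_le_sum fun k _ => ?_)
  have h0 : 0 ≤ boxFun (fun i => cellSet A M (k i)) x := by
    rcases boxFun_eq_zero_or_one (fun i => cellSet A M (k i)) x with h | h <;> simp [h]
  rw [abs_mul, abs_of_nonneg h0, ← Finset.abs_prod]
  refine mul_le_mul_of_nonneg_right ?_ h0
  split_ifs
  · rfl
  · rw [abs_zero]; exact abs_nonneg _

/-- Almost every point has distinct coordinates, so the approximation is eventually exact there; the
tensor power of `∑ |t_i| 1_{A_i}` dominates. -/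
theorem tendsto_offDiagFun_cellSet [SigmaFinite μ] [NullSingletonClass μ]
    (hA : ∀ i, MeasurableSet (A i)) (hμ : ∀ i, μ (A i) ≠ ⊤) (n : ℕ) :
    Tendsto (fun M => toL2 (Measure.pi fun _ : Fin n => μ)
        (offDiagFun (cellSet A M) (fun c => t c.1) n)) atTop
      (𝓝 (tensorPower μ n (toL2 μ (stepFun A t)))) := by
  refine tendsto_Lp_of_dominated (f := fun M => offDiagFun (cellSet A M) (fun c => t c.1) n)
    (g := fun x => ∏ i, stepFun A t (x i)) (b := fun x => ∏ i, stepFun A (fun i => |t i|) (x i))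
    (fun M => coeFn_toL2 (memLp_offDiagFun (measurableSet_cellSet hA M)
      (measure_cellSet_ne_top hμ M) _ n))
    (coeFn_tensorPower (coeFn_toL2 (memLp_stepFun hA hμ t)))
    (memLp_prod_pi fun _ => memLp_stepFun hA hμ _)
    (fun M => Eventually.of_forall fun x => abs_offDiagFun_cellSet_le t M n x) ?_
  filter_upwards [ae_injective_pi (μ := μ)] with x hx
  refine tendsto_const_nhds.congr' ?_
  filter_upwards [eventually_injOn_cellIdx (finite_range x)] with M hM
  exact (offDiagFun_cellSet_eq t fun i j hij =>
    hx (hM (mem_range_self i) (mem_range_self j) hij)).symm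

theorem norm_offDiagFun_cellSet_le [SigmaFinite μ]
    (hA : ∀ i, MeasurableSet (A i)) (hμ : ∀ i, μ (A i) ≠ ⊤) (M n : ℕ) :
    ‖toL2 (Measure.pi fun _ : Fin n => μ) (offDiagFun (cellSet A M) (fun c => t c.1) n)‖
      ≤ ‖toL2 μ (stepFun A fun i => |t i|)‖ ^ n := by
  rw [← norm_tensorPower]
  refine Lp.norm_le_norm_of_ae_le ?_
  filter_upwards [coeFn_toL2 (memLp_offDiagFun (μ := μ) (measurableSet_cellSet hA M)
      (measure_cellSet_ne_top hμ M) (fun c => t c.1) n),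
    coeFn_tensorPower (n := n) (coeFn_toL2 (memLp_stepFun hA hμ fun i => |t i|))] with x h1 h2
  rw [h1, h2]
  exact (abs_offDiagFun_cellSet_le t M n x).trans (le_abs_self _)

end DyadicCells

/-! ### Exponential vectors of step functions -/

section ExponentialOfStep

variable {X : Type*} [MetricSpace X] [ProperSpace X] [MeasurableSpace X] [BorelSpace X]
  {μ : Measure X} [IsLocallyFiniteMeasure μ] {Q : Measure (Config X)}

/-- The mixed moment of the two products equals the second moment of the first, so the squared
distance is the difference of the second moments. -/
theorem IsPoissonMeasure.integral_prod_sub_tilt_sq (hQ : IsPoissonMeasure μ Q)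
    {κ : Type*} [Fintype κ] {C : κ → Set X} (hC : ∀ i, MeasurableSet (C i))
    (hμ : ∀ i, μ (C i) ≠ ⊤) (hd : Pairwise (Function.onFun Disjoint C)) (t : κ → ℝ) :
    ∫ γ, (∏ c, (1 + t c * compCount μ (C c) γ)
        - ∏ c, poissonTilt (μ.real (C c)) (t c) (γ.1 ∩ C c).ncard) ^ 2 ∂Q
      = Real.exp (∑ c, t c ^ 2 * μ.real (C c)) - ∏ c, (1 + t c ^ 2 * μ.real (C c)) := by
  set g : κ → ℕ → ℝ := fun c n => 1 + t c * ((n : ℝ) - μ.real (C c)) with hg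
  set w : κ → ℕ → ℝ := fun c n => poissonTilt (μ.real (C c)) (t c) n with hw
  have e : ∀ γ : Config X, (∏ c, (1 + t c * compCount μ (C c) γ)
        - ∏ c, poissonTilt (μ.real (C c)) (t c) (γ.1 ∩ C c).ncard) ^ 2
      = ∏ c, g c (γ.1 ∩ C c).ncard ^ 2
        - 2 * ∏ c, g c (γ.1 ∩ C c).ncard * w c (γ.1 ∩ C c).ncard
        + ∏ c, w c (γ.1 ∩ C c).ncard ^ 2 := by
    intro γ
    rw [Finset.prod_pow, Finset.prod_pow, Finset.prod_mul_distrib]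
    simp only [hg, hw, compCount]
    ring
  simp_rw [e]
  have i1 := hQ.integrable_prod_comp_ncard hC hμ hd (fun c n => g c n ^ 2)
    fun c => hQ.integrable_comp_ncard (hC c) (hμ c) (integrable_one_add_sq_poissonMeasure _ (t c))
  have i2 := hQ.integrable_prod_comp_ncard hC hμ hd (fun c n => g c n * w c n)
    fun c => hQ.integrable_comp_ncard (hC c) (hμ c) (integrable_one_add_mul_poissonTilt _ (t c))
  have i3 := hQ.integrable_prod_comp_ncard hC hμ hd (fun c n => w c n ^ 2)
    fun c => hQ.integrable_comp_ncard (hC c) (hμ c) (integrable_poissonTilt_sq _ (t c))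
  have j1 : ∫ γ : Config X, ∏ c, g c (γ.1 ∩ C c).ncard ^ 2 ∂Q
      = ∏ c, (1 + t c ^ 2 * μ.real (C c)) := by
    rw [hQ.integral_prod_comp_ncard hC hμ hd fun c n => g c n ^ 2]
    exact Finset.prod_congr rfl fun c _ => (hQ.integral_comp_ncard (hC c) (hμ c) _).trans
      (integral_one_add_sq_poissonMeasure _ (t c))
  have j2 : ∫ γ : Config X, ∏ c, g c (γ.1 ∩ C c).ncard * w c (γ.1 ∩ C c).ncard ∂Q
      = ∏ c, (1 + t c ^ 2 * μ.real (C c)) := by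
    rw [hQ.integral_prod_comp_ncard hC hμ hd fun c n => g c n * w c n]
    exact Finset.prod_congr rfl fun c _ => (hQ.integral_comp_ncard (hC c) (hμ c)
      fun n => g c n * w c n).trans (integral_one_add_mul_poissonTilt _ (t c))
  have j3 : ∫ γ : Config X, ∏ c, w c (γ.1 ∩ C c).ncard ^ 2 ∂Q
      = Real.exp (∑ c, t c ^ 2 * μ.real (C c)) := by
    rw [hQ.integral_prod_comp_ncard hC hμ hd fun c n => w c n ^ 2, Real.exp_sum]
    exact Finset.prod_congr rfl fun c _ => (hQ.integral_comp_ncard (hC c) (hμ c) _).trans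
      (integral_poissonTilt_sq _ (t c))
  have i4 : Integrable (fun γ : Config X => ∏ c, g c (γ.1 ∩ C c).ncard ^ 2
      - 2 * ∏ c, g c (γ.1 ∩ C c).ncard * w c (γ.1 ∩ C c).ncard) Q := i1.sub (i2.const_mul 2)
  rw [integral_add i4 i3, integral_sub i1 (i2.const_mul 2), integral_const_mul, j1, j2, j3]
  ring

/-- The exponential vector of a step function. -/
theorem IsPoissonMeasure.coeFn_expVector_stepFun (hQ : IsPoissonMeasure μ Q)
    {ι : Type*} [Fintype ι] {A : ι → Set X} (hA : ∀ i, MeasurableSet (A i))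
    (hμ : ∀ i, μ (A i) ≠ ⊤) (hd : Pairwise (Function.onFun Disjoint A)) (t : ι → ℝ) :
    expVector μ Q (toL2 μ (stepFun A t))
      =ᵐ[Q] fun γ => ∏ i, poissonTilt (μ.real (A i)) (t i) (γ.1 ∩ A i).ncard := by
  have := hQ.nullSingletonClass
  -- `P M` is the exponential series with off-diagonal kernels on the `M`-th cells. It converges to
  -- the exponential vector, and also to the tilt `W`: refinement does not change `W`, and the
  -- squared distance tends to zero with the squares of the cell measures.
  set P : ℕ → Lp ℝ 2 Q := fun M => ∑' n : ℕ, (n.factorial : ℝ)⁻¹ • multipleIntegral μ Q n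
    (toL2 _ (offDiagFun (cellSet A M) (fun c => t c.1) n)) with hP
  have hlim : Tendsto P atTop (𝓝 (expVector μ Q (toL2 μ (stepFun A t)))) :=
    hQ.tendsto_tsum_multipleIntegral (norm_nonneg _)
      (fun M n => norm_offDiagFun_cellSet_le t hA hμ M n)
      (fun n => tendsto_offDiagFun_cellSet t hA hμ n)
  have hm := fun M => measurableSet_cellSet (M := M) hA
  have hfin := fun M => measure_cellSet_ne_top (M := M) hμ
  have hdis := fun M => pairwise_disjoint_cellSet (M := M) hd
  set W : Config X → ℝ := fun γ => ∏ i, poissonTilt (μ.real (A i)) (t i) (γ.1 ∩ A i).ncard with hW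
  have hWM : ∀ M, ∀ᵐ γ ∂Q, W γ = ∏ c, poissonTilt (μ.real (cellSet A M c)) (t c.1)
      (γ.1 ∩ cellSet A M c).ncard := by
    intro M
    filter_upwards [ae_all_iff.2 fun i => hQ.ae_finite_inter (hA i) (hμ i)] with γ hγ
    rw [Fintype.prod_prod_type]
    refine Finset.prod_congr rfl fun i _ => ?_
    unfold poissonTilt
    dsimp only
    rw [Finset.prod_mul_distrib, Finset.prod_pow_eq_pow_sum, sum_ncard_cellSet hd (hγ i),
      ← Real.exp_sum, Finset.sum_neg_distrib, ← Finset.mul_sum,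
      sum_measureReal_cellSet hA hμ hd]
  have hWm : MemLp W 2 Q := by
    have hWme : Measurable W := Finset.measurable_fun_prod _ fun i _ =>
      (Measurable.of_discrete (f := poissonTilt (μ.real (A i)) (t i))).comp
        (measurable_ncard_inter (hA i))
    rw [memLp_two_iff_integrable_sq hWme.aestronglyMeasurable]
    simp_rw [hW, ← Finset.prod_pow]
    exact hQ.integrable_prod_comp_ncard hA hμ hd (fun c n => poissonTilt (μ.real (A c)) (t c) n ^ 2)
      fun c => hQ.integrable_comp_ncard (hA c) (hμ c) (integrable_poissonTilt_sq _ (t c))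
  set a : ℝ := ∑ i, t i ^ 2 * μ.real (A i) with ha
  have haM : ∀ M, ∑ c : ι × Fin (2 ^ M), t c.1 ^ 2 * μ.real (cellSet A M c) = a := by
    intro M
    rw [Fintype.sum_prod_type]
    refine Finset.sum_congr rfl fun i _ => ?_
    dsimp only
    rw [← Finset.mul_sum, sum_measureReal_cellSet hA hμ hd]
  have hnorm : ∀ M, ‖P M - toL2 Q W‖ ^ 2
      = Real.exp a - ∏ c : ι × Fin (2 ^ M), (1 + t c.1 ^ 2 * μ.real (cellSet A M c)) := by
    intro M
    rw [← haM M, ← hQ.integral_prod_sub_tilt_sq (hm M) (hfin M) (hdis M) fun c => t c.1]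
    refine norm_sq_eq_integral_of_ae_eq ?_
    filter_upwards [Lp.coeFn_sub (P M) (toL2 Q W), coeFn_toL2 hWm, hWM M,
      hQ.coeFn_tsum_offDiagFun (hm M) (hfin M) (hdis M) fun c => t c.1] with γ h1 h2 h3 h4
    rw [h1, Pi.sub_apply, h2, h3, h4]
  have hprod : Tendsto (fun M => ∏ c : ι × Fin (2 ^ M), (1 + t c.1 ^ 2 * μ.real (cellSet A M c)))
      atTop (𝓝 (Real.exp a)) := by
    refine tendsto_prod_one_add_of_sum_sq (fun M c => by positivity) haM ?_
    have h1 : ∀ M, ∑ c : ι × Fin (2 ^ M), (t c.1 ^ 2 * μ.real (cellSet A M c)) ^ 2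
        = ∑ i, t i ^ 4 * ∑ j, μ.real (cellSet A M (i, j)) ^ 2 := by
      intro M
      rw [Fintype.sum_prod_type]
      refine Finset.sum_congr rfl fun i _ => ?_
      rw [Finset.mul_sum]
      exact Finset.sum_congr rfl fun j _ => by ring
    simp_rw [h1]
    have := tendsto_finsetSum (Finset.univ : Finset ι) fun i _ =>
      (tendsto_sum_measureReal_cellSet_sq hμ i).const_mul (t i ^ 4)
    simpa using this
  have hlim2 : Tendsto P atTop (𝓝 (toL2 Q W)) := by
    rw [tendsto_iff_norm_sub_tendsto_zero]
    have h1 : Tendsto (fun M => ‖P M - toL2 Q W‖ ^ 2) atTop (𝓝 0) := by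
      simp_rw [hnorm]
      simpa using hprod.const_sub (Real.exp a)
    simpa [Real.sqrt_sq (norm_nonneg _)] using h1.sqrt
  rw [tendsto_nhds_unique hlim hlim2]
  exact coeFn_toL2 hWm

end ExponentialOfStep

end
end InfiniteParticles

namespace InfiniteParticles

noncomputable section

/-! ### The functional `∏ (1 - h)` on configurations -/

section AvoidanceFunctional

variable {X : Type*} [MetricSpace X]

/-- The functional `∏_{x ∈ γ} (1 - h x)`. -/
def avoidFun (h : X → ℝ≥0∞) (γ : Config X) : ℝ≥0∞ :=
  ⨅ s : Finset γ.1, ∏ x ∈ s, (1 - h x.1)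

theorem avoidFun_le_one (h : X → ℝ≥0∞) (γ : Config X) : avoidFun h γ ≤ 1 :=
  (iInf_le _ ∅).trans_eq (by simp)

/-- The factors are at most 1, so infima over finite subsets and over initial segments agree. The
infimum definition thus gives an infinite product that needs neither an ordering nor a convergence
condition. -/
theorem IsNumeration.avoidFun_eq {x : ℕ → X} {γ : Config X} (hx : IsNumeration x γ)
    (h : X → ℝ≥0∞) : avoidFun h γ = ⨅ n : ℕ, ∏ i ∈ Finset.range n, (1 - h (x i)) := by
  let e : ℕ ≃ γ.1 := (Equiv.ofInjective x hx.1).trans (Equiv.setCongr hx.2)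
  have he : ∀ i, (e i).1 = x i := fun i => rfl
  refine le_antisymm (le_iInf fun n => ?_) (le_iInf fun s => ?_)
  · refine (iInf_le _ ((Finset.range n).map e.toEmbedding)).trans_eq ?_
    rw [Finset.prod_map]
    rfl
  · obtain ⟨n, hn⟩ := (s.map e.symm.toEmbedding).exists_nat_subset_range
    refine (iInf_le _ n).trans ((Finset.prod_le_prod_of_subset_of_le_one' hn fun i _ _ =>
      tsub_le_self).trans_eq ?_)
    rw [Finset.prod_map]
    refine Finset.prod_congr rfl fun y _ => ?_
    rw [← he, Equiv.coe_toEmbedding, Equiv.apply_symm_apply]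

theorem avoidFun_voidEvent {A : Set X} (γ : Config X) :
    avoidFun (A.indicator 1) γ = (voidEvent A).indicator 1 γ := by
  by_cases h : γ ∈ voidEvent A
  · rw [indicator_of_mem h]
    have h' : γ.1 ∩ A = ∅ := h
    have h1 : ∀ x : γ.1, (1 : ℝ≥0∞) - A.indicator 1 x.1 = 1 := fun x => by
      rw [indicator_of_notMem fun hx => (h' ▸ (⟨x.2, hx⟩ : x.1 ∈ γ.1 ∩ A) : x.1 ∈ (∅ : Set X)),
        tsub_zero]
    simp [avoidFun, h1]
  · rw [indicator_of_notMem h]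
    obtain ⟨x, hx, hxA⟩ : (γ.1 ∩ A).Nonempty := nonempty_iff_ne_empty.2 h
    refine le_antisymm ((iInf_le _ {⟨x, hx⟩}).trans_eq ?_) zero_le
    simp [hxA]

theorem avoidFun_eq_iInf_of_iSup {h : X → ℝ≥0∞} {g : ℕ → X → ℝ≥0∞} (hg : Monotone g)
    (hh : ∀ x, ⨆ k, g k x = h x) (γ : Config X) : avoidFun h γ = ⨅ k, avoidFun (g k) γ := by
  unfold avoidFun
  rw [iInf_comm]
  refine iInf_congr fun s => ?_
  have hanti : Antitone fun k => ∏ x ∈ s, (1 - g k x.1) := fun i j hij =>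
    Finset.prod_le_prod' fun x _ => tsub_le_tsub_left (hg hij x.1) 1
  refine tendsto_nhds_unique ?_ (tendsto_atTop_iInf hanti)
  refine ENNReal.tendsto_finsetProd_of_ne_top s (fun x _ => ?_)
    fun x _ => (tsub_le_self.trans_lt ENNReal.one_lt_top).ne
  refine ENNReal.Tendsto.sub tendsto_const_nhds ?_ (Or.inl ENNReal.one_ne_top)
  rw [← hh]
  exact tendsto_atTop_iSup fun i j hij => hg hij x.1

theorem antitone_avoidFun {g h : X → ℝ≥0∞} (hgh : g ≤ h) (γ : Config X) :
    avoidFun h γ ≤ avoidFun g γ :=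
  iInf_mono fun _ => Finset.prod_le_prod' fun x _ => tsub_le_tsub_left (hgh x.1) 1

theorem avoidFun_eq_prod_of_subset {h : X → ℝ≥0∞} {γ : Config X} (s : Finset γ.1)
    (hs : ∀ x : γ.1, x ∉ s → h x.1 = 0) : avoidFun h γ = ∏ x ∈ s, (1 - h x.1) := by
  classical
  refine le_antisymm (iInf_le _ s) (le_iInf fun s' => ?_)
  calc ∏ x ∈ s, (1 - h x.1) = ∏ x ∈ s ∪ s', (1 - h x.1) :=
        Finset.prod_subset Finset.subset_union_left fun x _ hx => by rw [hs x hx, tsub_zero]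
    _ ≤ ∏ x ∈ s', (1 - h x.1) :=
        Finset.prod_le_prod_of_subset_of_le_one' Finset.subset_union_right fun _ _ _ => tsub_le_self

/-- Grouping the finitely many relevant points by the value of `h` produces the powers that occur in
`poissonTilt`. -/
theorem toReal_avoidFun_of_sum_indicator {ι : Type*} [Fintype ι] {A : ι → Set X} {t : ι → ℝ≥0∞}
    (ht : ∀ i, t i ≤ 1) (hd : Pairwise (Function.onFun Disjoint A)) {h : X → ℝ≥0∞}
    (hA : ∀ i, ∀ x ∈ A i, h x = t i) (h0 : ∀ x, (∀ i, x ∉ A i) → h x = 0) {γ : Config X}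
    (hγ : ∀ i, (γ.1 ∩ A i).Finite) :
    (avoidFun h γ).toReal = ∏ i, (1 - (t i).toReal) ^ (γ.1 ∩ A i).ncard := by
  classical
  have hfin : (Subtype.val ⁻¹' (⋃ i, A i) : Set γ.1).Finite := by
    refine Finite.of_finite_image ?_ Subtype.val_injective.injOn
    refine (finite_iUnion hγ).subset ?_
    rintro _ ⟨x, hx, rfl⟩
    obtain ⟨i, hi⟩ := mem_iUnion.1 hx
    exact mem_iUnion.2 ⟨i, x.2, hi⟩
  rw [avoidFun_eq_prod_of_subset hfin.toFinset fun x hx => h0 _ fun i hi => hx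
    (hfin.mem_toFinset.2 (mem_iUnion.2 ⟨i, hi⟩))]
  have h1 : ∀ x ∈ hfin.toFinset, (1 : ℝ≥0∞) - h x.1
      = ∏ i, if x.1 ∈ A i then 1 - t i else 1 := by
    intro x hx
    obtain ⟨i, hi⟩ := mem_iUnion.1 (hfin.mem_toFinset.1 hx)
    rw [Finset.prod_eq_single i]
    · rw [if_pos hi, hA i _ hi]
    · intro j _ hj
      rw [if_neg fun h' => disjoint_left.1 (hd hj) h' hi]
    · simp
  rw [Finset.prod_congr rfl h1, Finset.prod_comm, ENNReal.toReal_prod]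
  refine Finset.prod_congr rfl fun i _ => ?_
  rw [Finset.prod_ite, Finset.prod_const, Finset.prod_const_one, mul_one, ENNReal.toReal_pow,
    ENNReal.toReal_sub_of_le (ht i) ENNReal.one_ne_top, ENNReal.toReal_one]
  congr 1
  rw [← Set.ncard_coe_finset, ← Set.ncard_image_of_injective _ Subtype.val_injective]
  congr 1
  ext x
  simp only [Finset.coe_filter, Finite.mem_toFinset, mem_image, Subtype.exists, exists_and_right,
    exists_eq_right]
  constructor
  · rintro ⟨hx, _, hi⟩
    exact ⟨hx, hi⟩
  · rintro ⟨hx, hi⟩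
    exact ⟨hx, mem_iUnion.2 ⟨i, hi⟩, hi⟩

variable [ProperSpace X] [MeasurableSpace X] [BorelSpace X]

theorem measurable_avoidFun {h : X → ℝ≥0∞} (hh : Measurable h) : Measurable (avoidFun h) := by
  rcases isEmpty_or_nonempty (Config X) with he | ⟨⟨γ₀⟩⟩
  · exact measurable_of_empty _
  obtain ⟨o, -⟩ := γ₀.2.1.nonempty
  have : avoidFun h = fun γ => ⨅ n : ℕ, ∏ i ∈ Finset.range n, (1 - h (enum o γ i)) :=
    funext fun γ => (isNumeration_enum o γ).avoidFun_eq h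
  rw [this]
  exact Measurable.iInf fun n => Finset.measurable_fun_prod _ fun i _ =>
    measurable_const.sub (hh.comp (measurable_enum o i))

/-- Independence evaluates the finite products; monotone convergence for decreasing functions,
applied to integrands bounded by 1, passes to the infimum. -/
theorem lintegral_avoidFun_map_toConfig (κ : Kernel X X) [IsMarkovKernel κ] {h : X → ℝ≥0∞}
    (hh : Measurable h) (h1 : ∀ x, h x ≤ 1) {γ γ₀ : Config X} {x : ℕ → X} (hx : IsNumeration x γ)
    (hgood : ∀ᵐ y ∂(seqKernel κ x), y ∈ goodSeq X) :
    ∫⁻ ξ, avoidFun h ξ ∂((seqKernel κ x).map (toConfig γ₀))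
      = avoidFun (fun y => ∫⁻ u, h u ∂(κ y)) γ := by
  rw [lintegral_map (measurable_avoidFun hh) (measurable_toConfig γ₀), hx.avoidFun_eq]
  have e1 : ∫⁻ y, avoidFun h (toConfig γ₀ y) ∂(seqKernel κ x)
      = ∫⁻ y, ⨅ n : ℕ, ∏ i ∈ Finset.range n, (1 - h (y i)) ∂(seqKernel κ x) :=
    lintegral_congr_ae (hgood.mono fun y hy => (isNumeration_toConfig γ₀ hy).avoidFun_eq h)
  have e2 : ∀ n, Measurable fun y : ℕ → X => ∏ i ∈ Finset.range n, (1 - h (y i)) := fun n =>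
    Finset.measurable_fun_prod _ fun i _ =>
      measurable_const.sub (hh.comp (measurable_pi_apply i))
  rw [e1, lintegral_iInf e2]
  · congr 1
    ext n
    rw [seqKernel_apply, lintegral_prod_infinitePi (fun n => κ (x n)) (Finset.range n)
      (f := fun _ u => 1 - h u) fun _ => measurable_const.sub hh]
    refine Finset.prod_congr rfl fun i _ => ?_
    have hle : ∫⁻ u, h u ∂(κ (x i)) ≤ 1 := (lintegral_mono h1).trans_eq (by simp)
    rw [lintegral_sub hh (hle.trans_lt ENNReal.one_lt_top).ne (Eventually.of_forall h1)]
    simp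
  · intro n n' hn y
    exact Finset.prod_le_prod_of_subset_of_le_one' (Finset.range_mono hn) fun _ _ _ => tsub_le_self
  · simp

end AvoidanceFunctional

/-! ### Exponential vectors of negative functions -/

section ExponentialVectors

variable {X : Type*} [MetricSpace X] [ProperSpace X] [MeasurableSpace X] [BorelSpace X]
  {μ : Measure X} [IsLocallyFiniteMeasure μ] {Q : Measure (Config X)}

theorem memLp_toReal_of_le_one {S : Type*} [MeasurableSpace S] {ν : Measure S} {h : S → ℝ≥0∞}
    (hh : Measurable h) (h1 : ∀ x, h x ≤ 1) (hi : ∫⁻ x, h x ∂ν ≠ ⊤) :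
    MemLp (fun x => (h x).toReal) 2 ν := by
  rw [memLp_two_iff_integrable_sq hh.ennreal_toReal.aestronglyMeasurable]
  refine (integrable_toReal_of_lintegral_ne_top hh.aemeasurable hi).mono
    (hh.ennreal_toReal.pow_const 2).aestronglyMeasurable (Eventually.of_forall fun x => ?_)
  have h2 : (h x).toReal ≤ 1 := ENNReal.toReal_mono ENNReal.one_ne_top (h1 x)
  have h3 : 0 ≤ (h x).toReal := ENNReal.toReal_nonneg
  rw [Real.norm_of_nonneg (sq_nonneg _), Real.norm_of_nonneg h3]
  nlinarith

/-- Decompose `h` along its nonzero values `v`, whose level sets have finite measure by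
integrability, and take `t = -v` in the formula for step functions. The factors `exp(v * μ(A))`
combine to `exp(∫ h)`. -/
theorem IsPoissonMeasure.coeFn_expVector_simpleFunc (hQ : IsPoissonMeasure μ Q)
    (h : SimpleFunc X ℝ≥0∞) (h1 : ∀ x, h x ≤ 1) (hi : ∫⁻ x, h x ∂μ ≠ ⊤) :
    expVector μ Q (-toL2 μ fun x => (h x).toReal)
      =ᵐ[Q] fun γ => Real.exp (∫⁻ x, h x ∂μ).toReal * (avoidFun h γ).toReal := by
  classical
  let ι := {v // v ∈ h.range.filter (· ≠ 0)}
  let : Fintype ι := Finset.Subtype.fintype _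
  set A : ι → Set X := fun v => h ⁻¹' {v.1} with hAdef
  have hA : ∀ i, MeasurableSet (A i) := fun i => h.measurableSet_preimage _
  have hv0 : ∀ i : ι, i.1 ≠ 0 := fun i => (Finset.mem_filter.1 i.2).2
  have hv1 : ∀ i : ι, i.1 ≤ 1 := fun i => by
    obtain ⟨x, hx⟩ := SimpleFunc.mem_range.1 (Finset.mem_filter.1 i.2).1
    exact hx ▸ h1 x
  have hvt : ∀ i : ι, i.1 ≠ ⊤ := fun i => ((hv1 i).trans_lt ENNReal.one_lt_top).ne
  have hlin : ∫⁻ x, h x ∂μ = ∑ i : ι, i.1 * μ (A i) := by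
    rw [SimpleFunc.lintegral_eq_lintegral, SimpleFunc.lintegral,
      ← Finset.sum_filter_of_ne (p := (· ≠ 0)) fun v _ hv h0 => hv (by rw [h0, zero_mul])]
    exact (Finset.sum_coe_sort (h.range.filter (· ≠ 0)) fun v => v * μ (h ⁻¹' {v})).symm
  have hμ : ∀ i, μ (A i) ≠ ⊤ := by
    intro i hi'
    refine hi ?_
    rw [hlin]
    refine ENNReal.sum_eq_top.2 ⟨i, Finset.mem_univ _, ?_⟩
    rw [hi', ENNReal.mul_top (hv0 i)]
  have hd : Pairwise (Function.onFun Disjoint A) := fun i j hij =>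
    disjoint_left.2 fun x hx hx' => hij (Subtype.ext (hx.symm.trans hx'))
  have hstep : ∀ x, stepFun A (fun i => -(i.1).toReal) x = -(h x).toReal := by
    intro x
    by_cases hx : h x = 0
    · rw [hx, ENNReal.toReal_zero, neg_zero]
      refine Finset.sum_eq_zero fun i _ => ?_
      have hxi : x ∉ A i := fun h' => hv0 i ((show h x = i.1 from h').symm.trans hx)
      rw [indicator_of_notMem hxi, mul_zero]
    · set i₀ : ι := ⟨h x, Finset.mem_filter.2 ⟨h.mem_range_self x, hx⟩⟩ with hi₀
      rw [stepFun, Finset.sum_eq_single i₀]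
      · rw [indicator_of_mem (show x ∈ A i₀ from rfl), mul_one]
      · intro j _ hj
        have hxj : x ∉ A j := fun h' => hj (Subtype.ext (show h x = j.1 from h').symm)
        rw [indicator_of_notMem hxj, mul_zero]
      · simp
  have hmem := memLp_toReal_of_le_one h.measurable h1 hi
  have hcls : -toL2 μ (fun x => (h x).toReal) = toL2 μ (stepFun A fun i => -(i.1).toReal) := by
    symm
    refine toL2_ext (memLp_stepFun hA hμ _) ?_
    filter_upwards [Lp.coeFn_neg (toL2 μ fun x => (h x).toReal), coeFn_toL2 hmem] with x h1 h2
    rw [h1, Pi.neg_apply, h2, hstep]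
  rw [hcls]
  filter_upwards [hQ.coeFn_expVector_stepFun hA hμ hd fun i => -(i.1).toReal,
    ae_all_iff.2 fun i => hQ.ae_finite_inter (hA i) (hμ i)] with γ e1 e2
  rw [e1, toReal_avoidFun_of_sum_indicator (A := A) (t := fun i : ι => i.1) hv1 hd
    (fun i x hx => hx) (fun x hx => ?_) e2]
  · unfold poissonTilt
    rw [Finset.prod_mul_distrib, mul_comm, ← Real.exp_sum, hlin, ENNReal.toReal_sum
      fun i _ => ENNReal.mul_ne_top (hvt i) (hμ i)]
    simp [ENNReal.toReal_mul, Measure.real, sub_eq_add_neg]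
  · by_contra hx0
    exact hx ⟨h x, Finset.mem_filter.2 ⟨h.mem_range_self x, hx0⟩⟩ rfl

/-- The exponential vector of `-h`, `0 ≤ h ≤ 1`. -/
theorem IsPoissonMeasure.coeFn_expVector_neg (hQ : IsPoissonMeasure μ Q)
    {h : X → ℝ≥0∞} (hh : Measurable h) (h1 : ∀ x, h x ≤ 1) (hi : ∫⁻ x, h x ∂μ ≠ ⊤) :
    expVector μ Q (-toL2 μ fun x => (h x).toReal)
      =ᵐ[Q] fun γ => Real.exp (∫⁻ x, h x ∂μ).toReal * (avoidFun h γ).toReal := by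
  have := hQ.isProbabilityMeasure
  set g : ℕ → SimpleFunc X ℝ≥0∞ := SimpleFunc.eapprox h with hg
  have hgh : ∀ k x, g k x ≤ h x := fun k x => by
    rw [← SimpleFunc.iSup_eapprox_apply hh x]
    exact le_iSup (fun k => g k x) k
  have hmono : Monotone fun k => (g k : X → ℝ≥0∞) := fun i j hij => SimpleFunc.monotone_eapprox h hij
  have hgi : ∀ k, ∫⁻ x, g k x ∂μ ≠ ⊤ := fun k =>
    ((lintegral_mono (hgh k)).trans_lt hi.lt_top).ne
  have hg1 : ∀ k x, g k x ≤ 1 := fun k x => (hgh k x).trans (h1 x)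
  have hmem := memLp_toReal_of_le_one hh h1 hi
  have hht : ∀ x, h x ≠ ⊤ := fun x => ((h1 x).trans_lt ENNReal.one_lt_top).ne
  have hlim1 : Tendsto (fun k => toL2 μ fun x => (g k x).toReal) atTop
      (𝓝 (toL2 μ fun x => (h x).toReal)) := by
    refine tendsto_Lp_of_dominated (fun k => coeFn_toL2
      (memLp_toReal_of_le_one (g k).measurable (hg1 k) (hgi k))) (coeFn_toL2 hmem) hmem
      (fun k => Eventually.of_forall fun x => ?_) (Eventually.of_forall fun x => ?_)
    · rw [abs_of_nonneg ENNReal.toReal_nonneg]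
      exact ENNReal.toReal_mono (hht x) (hgh k x)
    · exact (ENNReal.tendsto_toReal (hht x)).comp (SimpleFunc.tendsto_eapprox hh x)
  have hlim2 := (hQ.continuous_expVector.tendsto _).comp hlim1.neg
  set G : Config X → ℝ := fun γ => Real.exp (∫⁻ x, h x ∂μ).toReal * (avoidFun h γ).toReal with hG
  have hGm : MemLp G 2 Q := by
    refine MemLp.of_bound (((measurable_avoidFun hh).ennreal_toReal).const_mul
      _).aestronglyMeasurable (Real.exp (∫⁻ x, h x ∂μ).toReal) (Eventually.of_forall fun γ => ?_)
    rw [Real.norm_of_nonneg (by positivity)]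
    refine mul_le_of_le_one_right (Real.exp_pos _).le ?_
    exact ENNReal.toReal_mono ENNReal.one_ne_top (avoidFun_le_one h γ)
  -- Along increasing simple functions the explicit formulas converge pointwise, under a constant
  -- bound that is square integrable for a probability measure.
  have hlim3 : Tendsto (fun k => expVector μ Q (-toL2 μ fun x => (g k x).toReal)) atTop
      (𝓝 (toL2 Q G)) := by
    refine tendsto_Lp_of_dominated
      (fun k => hQ.coeFn_expVector_simpleFunc (g k) (hg1 k) (hgi k)) (coeFn_toL2 hGm)
      (memLp_const (Real.exp (∫⁻ x, h x ∂μ).toReal)) (fun k => Eventually.of_forall fun γ => ?_)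
      (Eventually.of_forall fun γ => ?_)
    · rw [abs_of_nonneg (by positivity)]
      refine (mul_le_of_le_one_right (Real.exp_pos _).le ?_).trans
        (Real.exp_le_exp.2 (ENNReal.toReal_mono hi (lintegral_mono (hgh k))))
      exact ENNReal.toReal_mono ENNReal.one_ne_top (avoidFun_le_one _ γ)
    · have e1 : Tendsto (fun k => ∫⁻ x, g k x ∂μ) atTop (𝓝 (∫⁻ x, h x ∂μ)) :=
        lintegral_tendsto_of_tendsto_of_monotone (fun k => (g k).measurable.aemeasurable)
          (Eventually.of_forall fun x i j hij => hmono hij x)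
          (Eventually.of_forall fun x => SimpleFunc.tendsto_eapprox hh x)
      have e2 : Tendsto (fun k => avoidFun (g k) γ) atTop (𝓝 (avoidFun h γ)) := by
        rw [avoidFun_eq_iInf_of_iSup hmono (fun x => SimpleFunc.iSup_eapprox_apply hh x) γ]
        exact tendsto_atTop_iInf fun i j hij => antitone_avoidFun (hmono hij) γ
      have e3 := ((ENNReal.tendsto_toReal hi).comp e1).rexp
      have e4 := (ENNReal.tendsto_toReal
        ((avoidFun_le_one h γ).trans_lt ENNReal.one_lt_top).ne).comp e2
      exact e3.mul e4
  rw [tendsto_nhds_unique hlim2 hlim3]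
  exact coeFn_toL2 hGm

/-- The Laplace functional of the Poisson measure, read off from the fact that exponential vectors
have mean 1. -/
theorem IsPoissonMeasure.lintegral_avoidFun (hQ : IsPoissonMeasure μ Q)
    {h : X → ℝ≥0∞} (hh : Measurable h) (h1 : ∀ x, h x ≤ 1) (hi : ∫⁻ x, h x ∂μ ≠ ⊤) :
    ∫⁻ γ, avoidFun h γ ∂Q = ENNReal.ofReal (Real.exp (-(∫⁻ x, h x ∂μ).toReal)) := by
  have := hQ.isProbabilityMeasure
  have e1 := hQ.integral_expVector (-toL2 μ fun x => (h x).toReal)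
  rw [integral_congr_ae (hQ.coeFn_expVector_neg hh h1 hi), integral_const_mul] at e1
  have hfin : ∀ γ, avoidFun h γ < ⊤ := fun γ => (avoidFun_le_one h γ).trans_lt ENNReal.one_lt_top
  have hle : ∫⁻ γ, avoidFun h γ ∂Q ≤ 1 := (lintegral_mono (avoidFun_le_one h)).trans_eq (by simp)
  rw [integral_toReal (measurable_avoidFun hh).aemeasurable (Eventually.of_forall hfin)] at e1
  rw [← ENNReal.ofReal_toReal (hle.trans_lt ENNReal.one_lt_top).ne, Real.exp_neg,
    eq_inv_of_mul_eq_one_right e1]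

end ExponentialVectors

end
end InfiniteParticles

namespace InfiniteParticles

noncomputable section

theorem eLpNorm_two_sq {S : Type*} [MeasurableSpace S] (F : S → ℝ) (ν : Measure S) :
    eLpNorm F 2 ν ^ 2 = ∫⁻ x, ‖F x‖ₑ ^ 2 ∂ν := by
  have h := eLpNorm_nnreal_pow_eq_lintegral (f := F) (μ := ν) (p := 2) two_ne_zero
  simpa [ENNReal.rpow_two] using h

/-! ### The operator of a kernel with invariant measure -/

section Koopman

variable {S : Type*} [MeasurableSpace S] {ν : Measure S} {K : Kernel S S}

theorem enorm_integral_sq_le {P : Measure S} [IsProbabilityMeasure P] {F : S → ℝ}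
    (hF : AEStronglyMeasurable F P) : ‖∫ x, F x ∂P‖ₑ ^ 2 ≤ ∫⁻ x, ‖F x‖ₑ ^ 2 ∂P := by
  have h1 : ‖∫ x, F x ∂P‖ₑ ≤ eLpNorm F 1 P := by
    rw [eLpNorm_one_eq_lintegral_enorm]; exact enorm_integral_le_lintegral_enorm F
  have h2 : eLpNorm F 1 P ≤ eLpNorm F 2 P := eLpNorm_le_eLpNorm_of_exponent_le one_le_two hF
  calc ‖∫ x, F x ∂P‖ₑ ^ 2 ≤ eLpNorm F 2 P ^ 2 := by gcongr; exact h1.trans h2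
    _ = ∫⁻ x, ‖F x‖ₑ ^ 2 ∂P := eLpNorm_two_sq F P

/-- Invariance prevents the kernel from charging null sets from almost every starting point, so
versions of `F` may be exchanged. -/
theorem ae_ae_of_invariant [SFinite ν] [IsSFiniteKernel K] (hinv : K ∘ₘ ν = ν) {p : S → Prop}
    (h : ∀ᵐ x ∂ν, p x) : ∀ᵐ x ∂ν, ∀ᵐ y ∂(K x), p y :=
  Measure.ae_ae_of_ae_comp (by rwa [hinv])

theorem lintegral_lintegral_of_invariant (hinv : K ∘ₘ ν = ν) {f : S → ℝ≥0∞}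
    (hf : Measurable f) : ∫⁻ x, ∫⁻ y, f y ∂(K x) ∂ν = ∫⁻ x, f x ∂ν := by
  rw [← Measure.lintegral_bind K.measurable.aemeasurable hf.aemeasurable, hinv]

variable [IsProbabilityMeasure ν] [IsMarkovKernel K]

theorem ae_memLp_of_invariant (hinv : K ∘ₘ ν = ν) {F : S → ℝ} (hF : MemLp F 2 ν) :
    ∀ᵐ x ∂ν, MemLp F 2 (K x) := by
  obtain ⟨F', hF', hFF'⟩ := hF.1
  have h1 : ∫⁻ x, ∫⁻ y, ‖F' y‖ₑ ^ 2 ∂(K x) ∂ν ≠ ⊤ := by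
    rw [lintegral_lintegral_of_invariant hinv (hF'.measurable.enorm.pow_const 2)]
    have h2 := (hF.ae_eq hFF').2
    rw [← eLpNorm_two_sq]
    exact ENNReal.pow_ne_top h2.ne
  have h5 := ae_lt_top ((hF'.measurable.enorm.pow_const 2).lintegral_kernel (κ := K)) h1
  filter_upwards [h5, ae_ae_of_invariant hinv hFF'] with x hx1 hx2
  refine MemLp.ae_eq (show F =ᵐ[K x] F' from hx2).symm ⟨hF'.aestronglyMeasurable, ?_⟩
  rw [← eLpNorm_two_sq] at hx1
  exact (ENNReal.pow_lt_top_iff.1 hx1).resolve_right (by norm_num)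

theorem ae_integral_eq_of_ae_eq (hinv : K ∘ₘ ν = ν) {F G : S → ℝ} (h : F =ᵐ[ν] G) :
    (fun x => ∫ y, F y ∂(K x)) =ᵐ[ν] fun x => ∫ y, G y ∂(K x) := by
  filter_upwards [ae_ae_of_invariant hinv h] with x hx
  exact integral_congr_ae hx

/-- Jensen's inequality under each `K x`, then invariance of the integral of the square. -/
theorem memLp_integral_kernel (hinv : K ∘ₘ ν = ν) {F : S → ℝ} (hF : MemLp F 2 ν) :
    MemLp (fun x => ∫ y, F y ∂(K x)) 2 ν ∧
      eLpNorm (fun x => ∫ y, F y ∂(K x)) 2 ν ≤ eLpNorm F 2 ν := by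
  obtain ⟨F', hF', hFF'⟩ := hF.1
  have hm : AEStronglyMeasurable (fun x => ∫ y, F' y ∂(K x)) ν :=
    hF'.integral_kernel.aestronglyMeasurable
  have hle : eLpNorm (fun x => ∫ y, F' y ∂(K x)) 2 ν ≤ eLpNorm F' 2 ν := by
    refine (ENNReal.pow_le_pow_left_iff two_ne_zero).1 ?_
    rw [eLpNorm_two_sq, eLpNorm_two_sq, ← lintegral_lintegral_of_invariant hinv (hF'.measurable.enorm.pow_const 2)]
    exact lintegral_mono fun x => enorm_integral_sq_le hF'.aestronglyMeasurable
  have hc := ae_integral_eq_of_ae_eq hinv hFF'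
  have h1 : eLpNorm (fun x => ∫ y, F y ∂(K x)) 2 ν ≤ eLpNorm F 2 ν := by
    rw [eLpNorm_congr_ae hc, eLpNorm_congr_ae hFF']; exact hle
  exact ⟨⟨hm.congr hc.symm, h1.trans_lt hF.2⟩, h1⟩

/-- The operator `F ↦ ∫ F(y) K(·, dy)` in `L²(ν)`, for an invariant probability measure `ν`. -/
def koopman (hinv : K ∘ₘ ν = ν) : Lp ℝ 2 ν →L[ℝ] Lp ℝ 2 ν :=
  LinearMap.mkContinuous
    { toFun := fun F => toL2 ν fun x => ∫ y, F y ∂(K x)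
      map_add' := fun F G => by
        refine toL2_ext (memLp_integral_kernel hinv (Lp.memLp _)).1 ?_
        filter_upwards [ae_integral_eq_of_ae_eq hinv (Lp.coeFn_add F G),
          Lp.coeFn_add (toL2 ν fun x => ∫ y, F y ∂(K x)) (toL2 ν fun x => ∫ y, G y ∂(K x)),
          coeFn_toL2 (memLp_integral_kernel hinv (Lp.memLp F)).1,
          coeFn_toL2 (memLp_integral_kernel hinv (Lp.memLp G)).1,
          ae_memLp_of_invariant hinv (Lp.memLp F), ae_memLp_of_invariant hinv (Lp.memLp G)]
          with x h1 h2 h3 h4 h5 h6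
        rw [h1, h2, Pi.add_apply, h3, h4]
        exact integral_add (h5.integrable one_le_two) (h6.integrable one_le_two)
      map_smul' := fun c F => by
        refine toL2_ext (memLp_integral_kernel hinv (Lp.memLp _)).1 ?_
        filter_upwards [ae_integral_eq_of_ae_eq hinv (Lp.coeFn_smul c F),
          Lp.coeFn_smul c (toL2 ν fun x => ∫ y, F y ∂(K x)),
          coeFn_toL2 (memLp_integral_kernel hinv (Lp.memLp F)).1] with x h1 h2 h3
        rw [h1, RingHom.id_apply, h2, Pi.smul_apply, h3]
        exact integral_const_mul c _ } 1 fun F => by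
    have h := memLp_integral_kernel hinv (Lp.memLp F)
    rw [one_mul]
    change ‖toL2 ν fun x => ∫ y, F y ∂(K x)‖ ≤ _
    rw [toL2_eq h.1, Lp.norm_toLp, Lp.norm_def]
    exact ENNReal.toReal_mono (Lp.memLp F).2.ne h.2

theorem coeFn_koopman (hinv : K ∘ₘ ν = ν) {F : Lp ℝ 2 ν} {G : S → ℝ} (h : F =ᵐ[ν] G) :
    koopman hinv F =ᵐ[ν] fun x => ∫ y, G y ∂(K x) :=
  (coeFn_toL2 (memLp_integral_kernel hinv (Lp.memLp F)).1).trans (ae_integral_eq_of_ae_eq hinv h)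

theorem norm_koopman_le (hinv : K ∘ₘ ν = ν) (F : Lp ℝ 2 ν) : ‖koopman hinv F‖ ≤ ‖F‖ := by
  refine (ContinuousLinearMap.le_opNorm _ _).trans (mul_le_of_le_one_left (norm_nonneg _) ?_)
  exact LinearMap.mkContinuous_norm_le _ zero_le_one _

end Koopman

/-! ### Comparison of coefficients -/

section PowerSeries

/-- Once the lower coefficients vanish, divide by `s ^ N` and let `s` tend to 0; dominated
convergence isolates `a N`. -/
theorem eq_zero_of_tsum_pow_smul_eq_zero {E : Type*} [NormedAddCommGroup E] [NormedSpace ℝ E]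
    [CompleteSpace E] {a : ℕ → E} (ha : Summable fun n => ‖a n‖)
    (h : ∀ s : ℝ, 0 < s → s ≤ 1 → ∑' n, s ^ n • a n = 0) (n : ℕ) : a n = 0 := by
  induction n using Nat.strong_induction_on with
  | _ N ih =>
  have hs : ∀ s : ℝ, 0 < s → s ≤ 1 → ∑' n, s ^ n • a (n + N) = 0 := by
    intro s hs0 hs1
    have hsum : Summable fun n => s ^ n • a n := by
      refine Summable.of_norm_bounded ha fun n => ?_
      rw [norm_smul, Real.norm_of_nonneg (by positivity)]
      exact mul_le_of_le_one_left (norm_nonneg _) (pow_le_one₀ hs0.le hs1)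
    have h1 := hsum.sum_add_tsum_nat_add N
    rw [h s hs0 hs1, Finset.sum_eq_zero fun k hk => by rw [ih k (Finset.mem_range.1 hk), smul_zero],
      zero_add] at h1
    have h2 : ∀ n, s ^ (n + N) • a (n + N) = s ^ N • (s ^ n • a (n + N)) := fun n => by
      rw [smul_smul, pow_add, mul_comm]
    simp_rw [h2] at h1
    rw [tsum_const_smul''] at h1
    exact (smul_eq_zero.1 h1).resolve_left (pow_pos hs0 N).ne'
  have hu : Tendsto (fun k : ℕ => (1 / ((k : ℝ) + 1))) atTop (𝓝 0) :=
    tendsto_one_div_add_atTop_nhds_zero_nat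
  have hu1 : ∀ k : ℕ, 1 / ((k : ℝ) + 1) ≤ 1 := fun k => by
    rw [div_le_one (by positivity)]; linarith [(Nat.cast_nonneg k : (0 : ℝ) ≤ k)]
  have hlim : Tendsto (fun k : ℕ => ∑' n, (1 / ((k : ℝ) + 1)) ^ n • a (n + N)) atTop
      (𝓝 (∑' n, (0 : ℝ) ^ n • a (n + N))) := by
    refine tendsto_tsum_of_dominated_convergence ((summable_nat_add_iff N).2 ha)
      (fun n => (hu.pow n).smul_const _) (Eventually.of_forall fun k n => ?_)
    rw [norm_smul, Real.norm_of_nonneg (by positivity)]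
    exact mul_le_of_le_one_left (norm_nonneg _) (pow_le_one₀ (by positivity) (hu1 k))
  have h0 : ∑' n, (0 : ℝ) ^ n • a (n + N) = a N := by
    rw [tsum_eq_single 0 fun n hn => by rw [zero_pow hn, zero_smul]]
    simp
  rw [h0] at hlim
  refine tendsto_nhds_unique hlim (tendsto_const_nhds.congr fun k => ?_)
  exact (hs _ (by positivity) (hu1 k)).symm

/-- A symmetric multilinear form that vanishes on the diagonal at `f + s g` for `0 < s ≤ 1` also
vanishes at `f - g`. -/
theorem MultilinearMap.map_const_sub_eq_zero {E V : Type*} [NormedAddCommGroup E]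
    [NormedSpace ℝ E] [CompleteSpace E] [AddCommGroup V] [Module ℝ V] {n : ℕ}
    (D : MultilinearMap ℝ (fun _ : Fin n => V) E) {f g : V}
    (h : ∀ s : ℝ, 0 < s → s ≤ 1 → D (fun _ => f + s • g) = 0) : D (fun _ => f - g) = 0 := by
  classical
  -- The coefficient of `s ^ j` in the polynomial obtained by expanding `D` at `f + s • g`. All of
  -- them vanish, so the polynomial may be evaluated at `s = -1`.
  set c : ℕ → E := fun j => ∑ s : Finset (Fin n) with sᶜ.card = j,
    D (s.piecewise (fun _ => f) fun _ => g) with hc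
  have h0 : ∀ j ∉ Finset.range (n + 1), c j = 0 := by
    intro j hj
    refine Finset.sum_eq_zero fun s hs => ?_
    have := Finset.card_le_univ (sᶜ : Finset (Fin n))
    rw [(Finset.mem_filter.1 hs).2, Fintype.card_fin] at this
    exact (hj (Finset.mem_range.2 (by omega))).elim
  have hexp : ∀ s : ℝ, D (fun _ => f + s • g) = ∑ j ∈ Finset.range (n + 1), s ^ j • c j := by
    intro s
    have h1 := D.map_add_univ (fun _ => f) (fun _ => s • g)
    have h2 : ∀ T : Finset (Fin n), D (T.piecewise (fun _ => f) fun _ => s • g)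
        = s ^ (Tᶜ).card • D (T.piecewise (fun _ => f) fun _ => g) := by
      intro T
      have h3 := D.map_piecewise_smul (fun _ => s) (T.piecewise (fun _ => f) fun _ => g) Tᶜ
      rw [Finset.prod_const] at h3
      rw [← h3]
      congr 1
      ext i
      by_cases hi : i ∈ T <;> simp [Finset.piecewise, hi]
    simp_rw [h2] at h1
    refine h1.trans ?_
    rw [← Finset.sum_fiberwise_of_maps_to (s := Finset.univ) (t := Finset.range (n + 1))
      (g := fun T : Finset (Fin n) => (Tᶜ).card)]
    · refine Finset.sum_congr rfl fun j _ => ?_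
      rw [hc, Finset.smul_sum]
      exact Finset.sum_congr rfl fun T hT => by rw [(Finset.mem_filter.1 hT).2]
    · intro T _
      have := Finset.card_le_univ (Tᶜ : Finset (Fin n))
      rw [Fintype.card_fin] at this
      exact Finset.mem_range.2 (by omega)
  have hcz := eq_zero_of_tsum_pow_smul_eq_zero (a := c)
    (summable_of_ne_finset_zero (s := Finset.range (n + 1)) fun j hj => by rw [h0 j hj, norm_zero])
    fun s hs0 hs1 => by
      rw [tsum_eq_sum (s := Finset.range (n + 1)) fun j hj => by rw [h0 j hj, smul_zero],
        ← hexp, h s hs0 hs1]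
  have h4 := hexp (-1)
  rw [Finset.sum_eq_zero fun j _ => by rw [hcz j, smul_zero]] at h4
  simpa [sub_eq_add_neg] using h4

end PowerSeries

end
end InfiniteParticles

namespace InfiniteParticles

noncomputable section

/-! ### Invariance of the intensity measure -/

section InvariantIntensity

variable {S : Type*} [MeasurableSpace S] {μ : Measure S}

/-- The `f n` may be negative and `u` need not be integrable; subtracting the term with `f 0` gives
nonnegative integrands suited to monotone convergence. -/
theorem tendsto_integral_mul_of_monotone {u : S → ℝ} (hu : MemLp u 2 μ) (hu0 : ∀ x, 0 ≤ u x)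
    {f : ℕ → Lp ℝ 2 μ}
    (hf : ∀ᵐ x ∂μ, Monotone (fun n => f n x) ∧ Tendsto (fun n => f n x) atTop (𝓝 1)) :
    Tendsto (fun n => ENNReal.ofReal (∫ x, u x * f n x ∂μ - ∫ x, u x * f 0 x ∂μ)) atTop
      (𝓝 (∫⁻ x, ENNReal.ofReal (u x * (1 - f 0 x)) ∂μ)) := by
  have hi : ∀ n, Integrable (fun x => u x * f n x) μ := fun n => hu.integrable_mul (Lp.memLp (f n))
  have h1 : ∀ n, ENNReal.ofReal (∫ x, u x * f n x ∂μ - ∫ x, u x * f 0 x ∂μ)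
      = ∫⁻ x, ENNReal.ofReal (u x * (f n x - f 0 x)) ∂μ := fun n => by
    rw [← integral_sub (hi n) (hi 0)]
    simp_rw [← mul_sub]
    refine ofReal_integral_eq_lintegral_ofReal ?_ ?_
    · simp only [mul_sub]; exact (hi n).sub (hi 0)
    · filter_upwards [hf] with x hx
      exact mul_nonneg (hu0 x) (sub_nonneg.2 (hx.1 (Nat.zero_le n)))
  simp_rw [h1]
  refine lintegral_tendsto_of_tendsto_of_monotone (fun n => ?_) ?_ ?_
  · exact (hu.1.aemeasurable.mul ((Lp.aestronglyMeasurable (f n)).aemeasurable.sub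
      (Lp.aestronglyMeasurable (f 0)).aemeasurable)).ennreal_ofReal
  · filter_upwards [hf] with x hx i j hij
    exact ENNReal.ofReal_le_ofReal
      (mul_le_mul_of_nonneg_left (sub_le_sub_right (hx.1 hij) _) (hu0 x))
  · filter_upwards [hf] with x hx
    exact ENNReal.tendsto_ofReal ((hx.2.sub_const _).const_mul _)

theorem inner_eq_integral {F G : Lp ℝ 2 μ} {f : S → ℝ} (hF : F =ᵐ[μ] f) :
    inner ℝ F G = ∫ x, f x * G x ∂μ := by
  rw [L2.inner_def]
  refine integral_congr_ae (hF.mono fun x hx => ?_)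
  simp [hx, mul_comm]

theorem coeFn_of_corresponds {T : Lp ℝ 2 μ →L[ℝ] Lp ℝ 2 μ} {κ : Kernel S S} [IsMarkovKernel κ]
    (hc : ∀ f : S → ℝ, Measurable f → ∀ hf : MemLp f 2 μ, T (hf.toLp f) =ᵐ[μ] fun x => ∫ y, f y ∂(κ x))
    {h : S → ℝ≥0∞} (hh : Measurable h) (h1 : ∀ x, h x ≤ 1) (hi : ∫⁻ x, h x ∂μ ≠ ⊤) :
    T (toL2 μ fun x => (h x).toReal) =ᵐ[μ] fun x => (∫⁻ y, h y ∂(κ x)).toReal := by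
  have hm := memLp_toReal_of_le_one hh h1 hi
  rw [toL2_eq hm]
  refine (hc _ hh.ennreal_toReal hm).trans (Eventually.of_forall fun x => ?_)
  exact integral_toReal hh.aemeasurable
    (Eventually.of_forall fun y => (h1 y).trans_lt ENNReal.one_lt_top)

/-- A symmetric Markov kernel preserves the measure. -/
theorem lintegral_lintegral_of_corresponds {T : Lp ℝ 2 μ →L[ℝ] Lp ℝ 2 μ} {κ : Kernel S S}
    [IsMarkovKernel κ] (hsa : IsSelfAdjoint T) (hT : IsMarkovOperator T)
    (hc : ∀ f : S → ℝ, Measurable f → ∀ hf : MemLp f 2 μ, T (hf.toLp f) =ᵐ[μ] fun x => ∫ y, f y ∂(κ x))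
    {h : S → ℝ≥0∞} (hh : Measurable h) (h1 : ∀ x, h x ≤ 1) (hi : ∫⁻ x, h x ∂μ ≠ ⊤) :
    ∫⁻ x, ∫⁻ y, h y ∂(κ x) ∂μ = ∫⁻ x, h x ∂μ := by
  have hm := memLp_toReal_of_le_one hh h1 hi
  have hκ1 : ∀ x, ∫⁻ y, h y ∂(κ x) ≤ 1 := fun x => (lintegral_mono h1).trans_eq (by simp)
  set g : S → ℝ := fun x => (∫⁻ y, h y ∂(κ x)).toReal with hg
  set H := toL2 μ fun x => (h x).toReal with hH
  have hTH : T H =ᵐ[μ] g := coeFn_of_corresponds hc hh h1 hi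
  have hgm : MemLp g 2 μ := (Lp.memLp (T H)).ae_eq hTH
  have hHm : H =ᵐ[μ] fun x => (h x).toReal := coeFn_toL2 hm
  obtain ⟨f, hf1, hf2⟩ := hT.markov
  -- Symmetry of `T` moves the operator onto the approximating sequence. Both `f n` and `T (f n)`
  -- increase to 1, so in the limit the integrals of `g` and `h` are compared.
  have hadj : ∀ n, ∫ x, g x * f n x ∂μ = ∫ x, (h x).toReal * T (f n) x ∂μ := fun n => by
    rw [← inner_eq_integral hTH, ← inner_eq_integral hHm]
    exact hsa.isSymmetric H (f n)
  have hg0 : ∀ x, 0 ≤ g x := fun x => ENNReal.toReal_nonneg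
  have hh0 : ∀ x, 0 ≤ (h x).toReal := fun x => ENNReal.toReal_nonneg
  have e1 := tendsto_integral_mul_of_monotone hgm hg0 hf1
  have e2 := tendsto_integral_mul_of_monotone hm hh0 hf2
  simp_rw [hadj] at e1
  have e3 := tendsto_nhds_unique e1 e2
  have hle1 : ∀ᵐ x ∂μ, f 0 x ≤ 1 := hf1.mono fun x hx => hx.1.ge_of_tendsto hx.2 0
  have hle2 : ∀ᵐ x ∂μ, T (f 0) x ≤ 1 := hf2.mono fun x hx => hx.1.ge_of_tendsto hx.2 0
  have hhi : Integrable (fun x => (h x).toReal) μ :=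
    integrable_toReal_of_lintegral_ne_top hh.aemeasurable hi
  have hi1 : Integrable (fun x => (h x).toReal * T (f 0) x) μ := hm.integrable_mul (Lp.memLp _)
  have hi2 : Integrable (fun x => g x * f 0 x) μ := hgm.integrable_mul (Lp.memLp _)
  have hi3 : Integrable (fun x => (h x).toReal * (1 - T (f 0) x)) μ := by
    simp only [mul_sub, mul_one]; exact hhi.sub hi1
  have hnn3 : 0 ≤ᵐ[μ] fun x => (h x).toReal * (1 - T (f 0) x) :=
    hle2.mono fun x hx => mul_nonneg (hh0 x) (sub_nonneg.2 hx)
  have hnn4 : 0 ≤ᵐ[μ] fun x => g x * (1 - f 0 x) :=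
    hle1.mono fun x hx => mul_nonneg (hg0 x) (sub_nonneg.2 hx)
  have hm4 : AEStronglyMeasurable (fun x => g x * (1 - f 0 x)) μ :=
    hgm.1.mul (aestronglyMeasurable_const.sub (Lp.aestronglyMeasurable _))
  -- A priori `g` is only square integrable; its integrability comes from equality with the limit on
  -- the other side.
  have hi4 : Integrable (fun x => g x * (1 - f 0 x)) μ := by
    refine ⟨hm4, ?_⟩
    rw [hasFiniteIntegral_iff_ofReal hnn4, e3, ← hasFiniteIntegral_iff_ofReal hnn3]
    exact hi3.2
  have hgi : Integrable g μ := by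
    refine (hi4.add hi2).congr (Eventually.of_forall fun x => ?_)
    simp only [Pi.add_apply]
    ring
  have e4 : ∫ x, g x * (1 - f 0 x) ∂μ = ∫ x, (h x).toReal * (1 - T (f 0) x) ∂μ := by
    rw [integral_eq_lintegral_of_nonneg_ae hnn4 hm4, e3,
      ← integral_eq_lintegral_of_nonneg_ae hnn3 hi3.1]
  simp only [mul_sub, mul_one] at e4
  rw [integral_sub hgi hi2, integral_sub hhi hi1, hadj 0, sub_left_inj] at e4
  have e5 := congrArg ENNReal.ofReal e4
  rw [ofReal_integral_eq_lintegral_ofReal hgi (Eventually.of_forall hg0),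
    ofReal_integral_eq_lintegral_ofReal hhi (Eventually.of_forall hh0)] at e5
  rw [lintegral_congr fun x => ENNReal.ofReal_toReal ((hκ1 x).trans_lt ENNReal.one_lt_top).ne,
    lintegral_congr fun x => ENNReal.ofReal_toReal ((h1 x).trans_lt ENNReal.one_lt_top).ne] at e5
  exact e5

end InvariantIntensity

/-! ### Identification of the second quantization -/

section Identification

variable {X : Type*} [MetricSpace X] [ProperSpace X] [MeasurableSpace X] [BorelSpace X]
  {μ : Measure X} [IsLocallyFiniteMeasure μ] {Q : Measure (Config X)}
  {κ : Kernel X X} [IsMarkovKernel κ] {K : Kernel (Config X) (Config X)} [IsMarkovKernel K]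

/-- Void probabilities decide. For `h` the indicator of `A`, both sides equal `exp(-μ(A))`, since
`κ` preserves the integral of `h`. -/
theorem IsPoissonMeasure.comp_eq (hQ : IsPoissonMeasure μ Q)
    (hK : ∀ h : X → ℝ≥0∞, Measurable h → (∀ x, h x ≤ 1) →
      ∀ᵐ γ ∂Q, ∫⁻ ξ, avoidFun h ξ ∂(K γ) = avoidFun (fun y => ∫⁻ u, h u ∂(κ y)) γ)
    (hκ : ∀ h : X → ℝ≥0∞, Measurable h → (∀ x, h x ≤ 1) → ∫⁻ x, h x ∂μ ≠ ⊤ →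
      ∫⁻ x, ∫⁻ y, h y ∂(κ x) ∂μ = ∫⁻ x, h x ∂μ) : K ∘ₘ Q = Q := by
  have := hQ.isProbabilityMeasure
  refine ext_of_voidEvent fun A hA hAb => ?_
  have hm : Measurable (A.indicator (1 : X → ℝ≥0∞)) := measurable_one.indicator hA
  have h1 : ∀ x, A.indicator (1 : X → ℝ≥0∞) x ≤ 1 := fun x => indicator_le_self' (by simp) x
  have hi : ∫⁻ x, A.indicator (1 : X → ℝ≥0∞) x ∂μ ≠ ⊤ := by
    rw [lintegral_indicator_one hA]; exact hAb.measure_lt_top.ne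
  have hV := measurableSet_voidEvent hA
  have e : ∀ P : Measure (Config X), P (voidEvent A) = ∫⁻ ξ, avoidFun (A.indicator 1) ξ ∂P := by
    intro P
    rw [lintegral_congr fun ξ => avoidFun_voidEvent (A := A) ξ, lintegral_indicator_one hV]
  have hκ1 : ∀ x, ∫⁻ y, A.indicator (1 : X → ℝ≥0∞) y ∂(κ x) ≤ 1 :=
    fun x => (lintegral_mono h1).trans_eq (by simp)
  rw [Measure.bind_apply hV K.measurable.aemeasurable, lintegral_congr fun γ => e (K γ),
    lintegral_congr_ae (hK _ hm h1), hQ.lintegral_avoidFun hm.lintegral_kernel hκ1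
      (by rw [hκ _ hm h1 hi]; exact hi), hκ _ hm h1 hi, e, hQ.lintegral_avoidFun hm h1 hi]

variable {T : Lp ℝ 2 μ →L[ℝ] Lp ℝ 2 μ}

/-- On both sides the explicit formula applies: independence changes `∏ (1 - h)` into `∏ (1 - κh)`,
and the prefactors agree because `∫ κh = ∫ h`. -/
theorem IsPoissonMeasure.koopman_expVector [IsProbabilityMeasure Q] (hQ : IsPoissonMeasure μ Q)
    (hinv : K ∘ₘ Q = Q)
    (hK : ∀ h : X → ℝ≥0∞, Measurable h → (∀ x, h x ≤ 1) →
      ∀ᵐ γ ∂Q, ∫⁻ ξ, avoidFun h ξ ∂(K γ) = avoidFun (fun y => ∫⁻ u, h u ∂(κ y)) γ)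
    (hκ : ∀ h : X → ℝ≥0∞, Measurable h → (∀ x, h x ≤ 1) → ∫⁻ x, h x ∂μ ≠ ⊤ →
      ∫⁻ x, ∫⁻ y, h y ∂(κ x) ∂μ = ∫⁻ x, h x ∂μ)
    (hT : ∀ h : X → ℝ≥0∞, Measurable h → (∀ x, h x ≤ 1) → ∫⁻ x, h x ∂μ ≠ ⊤ →
      T (toL2 μ fun x => (h x).toReal) =ᵐ[μ] fun x => (∫⁻ y, h y ∂(κ x)).toReal)
    {h : X → ℝ≥0∞} (hh : Measurable h) (h1 : ∀ x, h x ≤ 1) (hi : ∫⁻ x, h x ∂μ ≠ ⊤) :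
    koopman hinv (expVector μ Q (-toL2 μ fun x => (h x).toReal))
      = expVector μ Q (-T (toL2 μ fun x => (h x).toReal)) := by
  have hκ1 : ∀ x, ∫⁻ y, h y ∂(κ x) ≤ 1 := fun x => (lintegral_mono h1).trans_eq (by simp)
  have hκi : ∫⁻ x, ∫⁻ y, h y ∂(κ x) ∂μ ≠ ⊤ := by rw [hκ _ hh h1 hi]; exact hi
  have e1 : T (toL2 μ fun x => (h x).toReal) = toL2 μ fun x => (∫⁻ y, h y ∂(κ x)).toReal :=
    (toL2_ext (memLp_toReal_of_le_one hh.lintegral_kernel hκ1 hκi) (hT h hh h1 hi).symm).symm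
  rw [e1]
  refine Lp.ext ?_
  filter_upwards [coeFn_koopman hinv (hQ.coeFn_expVector_neg hh h1 hi),
    hQ.coeFn_expVector_neg hh.lintegral_kernel hκ1 hκi, hK h hh h1] with γ h2 h3 h4
  rw [h2, h3, integral_const_mul, hκ _ hh h1 hi, integral_toReal
    (measurable_avoidFun hh).aemeasurable
    (Eventually.of_forall fun ξ => (avoidFun_le_one h ξ).trans_lt ENNReal.one_lt_top), h4]

/-- The order `n` term of the exponential vector of `s • f` is homogeneous of degree `n` in `s`, so
the coefficients can be compared. -/
theorem IsPoissonMeasure.map_chaosPower_of_map_expVector (hQ : IsPoissonMeasure μ Q)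
    {A : Lp ℝ 2 Q →L[ℝ] Lp ℝ 2 Q} {f : Lp ℝ 2 μ}
    (h : ∀ s : ℝ, 0 < s → s ≤ 1 → A (expVector μ Q (s • f)) = expVector μ Q (T (s • f))) (n : ℕ) :
    A (chaosPower μ Q n f) = chaosPower μ Q n (T f) := by
  have hs1 : Summable fun n : ℕ => ‖A ((n.factorial : ℝ)⁻¹ • chaosPower μ Q n f)‖ :=
    Summable.of_nonneg_of_le (fun _ => norm_nonneg _) (fun _ => A.le_opNorm _)
      ((hQ.summable_norm_chaosPower f).mul_left _)
  have h0 := eq_zero_of_tsum_pow_smul_eq_zero (a := fun n : ℕ =>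
    A ((n.factorial : ℝ)⁻¹ • chaosPower μ Q n f) - (n.factorial : ℝ)⁻¹ • chaosPower μ Q n (T f))
    (Summable.of_nonneg_of_le (fun _ => norm_nonneg _) (fun _ => norm_sub_le _ _)
      (hs1.add (hQ.summable_norm_chaosPower (T f)))) (fun s hs0 hs1 => ?_) n
  · simp only [map_smul, ← smul_sub] at h0
    exact sub_eq_zero.1 ((smul_eq_zero.1 h0).resolve_left (by positivity))
  · have e1 := (hQ.hasSum_expVector (s • f)).mapL A
    have e2 := hQ.hasSum_expVector (T (s • f))
    rw [← h s hs0 hs1] at e2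
    have e3 := (e1.sub e2).tsum_eq
    rw [sub_self] at e3
    rw [← e3]
    refine tsum_congr fun n => ?_
    rw [map_smul T, chaosPower_smul, chaosPower_smul, smul_sub, smul_comm _ (s ^ n),
      map_smul A (s ^ n), smul_comm _ (s ^ n)]

/-- The defect of commutation is the diagonal of a multilinear map, hence polynomial in `s`. This
passes from sums with nonnegative weights to differences, which are out of reach of the formula for
`∏ (1 - h)`. -/
theorem map_chaosPower_sub {A : Lp ℝ 2 Q →L[ℝ] Lp ℝ 2 Q} {f g : Lp ℝ 2 μ} {n : ℕ}
    (h : ∀ s : ℝ, 0 < s → s ≤ 1 →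
      A (chaosPower μ Q n (f + s • g)) = chaosPower μ Q n (T (f + s • g))) :
    A (chaosPower μ Q n (f - g)) = chaosPower μ Q n (T (f - g)) := by
  let D : MultilinearMap ℝ (fun _ : Fin n => Lp ℝ 2 μ) (Lp ℝ 2 Q) :=
    (A.comp (multipleIntegral μ Q n)).toLinearMap.compMultilinearMap
        (tensorMap μ n).toMultilinearMap
      - (multipleIntegral μ Q n).toLinearMap.compMultilinearMap
        ((tensorMap μ n).toMultilinearMap.compLinearMap fun _ => T.toLinearMap)
  have hD : ∀ f : Lp ℝ 2 μ, D (fun _ => f) = A (chaosPower μ Q n f) - chaosPower μ Q n (T f) :=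
    fun f => rfl
  have := MultilinearMap.map_const_sub_eq_zero D (f := f) (g := g) fun s hs0 hs1 => by
    rw [hD, h s hs0 hs1, sub_self]
  exact sub_eq_zero.1 ((hD _).symm.trans this)

/-- An operator that commutes with a chaos power on bounded nonnegative integrable functions does
so on the whole of `L²`. -/
theorem map_chaosPower_of_nonneg {A : Lp ℝ 2 Q →L[ℝ] Lp ℝ 2 Q} {n : ℕ}
    (h : ∀ u : X → ℝ≥0∞, Measurable u → (∀ x, u x ≤ 1) → ∫⁻ x, u x ∂μ ≠ ⊤ →
      A (chaosPower μ Q n (toL2 μ fun x => (u x).toReal))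
        = chaosPower μ Q n (T (toL2 μ fun x => (u x).toReal))) (f : Lp ℝ 2 μ) :
    A (chaosPower μ Q n f) = chaosPower μ Q n (T f) := by
  have hsmul : ∀ (c : ℝ) (f : Lp ℝ 2 μ), A (chaosPower μ Q n f) = chaosPower μ Q n (T f) →
      A (chaosPower μ Q n (c • f)) = chaosPower μ Q n (T (c • f)) := fun c f hf => by
    rw [chaosPower_smul, map_smul, hf, map_smul, chaosPower_smul]
  have hsub : ∀ u v : X → ℝ≥0∞, Measurable u → (∀ x, u x ≤ 1) → ∫⁻ x, u x ∂μ ≠ ⊤ →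
      Measurable v → (∀ x, v x ≤ 1) → ∫⁻ x, v x ∂μ ≠ ⊤ →
      A (chaosPower μ Q n ((toL2 μ fun x => (u x).toReal) - toL2 μ fun x => (v x).toReal))
        = chaosPower μ Q n
          (T ((toL2 μ fun x => (u x).toReal) - toL2 μ fun x => (v x).toReal)) := by
    intro u v hu hu1 hui hv hv1 hvi
    refine map_chaosPower_sub fun s hs0 hs1 => ?_
    -- Halving keeps the sum below 1; homogeneity restores the factor 2.
    set w : X → ℝ≥0∞ := fun x => (u x + ENNReal.ofReal s * v x) / 2 with hw
    have hs1' : ENNReal.ofReal s ≤ 1 := ENNReal.ofReal_le_one.2 hs1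
    have hwm : Measurable w := (hu.add (hv.const_mul _)).div_const 2
    have hw1 : ∀ x, w x ≤ 1 := fun x => by
      refine ENNReal.div_le_of_le_mul ?_
      rw [one_mul, ← one_add_one_eq_two]
      exact add_le_add (hu1 x) (mul_le_one' hs1' (hv1 x))
    have hwi : ∫⁻ x, w x ∂μ ≠ ⊤ := by
      refine ((lintegral_mono (g := fun x => u x + v x) fun x => ?_).trans_lt ?_).ne
      · refine ENNReal.div_le_of_le_mul ?_
        calc u x + ENNReal.ofReal s * v x ≤ u x + v x := by gcongr; exact mul_le_of_le_one_left' hs1'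
          _ ≤ (u x + v x) * 2 := le_mul_of_one_le_right' one_le_two
      · rw [lintegral_add_left hu]
        exact ENNReal.add_lt_top.2 ⟨hui.lt_top, hvi.lt_top⟩
    have e : (toL2 μ fun x => (u x).toReal) + s • toL2 μ (fun x => (v x).toReal)
        = (2 : ℝ) • toL2 μ fun x => (w x).toReal := by
      refine Lp.ext ?_
      filter_upwards [coeFn_toL2 (memLp_toReal_of_le_one hu hu1 hui),
        coeFn_toL2 (memLp_toReal_of_le_one hv hv1 hvi),
        coeFn_toL2 (memLp_toReal_of_le_one hwm hw1 hwi),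
        Lp.coeFn_add (toL2 μ fun x => (u x).toReal) (s • toL2 μ fun x => (v x).toReal),
        Lp.coeFn_smul s (toL2 μ fun x => (v x).toReal),
        Lp.coeFn_smul (2 : ℝ) (toL2 μ fun x => (w x).toReal)] with x h1 h2 h3 h4 h5 h6
      rw [h4, Pi.add_apply, h5, h6, Pi.smul_apply, Pi.smul_apply, h1, h2, h3, hw]
      have hu' : u x ≠ ⊤ := ((hu1 x).trans_lt ENNReal.one_lt_top).ne
      have hv' : v x ≠ ⊤ := ((hv1 x).trans_lt ENNReal.one_lt_top).ne
      simp only [ENNReal.toReal_div, ENNReal.toReal_ofNat, smul_eq_mul]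
      rw [ENNReal.toReal_add hu' (ENNReal.mul_ne_top ENNReal.ofReal_ne_top hv'),
        ENNReal.toReal_mul, ENNReal.toReal_ofReal hs0.le]
      ring
    rw [e]
    exact hsmul 2 _ (h w hwm hw1 hwi)
  obtain ⟨g, hg, hfg⟩ := (Lp.aestronglyMeasurable f)
  have hgm : MemLp g 2 μ := (Lp.memLp f).ae_eq hfg
  -- With `a = 1` and `a = -1`, the positive and negative parts of `g`, scaled by `k + 1`, truncated
  -- at 1 and cut off to a set of finite measure. The rescaled differences converge to `f` in `L²`.
  set c : ℝ → ℕ → X → ℝ≥0∞ := fun a k => (spanningSets μ k).indicator fun x =>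
    min (ENNReal.ofReal (a * g x) / ((k : ℝ≥0∞) + 1)) 1 with hc
  have hcm : ∀ a k, Measurable (c a k) := fun a k =>
    Measurable.indicator (((hg.measurable.const_mul a).ennreal_ofReal.div_const _).min
      measurable_const) (measurableSet_spanningSets μ k)
  have hc1 : ∀ a k x, c a k x ≤ 1 := fun a k x =>
    indicator_apply_le' (fun _ => min_le_right _ _) fun _ => zero_le
  have hci : ∀ a k, ∫⁻ x, c a k x ∂μ ≠ ⊤ := fun a k => by
    refine ((lintegral_mono (g := (spanningSets μ k).indicator 1) fun x => ?_).trans_lt ?_).ne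
    · exact indicator_le_indicator (min_le_right _ _)
    · rw [lintegral_indicator_one (measurableSet_spanningSets μ k)]
      exact measure_spanningSets_lt_top μ k
  set F : ℕ → Lp ℝ 2 μ := fun k =>
    ((k : ℝ) + 1) • ((toL2 μ fun x => (c 1 k x).toReal) - toL2 μ fun x => (c (-1) k x).toReal)
    with hF
  have hFk : ∀ k, F k =ᵐ[μ] (spanningSets μ k).indicator fun x =>
      max (min (g x) (k + 1)) (-(k + 1)) := by
    intro k
    filter_upwards [coeFn_toL2 (memLp_toReal_of_le_one (hcm 1 k) (hc1 1 k) (hci 1 k)),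
      coeFn_toL2 (memLp_toReal_of_le_one (hcm (-1) k) (hc1 (-1) k) (hci (-1) k)),
      Lp.coeFn_smul ((k : ℝ) + 1)
        ((toL2 μ fun x => (c 1 k x).toReal) - toL2 μ fun x => (c (-1) k x).toReal),
      Lp.coeFn_sub (toL2 μ fun x => (c 1 k x).toReal) (toL2 μ fun x => (c (-1) k x).toReal)]
      with x h1 h2 h3 h4
    rw [hF]
    dsimp only
    rw [h3, Pi.smul_apply, h4, Pi.sub_apply, h1, h2, hc]
    by_cases hx : x ∈ spanningSets μ k
    · simp only [indicator_of_mem hx, smul_eq_mul]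
      have hk : (0 : ℝ) < (k : ℝ) + 1 := by positivity
      have e : ∀ a : ℝ, (min (ENNReal.ofReal a / ((k : ℝ≥0∞) + 1)) 1).toReal
          = min (max a 0 / ((k : ℝ) + 1)) 1 := fun a => by
        rw [ENNReal.toReal_min (ENNReal.div_ne_top ENNReal.ofReal_ne_top (by simp)) (by simp),
          ENNReal.toReal_div, ENNReal.toReal_ofReal', ENNReal.toReal_add (by simp) (by simp)]
        simp
      rw [e, e, mul_sub, mul_min_of_nonneg _ _ hk.le, mul_min_of_nonneg _ _ hk.le,
        mul_div_cancel₀ _ hk.ne', mul_div_cancel₀ _ hk.ne', one_mul, neg_one_mul, mul_one]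
      rcases le_total 0 (g x) with h0 | h0
      · rw [max_eq_left h0, max_eq_right (neg_nonpos.2 h0), min_eq_left hk.le, sub_zero,
          max_eq_left]
        exact (neg_nonpos.2 hk.le).trans (le_min h0 hk.le)
      · rw [max_eq_right h0, max_eq_left (neg_nonneg.2 h0), min_eq_left hk.le,
          min_eq_left (h0.trans hk.le), zero_sub, ← max_neg_neg, neg_neg]
    · simp [indicator_of_notMem hx]
  have hlim : Tendsto F atTop (𝓝 f) := by
    refine tendsto_Lp_of_dominated hFk hfg hgm.abs (fun k => Eventually.of_forall fun x => ?_)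
      (Eventually.of_forall fun x => ?_)
    · by_cases hx : x ∈ spanningSets μ k
      · rw [indicator_of_mem hx, Pi.abs_apply, abs_le]
        have := neg_abs_le (g x)
        have h2 := le_abs_self (g x)
        have h3 := abs_nonneg (g x)
        have hk : (0 : ℝ) < (k : ℝ) + 1 := by positivity
        refine ⟨?_, max_le ((min_le_left _ _).trans h2) (by linarith)⟩
        refine le_max_of_le_left (le_min this (by linarith))
      · rw [indicator_of_notMem hx, abs_zero]
        exact abs_nonneg _
    · refine tendsto_const_nhds.congr' ?_
      obtain ⟨M, hM⟩ := mem_iUnion.1 ((iUnion_spanningSets μ).symm ▸ mem_univ x)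
      obtain ⟨N, hN⟩ := exists_nat_ge |g x|
      filter_upwards [eventually_ge_atTop M, eventually_ge_atTop N] with k hk hk'
      rw [indicator_of_mem (monotone_spanningSets μ hk hM)]
      have h1 : |g x| ≤ k := hN.trans (by exact_mod_cast hk')
      have h2 := abs_le.1 h1
      rw [min_eq_left (by linarith), max_eq_left (by linarith)]
  have hFP : ∀ k, A (chaosPower μ Q n (F k)) = chaosPower μ Q n (T (F k)) := fun k =>
    hsmul _ _ (hsub _ _ (hcm _ _) (hc1 _ _) (hci _ _) (hcm _ _) (hc1 _ _) (hci _ _))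
  refine tendsto_nhds_unique (f := fun k => A (chaosPower μ Q n (F k)))
    (((A.continuous.comp continuous_chaosPower).tendsto f).comp hlim) ?_
  simp_rw [hFP]
  exact ((continuous_chaosPower.comp T.continuous).tendsto f).comp hlim

/-- Orthogonality to all chaos powers gives orthogonality to exponential vectors. That of minus the
indicator of `A` is a positive multiple of the indicator of a void event, and void events form a
generating π-system. -/
theorem IsPoissonMeasure.eq_zero_of_inner_chaosPower (hQ : IsPoissonMeasure μ Q) {G : Lp ℝ 2 Q}
    (h : ∀ n f, inner ℝ (chaosPower μ Q n f) G = 0) : G = 0 := by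
  have := hQ.isProbabilityMeasure
  have hexp : ∀ f, inner ℝ (expVector μ Q f) G = 0 := fun f => by
    have h1 := (hQ.hasSum_expVector f).mapL (innerSL ℝ G)
    refine (real_inner_comm _ _).trans (h1.unique ?_)
    convert! hasSum_zero using 2 with n
    rw [innerSL_apply_apply, real_inner_smul_right, real_inner_comm, h, mul_zero]
  have hvoid : ∀ A, MeasurableSet A → Bornology.IsBounded A → ∫ γ in voidEvent A, G γ ∂Q = 0 := by
    intro A hA hAb
    have hm : Measurable (A.indicator (1 : X → ℝ≥0∞)) := measurable_one.indicator hA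
    have h1 : ∀ x, A.indicator (1 : X → ℝ≥0∞) x ≤ 1 := fun x => indicator_le_self' (by simp) x
    have hi : ∫⁻ x, A.indicator (1 : X → ℝ≥0∞) x ∂μ ≠ ⊤ := by
      rw [lintegral_indicator_one hA]; exact hAb.measure_lt_top.ne
    have h2 := hexp (-toL2 μ fun x => (A.indicator (1 : X → ℝ≥0∞) x).toReal)
    rw [inner_eq_integral (hQ.coeFn_expVector_neg hm h1 hi)] at h2
    simp_rw [mul_assoc] at h2
    rw [integral_const_mul] at h2
    rw [← integral_indicator (measurableSet_voidEvent hA)]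
    refine Eq.trans (integral_congr_ae (Eventually.of_forall fun γ => ?_))
      ((mul_eq_zero.1 h2).resolve_left (Real.exp_pos _).ne')
    rw [avoidFun_voidEvent]
    by_cases hγ : γ ∈ voidEvent A <;> simp [hγ]
  have hGi : Integrable G Q := (Lp.memLp G).integrable one_le_two
  have huniv : ∫ γ, G γ ∂Q = 0 := by
    have h1 := hvoid ∅ MeasurableSet.empty Bornology.isBounded_empty
    have h2 : voidEvent (∅ : Set X) = univ := eq_univ_of_forall fun γ => inter_empty _
    rwa [h2, Measure.restrict_univ] at h1
  have key : ∀ S, MeasurableSet S → ∫ γ in S, G γ ∂Q = 0 := by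
    intro S hS
    refine MeasurableSpace.induction_on_inter
      (C := fun S _ => ∫ γ in S, G γ ∂Q = 0) config_eq_generateFrom_voidEvent
      isPiSystem_voidEvent (by simp) (fun S hS => ?_) (fun S hS ih => ?_) (fun f hd hf ih => ?_) S hS
    · obtain ⟨A, hA, hAb, rfl⟩ := hS
      exact hvoid A hA hAb
    · have h1 := integral_add_compl hS hGi
      rw [ih, huniv] at h1
      linarith
    · rw [integral_iUnion hf hd hGi.integrableOn]
      simp [ih]
  exact Lp.eq_zero_iff_ae_eq_zero.2
    (hGi.ae_eq_zero_of_forall_setIntegral_eq_zero fun S hS _ => key S hS)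

/-- The defining extension is unique, given a norm bound and totality. The contraction `A` itself
supplies the bound. -/
theorem IsPoissonMeasure.secondQuantization_eq (hQ : IsPoissonMeasure μ Q)
    {A : Lp ℝ 2 Q →L[ℝ] Lp ℝ 2 Q} (hA : ∀ F, ‖A F‖ ≤ ‖F‖)
    (h : ∀ n f, A (chaosPower μ Q n f) = chaosPower μ Q n (T f)) :
    secondQuantization μ Q T = A := by
  have e : A.toLinearMap.comp (Finsupp.linearCombination ℝ
      fun q : ℕ × Lp ℝ 2 μ => multipleIntegral μ Q q.1 (tensorPower μ q.1 q.2))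
      = Finsupp.linearCombination ℝ
        fun q : ℕ × Lp ℝ 2 μ => multipleIntegral μ Q q.1 (tensorPower μ q.1 (T q.2)) := by
    ext q : 2
    simpa [chaosPower] using h q.1 q.2
  refine LinearMap.extendOfNorm_unique (denseRange_linearCombination _ fun G hG =>
    hQ.eq_zero_of_inner_chaosPower fun n f => hG (n, f)) 1 (fun x => ?_) A e
  rw [← e, one_mul]
  exact hA _

/-- The second quantization of a symmetric Markov operator is the Koopman operator of the system of
independent particles. -/
theorem IsPoissonMeasure.secondQuantization_eq_koopman [IsProbabilityMeasure Q]
    (hQ : IsPoissonMeasure μ Q) (hinv : K ∘ₘ Q = Q)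
    (hK : ∀ h : X → ℝ≥0∞, Measurable h → (∀ x, h x ≤ 1) →
      ∀ᵐ γ ∂Q, ∫⁻ ξ, avoidFun h ξ ∂(K γ) = avoidFun (fun y => ∫⁻ u, h u ∂(κ y)) γ)
    (hκ : ∀ h : X → ℝ≥0∞, Measurable h → (∀ x, h x ≤ 1) → ∫⁻ x, h x ∂μ ≠ ⊤ →
      ∫⁻ x, ∫⁻ y, h y ∂(κ x) ∂μ = ∫⁻ x, h x ∂μ)
    (hT : ∀ h : X → ℝ≥0∞, Measurable h → (∀ x, h x ≤ 1) → ∫⁻ x, h x ∂μ ≠ ⊤ →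
      T (toL2 μ fun x => (h x).toReal) =ᵐ[μ] fun x => (∫⁻ y, h y ∂(κ x)).toReal) :
    secondQuantization μ Q T = koopman hinv := by
  refine hQ.secondQuantization_eq (norm_koopman_le hinv) fun n => ?_
  refine map_chaosPower_of_nonneg fun u hu hu1 hui => ?_
  -- The exponential formula is available for `-u`; the sign enters as `(-1) ^ n` on both sides and
  -- cancels.
  have h1 := hQ.map_chaosPower_of_map_expVector (T := T) (A := koopman hinv)
    (f := -toL2 μ fun x => (u x).toReal) (fun s hs0 hs1 => ?_) n
  · rw [← neg_one_smul ℝ, chaosPower_smul, map_smul, map_smul, chaosPower_smul] at h1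
    exact smul_right_injective _ (pow_ne_zero n (by norm_num : (-1 : ℝ) ≠ 0)) h1
  · set w : X → ℝ≥0∞ := fun x => ENNReal.ofReal s * u x with hw
    have hs1' : ENNReal.ofReal s ≤ 1 := ENNReal.ofReal_le_one.2 hs1
    have hwm : Measurable w := hu.const_mul _
    have hw1 : ∀ x, w x ≤ 1 := fun x => mul_le_one' hs1' (hu1 x)
    have hwi : ∫⁻ x, w x ∂μ ≠ ⊤ := by
      rw [hw, lintegral_const_mul _ hu]
      exact ENNReal.mul_ne_top ENNReal.ofReal_ne_top hui
    have e : s • -toL2 μ (fun x => (u x).toReal) = -toL2 μ fun x => (w x).toReal := by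
      rw [smul_neg, neg_inj]
      refine (toL2_ext (memLp_toReal_of_le_one hwm hw1 hwi) ?_).symm
      filter_upwards [coeFn_toL2 (memLp_toReal_of_le_one hu hu1 hui),
        Lp.coeFn_smul s (toL2 μ fun x => (u x).toReal)] with x h2 h3
      rw [h3, Pi.smul_apply, h2, hw, ENNReal.toReal_mul, ENNReal.toReal_ofReal hs0.le, smul_eq_mul]
    rw [e, hQ.koopman_expVector hinv hK hκ hT hwm hw1 hwi, map_neg]

end Identification

end
end InfiniteParticles

namespace InfiniteParticles

noncomputable section

/-! ### Poisson configurations lie in `Theta` -/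

section PoissonGrowth

variable {X : Type*} [MetricSpace X] [ProperSpace X] [MeasurableSpace X] [BorelSpace X]
  {Q : Measure (Config X)}

/-- The variances divided by `4 ^ k` are summable, so almost surely the sum of the squared
normalized deviations is finite and bounds all deviations by a multiple of `2 ^ k` at once. -/
theorem IsPoissonMeasure.ae_exists_encard_le {μ : Measure X} (hQ : IsPoissonMeasure μ Q)
    {D : ℕ → Set X} (hD : ∀ k, MeasurableSet (D k)) {z : ℝ≥0} (hμ : ∀ k, μ (D k) ≤ z * 2 ^ k) :
    ∀ᵐ γ ∂Q, ∃ L : ℝ≥0, ∀ k, ((γ.1 ∩ D k).encard : ℝ≥0∞) ≤ L * 2 ^ k := by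
  have hfin : ∀ k, μ (D k) ≠ ⊤ := fun k =>
    ((hμ k).trans_lt (ENNReal.mul_lt_top ENNReal.coe_lt_top (by simp))).ne
  set f : ℕ → Config X → ℝ≥0∞ := fun k γ => ENNReal.ofReal (compCount μ (D k) γ ^ 2) / 4 ^ k with hf
  have hfm : ∀ k, Measurable (f k) := fun k =>
    ((measurable_compCount (hD k)).pow_const 2).ennreal_ofReal.div_const _
  have hfk : ∀ k, ∫⁻ γ, f k γ ∂Q ≤ z * 2⁻¹ ^ k := fun k => by
    have h1 : ∫⁻ γ, f k γ ∂Q = μ (D k) / 4 ^ k := by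
      simp only [hf, div_eq_mul_inv]
      rw [lintegral_mul_const _ ((measurable_compCount (hD k)).pow_const 2).ennreal_ofReal,
        ← ofReal_integral_eq_lintegral_ofReal (hQ.integrable_compCount_sq (hD k) (hfin k))
          (Eventually.of_forall fun γ => sq_nonneg _), hQ.integral_compCount_sq (hD k) (hfin k),
        ofReal_measureReal (hfin k)]
    rw [h1]
    refine ENNReal.div_le_of_le_mul ((hμ k).trans_eq ?_)
    rw [mul_assoc, ← mul_pow, show (2 : ℝ≥0∞)⁻¹ * 4 = 2 by
      rw [show (4 : ℝ≥0∞) = 2 * 2 by norm_num, ← mul_assoc,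
        ENNReal.inv_mul_cancel (by simp) (by simp), one_mul]]
  have hsum : ∫⁻ γ, ∑' k, f k γ ∂Q ≠ ⊤ := by
    rw [lintegral_tsum fun k => (hfm k).aemeasurable]
    refine ((ENNReal.tsum_le_tsum hfk).trans_lt ?_).ne
    rw [ENNReal.tsum_mul_left, ENNReal.tsum_geometric, ENNReal.one_sub_inv_two, inv_inv]
    exact ENNReal.mul_lt_top ENNReal.coe_lt_top (by simp)
  filter_upwards [ae_lt_top (Measurable.tsum hfm) hsum,
    ae_all_iff.2 fun k => hQ.ae_finite_inter (hD k) (hfin k)] with γ hγ hγf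
  set s : ℝ := (∑' k, f k γ).toReal with hs
  have hs0 : 0 ≤ s := ENNReal.toReal_nonneg
  refine ⟨(z + (1 + s)).toNNReal, fun k => ?_⟩
  have h1 : f k γ ≤ ENNReal.ofReal s := by
    rw [hs, ENNReal.ofReal_toReal hγ.ne]
    exact ENNReal.le_tsum k
  have h2 : compCount μ (D k) γ ^ 2 ≤ s * 4 ^ k := by
    have h3 := (ENNReal.div_le_iff (by simp) (by simp)).1 h1
    rw [show (4 : ℝ≥0∞) ^ k = ENNReal.ofReal (4 ^ k) by
      rw [ENNReal.ofReal_pow (by norm_num)]; norm_num, ← ENNReal.ofReal_mul hs0] at h3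
    exact (ENNReal.ofReal_le_ofReal_iff (by positivity)).1 h3
  -- Uses `s ≤ (1 + s)²` in place of a square root.
  have h3 : compCount μ (D k) γ ≤ (1 + s) * 2 ^ k := by
    refine le_of_sq_le_sq (h2.trans ?_) (by positivity)
    rw [mul_pow, show (4 : ℝ) ^ k = (2 ^ k) ^ 2 by rw [← pow_mul, mul_comm, pow_mul]; norm_num]
    exact mul_le_mul_of_nonneg_right (by nlinarith) (by positivity)
  have h4 : μ.real (D k) ≤ z * 2 ^ k := by
    have := ENNReal.toReal_mono (ENNReal.mul_ne_top ENNReal.coe_ne_top (by simp)) (hμ k)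
    simpa [Measure.real] using this
  have h5 : ((γ.1 ∩ D k).ncard : ℝ) ≤ (z + (1 + s)) * 2 ^ k := by
    rw [compCount] at h3
    linarith
  rw [← (hγf k).cast_ncard_eq]
  have h6 := ENNReal.ofReal_le_ofReal h5
  rw [ENNReal.ofReal_natCast, ENNReal.ofReal_mul (by positivity),
    ENNReal.ofReal_pow (by norm_num)] at h6
  simpa [ENNReal.ofReal] using h6

/-- The inverse volumes of the balls `B(r)` need not be summable, so balls are grouped by volume:
the union of those of volume at most `2 ^ k` again has volume at most `2 ^ k`. The least such `k`
for `B(r)` gives a linear bound in the volume, and `α ≥ 1` weakens it to the power `α`. -/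
theorem IsPoissonMeasure.ae_mem_Theta {v : Measure X} {x₀ : X} {z : ℝ≥0}
    (hQ : IsPoissonMeasure (z • v) Q) (hlt : ∀ r, v (Metric.closedBall x₀ r) < ⊤)
    (hpos : 0 < v (Metric.closedBall x₀ 1)) {α : ℝ} (hα : 1 ≤ α) :
    ∀ᵐ γ ∂Q, γ ∈ Theta v x₀ α := by
  set V := v (Metric.closedBall x₀ 1) with hV
  have hVt : V ≠ ⊤ := (hlt 1).ne
  set R : ℕ → Set ℕ := fun k => {r | v (Metric.closedBall x₀ (r : ℝ)) ≤ 2 ^ k} with hR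
  have hmono : Monotone fun r : ℕ => Metric.closedBall x₀ (r : ℝ) := fun i j hij =>
    Metric.closedBall_subset_closedBall (by exact_mod_cast hij)
  have hle : ∀ k, (z • v) (⋃ r ∈ R k, Metric.closedBall x₀ (r : ℝ)) ≤ z * 2 ^ k := fun k => by
    have h1 : v (⋃ r ∈ R k, Metric.closedBall x₀ (r : ℝ)) ≤ 2 ^ k := by
      rw [measure_biUnion_eq_iSup (to_countable _)]
      · exact iSup₂_le fun r hr => hr
      · intro i hi j hj
        rcases le_total i j with h | h
        · exact ⟨j, hj, hmono h, Subset.rfl⟩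
        · exact ⟨i, hi, Subset.rfl, hmono h⟩
    rw [Measure.smul_apply, ENNReal.smul_def, smul_eq_mul]
    gcongr
  filter_upwards [hQ.ae_exists_encard_le (fun k => MeasurableSet.biUnion (to_countable _)
    fun r _ => Metric.isClosed_closedBall.measurableSet) hle] with γ ⟨L, hL⟩
  have hlin : ∀ r : ℕ, 1 ≤ r → ((γ.1 ∩ Metric.closedBall x₀ (r : ℝ)).encard : ℝ≥0∞)
      ≤ (L / V + 2 * L) * v (Metric.closedBall x₀ r) := by
    intro r hr
    have hex : ∃ k : ℕ, v (Metric.closedBall x₀ (r : ℝ)) ≤ 2 ^ k := by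
      obtain ⟨k, hk⟩ := ENNReal.exists_nat_gt (hlt r).ne
      exact ⟨k, hk.le.trans (by exact_mod_cast Nat.lt_two_pow_self.le)⟩
    classical
    have hk := Nat.find_spec hex
    have h1 : ((γ.1 ∩ Metric.closedBall x₀ (r : ℝ)).encard : ℝ≥0∞) ≤ L * 2 ^ Nat.find hex :=
      (ENat.toENNReal_mono (encard_le_encard (inter_subset_inter_right _
        (subset_biUnion_of_mem (u := fun r : ℕ => Metric.closedBall x₀ (r : ℝ)) hk)))).trans (hL _)
    have hVr : V ≤ v (Metric.closedBall x₀ (r : ℝ)) :=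
      measure_mono (Metric.closedBall_subset_closedBall (by exact_mod_cast hr))
    rw [add_mul]
    -- For `k = 0` there is no lower dyadic bound on the volume; it is at least `V` instead.
    -- Otherwise minimality gives volume greater than `2 ^ (k - 1)`, whence the factor 2.
    rcases Nat.eq_zero_or_pos (Nat.find hex) with h0 | h0
    · rw [h0, pow_zero, mul_one] at h1
      refine h1.trans (le_add_right ?_)
      calc (L : ℝ≥0∞) = L / V * V := (ENNReal.div_mul_cancel hpos.ne' hVt).symm
        _ ≤ _ := by gcongr
    · refine h1.trans (le_add_left ?_)
      have h2 := Nat.find_min hex (Nat.sub_lt h0 one_pos)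
      rw [not_le] at h2
      obtain ⟨j, hj⟩ := Nat.exists_eq_succ_of_ne_zero h0.ne'
      rw [hj, Nat.succ_sub_one] at h2
      rw [hj, pow_succ', ← mul_assoc, mul_comm (L : ℝ≥0∞) 2]
      gcongr
  have hα0 : 0 < α := by linarith
  have hVα0 : V ^ α ≠ 0 := by
    rw [ne_eq, ENNReal.rpow_eq_zero_iff_of_pos hα0]; exact hpos.ne'
  have hVαt : V ^ α ≠ ⊤ := ENNReal.rpow_ne_top_of_nonneg hα0.le hVt
  obtain ⟨K, hK⟩ := ENNReal.exists_nat_gt (r := (L / V + 2 * L) * (V / V ^ α))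
    (ENNReal.mul_ne_top (ENNReal.add_ne_top.2 ⟨ENNReal.div_ne_top ENNReal.coe_ne_top hpos.ne',
      ENNReal.mul_ne_top (by simp) ENNReal.coe_ne_top⟩) (ENNReal.div_ne_top hVt hVα0))
  refine ⟨K, fun r hr => (hlin r hr).trans ?_⟩
  have hVr : V ≤ v (Metric.closedBall x₀ (r : ℝ)) :=
    measure_mono (Metric.closedBall_subset_closedBall (by exact_mod_cast hr))
  set w := v (Metric.closedBall x₀ (r : ℝ)) with hw
  have h1 : w ≤ V / V ^ α * w ^ α := by
    have h2 : w / V ≤ (w / V) ^ α := by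
      have h3 : (1 : ℝ≥0∞) ≤ w / V := (ENNReal.le_div_iff_mul_le (Or.inl hpos.ne') (Or.inl hVt)).2
        (by rwa [one_mul])
      calc w / V = (w / V) ^ (1 : ℝ) := (ENNReal.rpow_one _).symm
        _ ≤ _ := ENNReal.rpow_le_rpow_of_exponent_le h3 hα
    rw [ENNReal.div_rpow_of_nonneg _ _ hα0.le] at h2
    calc w = V * (w / V) := (ENNReal.mul_div_cancel hpos.ne' hVt).symm
      _ ≤ V * (w ^ α / V ^ α) := by gcongr
      _ = _ := by rw [div_eq_mul_inv, div_eq_mul_inv]; ring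
  calc (L / V + 2 * L) * w ≤ (L / V + 2 * L) * (V / V ^ α * w ^ α) := by gcongr
    _ = (L / V + 2 * L) * (V / V ^ α) * w ^ α := by rw [mul_assoc]
    _ ≤ K * w ^ α := by gcongr

end PoissonGrowth

/-! ### The particle system and the second quantization -/

section IndependentParticles

variable {X : Type*} [MetricSpace X] [ProperSpace X] [MeasurableSpace X] [BorelSpace X]
  {v : Measure X} {x₀ : X} {m : ℕ} {C α : ℝ} {κ : Kernel X X} [IsMarkovKernel κ]

open Classical in
/-- The law of the independent particles started at a configuration of `Theta`; other
configurations do not move. -/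
def particleKernel (v : Measure X) (x₀ : X) (α : ℝ) (κ : Kernel X X) [IsMarkovKernel κ] :
    Kernel (Config X) (Config X) :=
  -- Outside `Theta` the points might accumulate and the law lose mass; standing still there makes
  -- the kernel Markov everywhere, as the operator on `L²` requires.
  Kernel.piecewise (measurableSet_Theta v x₀ α) (cfgKernel x₀ κ) Kernel.id

theorem particleKernel_of_mem {γ : Config X} (hγ : γ ∈ Theta v x₀ α) :
    particleKernel v x₀ α κ γ = cfgKernel x₀ κ γ := by
  classical
  rw [particleKernel, Kernel.piecewise_apply, if_pos hγ]

theorem HasVolumeGrowth.isMarkovKernel_particleKernel (hv : HasVolumeGrowth v x₀ m C) (hm : 1 ≤ m)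
    (hα : 1 ≤ α) (hκ : SummableTails (1 / (α * m)) κ) (hco : NonCoinciding κ) :
    IsMarkovKernel (particleKernel v x₀ α κ) := by
  refine ⟨fun γ => ?_⟩
  classical
  rw [particleKernel, Kernel.piecewise_apply]
  split_ifs with hγ
  · exact hv.isProbabilityMeasure_cfgKernel hm hα hγ hκ hco
  · rw [Kernel.id_apply]; infer_instance

theorem HasVolumeGrowth.lintegral_avoidFun_particleKernel (hv : HasVolumeGrowth v x₀ m C)
    (hm : 1 ≤ m) (hα : 1 ≤ α) (hκ : SummableTails (1 / (α * m)) κ) (hco : NonCoinciding κ)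
    {γ : Config X} (hγ : γ ∈ Theta v x₀ α) {h : X → ℝ≥0∞} (hh : Measurable h) (h1 : ∀ x, h x ≤ 1) :
    ∫⁻ ξ, avoidFun h ξ ∂(particleKernel v x₀ α κ γ) = avoidFun (fun y => ∫⁻ u, h u ∂(κ y)) γ := by
  have hx := isNumeration_enum x₀ γ
  rw [particleKernel_of_mem hγ, hv.cfgKernel_eq_map hm hα hγ hκ hco hx γ]
  exact lintegral_avoidFun_map_toConfig κ hh h1 hx (hv.ae_mem_goodSeq hm hα hγ hκ hco hx)

/-- Almost every configuration lies in `Theta`, where the total kernel agrees with `thetaKernel`;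
the identification with the Koopman operator then gives the formula. -/
theorem HasVolumeGrowth.secondQuantization_ae_eq (hv : HasVolumeGrowth v x₀ m C)
    (hm : 1 ≤ m) (hα : 1 ≤ α) (hκ : SummableTails (1 / (α * m)) κ) (hco : NonCoinciding κ)
    {z : ℝ≥0} [IsLocallyFiniteMeasure (z • v)] {T : Lp ℝ 2 (z • v) →L[ℝ] Lp ℝ 2 (z • v)}
    (hsa : IsSelfAdjoint T) (hT : IsMarkovOperator T)
    (hc : ∀ f : X → ℝ, Measurable f → ∀ hf : MemLp f 2 (z • v),
      T (hf.toLp f) =ᵐ[z • v] fun x => ∫ y, f y ∂(κ x))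
    {Q : Measure (Config X)} (hQ : IsPoissonMeasure (z • v) Q) {F : Config X → ℝ}
    (hF : MemLp F 2 Q) :
    ∀ᵐ γ ∂Q, ∃ hγ : γ ∈ Theta v x₀ α,
      Integrable (fun ξ => F ξ.1) (thetaKernel v x₀ α κ ⟨γ, hγ⟩) ∧
      secondQuantization (z • v) Q T (hF.toLp F) γ
        = ∫ ξ, F ξ.1 ∂(thetaKernel v x₀ α κ ⟨γ, hγ⟩) := by
  have := hQ.isProbabilityMeasure
  have := hv.isMarkovKernel_particleKernel hm hα hκ hco
  have hΘ := hQ.ae_mem_Theta hv.lt_top (hv.pos 1 one_pos) hα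
  have hK : ∀ h : X → ℝ≥0∞, Measurable h → (∀ x, h x ≤ 1) → ∀ᵐ γ ∂Q,
      ∫⁻ ξ, avoidFun h ξ ∂(particleKernel v x₀ α κ γ) = avoidFun (fun y => ∫⁻ u, h u ∂(κ y)) γ :=
    fun h hh h1 => hΘ.mono fun γ hγ =>
      hv.lintegral_avoidFun_particleKernel hm hα hκ hco hγ hh h1
  have hκ' := fun (h : X → ℝ≥0∞) (hh : Measurable h) (h1 : ∀ x, h x ≤ 1)
    (hi : ∫⁻ x, h x ∂(z • v) ≠ ⊤) => lintegral_lintegral_of_corresponds hsa hT hc hh h1 hi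
  have hinv := hQ.comp_eq hK hκ'
  rw [hQ.secondQuantization_eq_koopman hinv hK hκ' fun h hh h1 hi =>
    coeFn_of_corresponds hc hh h1 hi]
  filter_upwards [hΘ, ae_memLp_of_invariant hinv hF, coeFn_koopman hinv hF.coeFn_toLp]
    with γ hγ h1 h2
  have hemb := MeasurableEmbedding.subtype_coe (measurableSet_Theta v x₀ α)
  have e := (hv.thetaKernel_map hm hα hκ hco ⟨γ, hγ⟩).trans (particleKernel_of_mem hγ).symm
  refine ⟨hγ, ?_, ?_⟩
  · have h3 := h1.integrable one_le_two
    rw [← e] at h3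
    exact hemb.integrable_map_iff.1 h3
  · rw [h2, ← e, hemb.integral_map]

end IndependentParticles

end
end InfiniteParticles

theorem mainTheorem2
    -- a complete connected smooth Riemannian manifold of infinite volume
    {d : ℕ} {X : Type*} [MetricSpace X] [ChartedSpace (EuclideanSpace ℝ (Fin d)) X]
    [IsManifold (𝓡 d) ∞ X] [SecondCountableTopology X]
    [Bundle.RiemannianBundle (fun x : X => TangentSpace (𝓡 d) x)]
    [IsContMDiffRiemannianBundle (𝓡 d) ∞ (EuclideanSpace ℝ (Fin d))
      (fun x : X => TangentSpace (𝓡 d) x)]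
    [IsRiemannianManifold (𝓡 d) X] [CompleteSpace X] [ConnectedSpace X]
    [MeasurableSpace X] [BorelSpace X]
    (hvol : riemannianVolume d X univ = ⊤)
    -- the volume growth condition
    (x₀ : X) (m : ℕ) (hm : 1 ≤ m) (C : ℝ) (hC : 0 < C)
    (hgrowth : ∀ r β : ℝ, 0 < r → 1 ≤ β →
      riemannianVolume d X (Metric.closedBall x₀ (β * r))
        ≤ ENNReal.ofReal (C * β ^ m) * riemannianVolume d X (Metric.closedBall x₀ r))
    -- the semigroup of kernels, non-coincidence, and summability of the tails
    (p : ℝ≥0 → Kernel X X) (hp : IsMarkovSemigroup p)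
    (hcoin : ∀ t, 0 < t → ∀ x y, x ≠ y → ((p t x).prod (p t y)) {q : X × X | q.1 = q.2} = 0)
    (α : ℝ) (hα : 1 ≤ α)
    (htail : ∃ ε : ℝ≥0, 0 < ε ∧ ∀ t, 0 < t → t < ε → ∀ δ : ℝ, 0 < δ →
      ∑' n : ℕ, ⨆ x : X,
        p t x (Metric.closedBall x (δ * ((n + 1 : ℕ) : ℝ) ^ (1 / (α * m))))ᶜ < ⊤) :
    (∀ γ ∈ Theta (riemannianVolume d X) x₀ α,
      (∀ t, 0 < t → ∀ r : ℕ, ∑' x : γ.1, p t x.1 (Metric.closedBall x₀ r) < ⊤) ∧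
      (∀ t, ∀ x : ℕ → X, IsNumeration x γ →
        IsProbabilityMeasure (configLaw fun n => p t (x n)))) ∧
    ∃ P : ℝ≥0 → Kernel (Theta (riemannianVolume d X) x₀ α) (Theta (riemannianVolume d X) x₀ α),
      -- `P t γ` is the law of the independent particles started from the points of `γ`
      (∀ t γ, ∀ x : ℕ → X, IsNumeration x γ.1 →
        (P t γ).map Subtype.val = configLaw fun n => p t (x n)) ∧
      IsMarkovSemigroup P ∧
      ∀ z : ℝ≥0, 0 < z →
        ∀ T : ℝ≥0 → Lp ℝ 2 (z • riemannianVolume d X) →L[ℝ] Lp ℝ 2 (z • riemannianVolume d X),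
        IsMarkovL2Semigroup T → Corresponds T p →
        ∀ Q : Measure (Config X), IsPoissonMeasure (z • riemannianVolume d X) Q →
        ∀ t, 0 < t → ∀ (F : Config X → ℝ) (hF : MemLp F 2 Q),
          ∀ᵐ γ ∂Q, ∃ hγ : γ ∈ Theta (riemannianVolume d X) x₀ α,
            Integrable (fun ξ => F ξ.1) (P t ⟨γ, hγ⟩) ∧
            secondQuantization (z • riemannianVolume d X) Q (T t) (hF.toLp F) γ
              = ∫ ξ, F ξ.1 ∂(P t ⟨γ, hγ⟩) := by

  have : LocallyCompactSpace X := Manifold.locallyCompact_of_finiteDimensional (𝓡 d)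
  -- Completeness enters only here, to make closed balls compact.
  have : ProperSpace X := (approxGeodesic_of_isRiemannianManifold (d := d)).properSpace
  have hv : HasVolumeGrowth (riemannianVolume d X) x₀ m C := hasVolumeGrowth_of_univ_eq_top hC
    hgrowth (exists_riemannianVolume_closedBall_lt_top x₀) hvol
  have := hp.markov
  have hκ : ∀ t, SummableTails (1 / (α * m)) (p t) := by
    obtain ⟨ε, hε, h⟩ := htail
    exact hp.summableTails hε h
  have hco : ∀ t, NonCoinciding (p t) := fun t x y hxy => by
    -- Non-coincidence is assumed only for positive times; at time 0 it holds for Dirac measures at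
    -- distinct points.
    rcases eq_or_ne t 0 with rfl | ht
    · rw [hp.zero, Kernel.id_apply, Kernel.id_apply, Measure.dirac_prod_dirac,
        Measure.dirac_apply' _ (measurableSet_eq_fun measurable_fst measurable_snd),
        indicator_of_notMem (show (x, y) ∉ {q : X × X | q.1 = q.2} from hxy)]
    · exact hcoin t (pos_iff_ne_zero.2 ht) x y hxy
  refine ⟨fun γ hγ => ⟨fun t _ r => ?_, fun t x hx => ?_⟩,
    fun t => thetaKernel (riemannianVolume d X) x₀ α (p t), fun t γ x hx => ?_,
    hv.isMarkovSemigroup_thetaKernel hm hα hp hκ hco, ?_⟩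
  · have hx := isNumeration_enum x₀ γ
    rw [← lintegral_cfgMeasure γ fun x => p t x (Metric.closedBall x₀ r), hx.lintegral_cfgMeasure]
    exact hv.tsum_closedBall_lt_top hm hα hγ (hκ t) hx r
  · rw [← hv.cfgKernel_eq hm hα hγ (hκ t) (hco t) hx]
    exact hv.isProbabilityMeasure_cfgKernel hm hα hγ (hκ t) (hco t)
  · rw [hv.thetaKernel_map hm hα (hκ t) (hco t), hv.cfgKernel_eq hm hα γ.2 (hκ t) (hco t) hx]
  · intro z _ T hT hTp Q hQ t _ F hF
    have hloc : IsLocallyFiniteMeasure (z • riemannianVolume d X) := ⟨fun x => by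
      refine ⟨Metric.closedBall x₀ (dist x x₀ + 1), Filter.mem_of_superset
        (Metric.ball_mem_nhds x one_pos) fun y hy => ?_, ?_⟩
      · rw [Metric.mem_ball] at hy
        rw [Metric.mem_closedBall]
        linarith [dist_triangle y x x₀]
      · rw [Measure.smul_apply, ENNReal.smul_def, smul_eq_mul]
        exact ENNReal.mul_lt_top ENNReal.coe_lt_top (hv.lt_top _)⟩
    exact hv.secondQuantization_ae_eq hm hα (hκ t) (hco t) (hT.selfAdjoint t) (hT.markov t)
      (hTp t) hQ hF
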